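/- **Setting.** Let $\Gamma=\mathbb R^2/\mathbb Z^2$ be the flat torus and let $\Omega\subset\mathbb R^3$ be a bounded domain of class $C^4$ with $\partial\Omega=\varphi(\Gamma)$, where $\varphi$ is an injective $C^4$ immersion of $\Gamma$ such that $\nu=\frac{\partial_1\varphi\times\partial_2\varphi}{|\partial_1\varphi\times\partial_2\varphi|}$ is the unit outward normal. Let $a<0<b$ be such that $(y,z)\mapsto\varphi(y)+z\nu(y)$ is injective on $\Gamma\times(a,b)$. On the image $N$ of this map let $\pi$ be the projection to $\partial\Omega$ and $d$ the signed distance, so that $x=\pi(x)+d(x)\,\nu(\varphi^{-1}(\pi(x)))$ and $d(x)\in(a,b)$. Fix $a<m''<m'<m<0<\bar m<\bar m'<\bar m''<b$ and let $f_\Gamma=f*\omega$, where $f=1$ on $[m''-m',\bar m''-\bar m']$, $f=0$ outside $(m'',\bar m'')$, $f$ is affine on each of the two remaining intervals and continuous, and $\omega\ge0$ is a smooth kernel with integral $1$ and support in $(-\alpha,\alpha)$, where $0<\alpha<\frac12\min\{m'-m'',\bar m''-\bar m'\}$ and $a<m''-\alpha$, $\bar m''+\alpha<b$. Let $T>0$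 and let $\eta\in L^\infty(0,T;W^{2,2}(\Gamma))\cap W^{1,\infty}(0,T;L^2(\Gamma))$ (identified with its continuous representative on $[0,T]\times\Gamma$) satisfy $m\le\eta\le\bar m$. For $t\in[0,T]$ put $\Omega_\eta(t)=\tilde\varphi_\eta(t,\Omega)$, where $$\tilde\varphi_\eta(t,x)=x+f_\Gamma(d(x))\,\eta\big(t,\varphi^{-1}(\pi(x))\big)\,\nu\big(\varphi^{-1}(\pi(x))\big)\ \text{ for }x\in N,\qquad \tilde\varphi_\eta(t,x)=x\ \text{ for }x\notin N ,$$ and put $Q=\{(t,x):t\in(0,T),\ x\in\Omega_\eta(t)\}$. Let $B=\Omega\cup S$, where $S\subset N$ is an open set containing the compact set $\{\varphi(y)+z\nu(y):y\in\Gamma,\ m\le z\le\bar m\}$. For $p,s\in[1,\infty]$, $L^p(0,T;L^s(\Omega_\eta(t)))$ denotes the set of $v\in L^1(Q)$ with $v(t)\in L^s(\Omega_\eta(t))$ for a.e. $t$ and $t\mapsto\|v(t)\|_{L^s(\Omega_\eta(t))}\in L^p(0,T)$. **Lemma.** Let $M\ge1$, $\gamma_1,\dots,\gamma_M\in[2,\infty]$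 and $\mathfrak m=\min_i\gamma_i$. Let $r^{(i)}\in L^\infty(0,T;L^{\gamma_i}(\Omega_\eta(t)))$ with $r^{(i)}\ge0$ a.e. in $Q$, $i=1,\dots,M$, and let $u\in L^2(0,T;W^{1,q}(B))^3$, where $q\in[1,2)$ with $\frac1{\mathfrak m}+\frac1q\le1$ if $\mathfrak m>2$, and $q=2$ if $\mathfrak m=2$. Suppose that for each $i$ $$\int_0^T\int_{\Omega_\eta(s)}r^{(i)}\,(\partial_t\phi+u\cdot\nabla\phi)\,dx\,ds=0\qquad\text{for all }\phi\in C_c^\infty((0,T)\times\mathbb R^3).$$ Then $r=(r^{(1)},\dots,r^{(M)})$ has a representative (equal to $r$ a.e. in $Q$, again denoted by $r$), with $r^{(i)}(t)\in L^{\gamma_i}(\Omega_\eta(t))$ and $r^{(i)}(t)\ge0$ a.e. in $\Omega_\eta(t)$ for every $t\in[0,T]$ and every $i$, such that for every $\mathcal B\in C^1([0,\infty)^M)$ with $\nabla\mathcal B\in L^\infty((0,\infty)^M)$ and $\mathcal B(0)=0$, every $\phi\in C^\infty([0,T]\times\mathbb R^3)$ and every $t\in[0,T]$, $$\int_0^t\int_{\Omega_\eta(s)}\Big[\mathcal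 B(r)(\partial_t\phi+u\cdot\nabla\phi)-\big(\nabla\mathcal B(r)\cdot r-\mathcal B(r)\big)\,\operatorname{div}u\;\phi\Big]dx\,ds=\int_{\Omega_\eta(t)}\mathcal B(r(t))\,\phi(t)\,dx-\int_{\Omega_\eta(0)}\mathcal B(r(0))\,\phi(0)\,dx ,$$ where all integrals converge absolutely. -/

import Mathlib

open MeasureTheory Set
open scoped ENNReal
open scoped ContDiff

noncomputable section

/-- The plane, universal cover of the flat torus `Γ = ℝ² / ℤ²`. -/
abbrev R2 : Type := EuclideanSpace ℝ (Fin 2)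

/-- The physical space. -/
abbrev R3 : Type := EuclideanSpace ℝ (Fin 3)

/-! ### The torus -/

/-- Two points of the plane represent the same point of the torus `Γ = ℝ² / ℤ²`. -/
def TorusEq (x y : R2) : Prop := ∀ i, ∃ n : ℤ, x i - y i = n

/-- `f` is (the lift of) a function on the torus. -/
def TorusPeriodic {α : Type*} (f : R2 → α) : Prop := ∀ x y, TorusEq x y → f x = f y

/-- The fundamental cell `(0,1)²`; it has full measure in the torus. -/
def torusCell : Set R2 := {y | ∀ i, y i ∈ Ioo (0 : ℝ) 1}

/-! ### Function spaces -/

/-- The space-time domain `⋃_{t ∈ (0,T)} {t} × A(t)`. -/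
def spaceTime {V : Type*} (T : ℝ) (A : ℝ → Set V) : Set (ℝ × V) :=
  {p | p.1 ∈ Ioo (0 : ℝ) T ∧ p.2 ∈ A p.1}

/-- `v ∈ L^p(0,T; L^q(A(t)))` for a family of domains `A(t)`: `v` is integrable on the space-time
domain, `v(t) ∈ L^q(A(t))` for a.e. `t`, and `t ↦ ‖v(t)‖_{L^q(A(t))}` is in `L^p(0,T)`. -/
structure MemLpLq {V F : Type*} [MeasureSpace V] [NormedAddCommGroup F]
    (T : ℝ) (A : ℝ → Set V) (p q : ℝ≥0∞) (v : ℝ → V → F) : Prop where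
  integrableOn : IntegrableOn (fun z : ℝ × V => v z.1 z.2) (spaceTime T A)
  memLp : ∀ᵐ t ∂(volume.restrict (Ioo (0 : ℝ) T)), MemLp (v t) q (volume.restrict (A t))
  norm_lt_top : eLpNorm (fun t => eLpNorm (v t) q (volume.restrict (A t))) p
    (volume.restrict (Ioo (0 : ℝ) T)) < ⊤

/-- `G` is the weak (distributional) gradient of `f` on the open set `U`. -/
structure HasWeakGradient {V F : Type*} [NormedAddCommGroup V] [NormedSpace ℝ V] [MeasureSpace V]
    [NormedAddCommGroup F] [NormedSpace ℝ F] (U : Set V) (f : V → F) (G : V → V →L[ℝ] F) :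
    Prop where
  locallyIntegrableOn : LocallyIntegrableOn f U
  locallyIntegrableOn_grad : LocallyIntegrableOn G U
  integral_eq : ∀ ψ : V → ℝ, ContDiff ℝ ∞ ψ → HasCompactSupport ψ → tsupport ψ ⊆ U → ∀ e : V,
    ∫ x in U, (fderiv ℝ ψ x e) • f x = -∫ x in U, ψ x • G x e

/-- `u ∈ L^p(0,T; W^{1,q}(U))`, with weak spatial gradient `Du`. -/
structure MemLpW1 {V F : Type*} [NormedAddCommGroup V] [NormedSpace ℝ V] [MeasureSpace V]
    [NormedAddCommGroup F] [NormedSpace ℝ F] (T : ℝ) (U : Set V) (p q : ℝ≥0∞)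
    (u : ℝ → V → F) (Du : ℝ → V → V →L[ℝ] F) : Prop where
  memLpLq : MemLpLq T (fun _ => U) p q u
  memLpLq_grad : MemLpLq T (fun _ => U) p q Du
  weakGradient : ∀ᵐ t ∂(volume.restrict (Ioo (0 : ℝ) T)), HasWeakGradient U (u t) (Du t)

/-- `η ∈ L^∞(0,T; W^{2,2}(Γ))`. The weak derivatives of the periodic functions `η(t)` are tested
on the whole plane, the norms are taken over one cell. -/
def MemLinftyW22 (T : ℝ) (η : ℝ → R2 → ℝ) : Prop :=
  ∃ (G : ℝ → R2 → R2 →L[ℝ] ℝ) (H : ℝ → R2 → R2 →L[ℝ] R2 →L[ℝ] ℝ),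
    MemLpLq T (fun _ => torusCell) ⊤ 2 η ∧ MemLpLq T (fun _ => torusCell) ⊤ 2 G ∧
    MemLpLq T (fun _ => torusCell) ⊤ 2 H ∧
    ∀ᵐ t ∂(volume.restrict (Ioo (0 : ℝ) T)),
      HasWeakGradient univ (η t) (G t) ∧ HasWeakGradient univ (G t) (H t)

/-- `η ∈ W^{1,∞}(0,T; L²(Γ))`. -/
def MemW1inftyL2 (T : ℝ) (η : ℝ → R2 → ℝ) : Prop :=
  ∃ g : ℝ → R2 → ℝ,
    MemLpLq T (fun _ => torusCell) ⊤ 2 η ∧ MemLpLq T (fun _ => torusCell) ⊤ 2 g ∧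
    ∀ ψ : ℝ × R2 → ℝ, ContDiff ℝ ∞ ψ → HasCompactSupport ψ →
      tsupport ψ ⊆ Ioo (0 : ℝ) T ×ˢ torusCell →
      ∫ z in Ioo (0 : ℝ) T ×ˢ torusCell, η z.1 z.2 * fderiv ℝ ψ z (1, 0) =
        -∫ z in Ioo (0 : ℝ) T ×ˢ torusCell, g z.1 z.2 * ψ z

/-- `η ∈ X = L^∞(0,T; W^{2,2}(Γ)) ∩ W^{1,∞}(0,T; L²(Γ))`. Since `X` embeds into
`C([0,T] × Γ)`, an element of `X` is identified with its continuous representative. -/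
structure MemX (T : ℝ) (η : ℝ → R2 → ℝ) : Prop where
  periodic : ∀ t ∈ Icc (0 : ℝ) T, TorusPeriodic (η t)
  continuousOn : ContinuousOn (fun z : ℝ × R2 => η z.1 z.2) (Icc (0 : ℝ) T ×ˢ univ)
  memLinftyW22 : MemLinftyW22 T η
  memW1inftyL2 : MemW1inftyL2 T η

/-! ### Geometry -/

/-- The cross product on `ℝ³`. -/
def cross3 (v w : R3) : R3 := WithLp.toLp 2 (crossProduct v.ofLp w.ofLp)

/-- The vector `∂₁φ × ∂₂φ`. -/
def normalVector (φ : R2 → R3) (y : R2) : R3 :=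
  cross3 (fderiv ℝ φ y (EuclideanSpace.single 0 1)) (fderiv ℝ φ y (EuclideanSpace.single 1 1))

/-- The unit normal `ν = ∂₁φ × ∂₂φ / |∂₁φ × ∂₂φ|` at the point `φ(y)`. -/
def unitNormal (φ : R2 → R3) (y : R2) : R3 := ‖normalVector φ y‖⁻¹ • normalVector φ y

/-- A bounded domain `Ω ⊆ ℝ³` of class `C⁴` with boundary parametrized by an injective `C⁴`
immersion `φ` of the torus, and an interval `(a, b)` of admissible normal displacements
(`a = a_{∂Ω}`, `b = b_{∂Ω}`). -/
structure ReferenceDomain where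
  Ω : Set R3
  φ : R2 → R3
  a : ℝ
  b : ℝ
  isOpen : IsOpen Ω
  isConnected : IsConnected Ω
  isBounded : Bornology.IsBounded Ω
  contDiff : ContDiff ℝ 4 φ
  periodic : TorusPeriodic φ
  injective : ∀ x y, φ x = φ y → TorusEq x y
  immersion : ∀ y, normalVector φ y ≠ 0
  frontier_eq : frontier Ω = range φ
  a_neg : a < 0
  b_pos : 0 < b
  /-- Normal coordinates with values in `(a, b)` are unique. -/
  tube_injective : ∀ x y : R2, ∀ z ∈ Ioo a b, ∀ w ∈ Ioo a b,
    φ x + z • unitNormal φ x = φ y + w • unitNormal φ y → TorusEq x y ∧ z = w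
  /-- The unit normal points out of `Ω`, which lies on one side of its boundary. -/
  inner : ∀ y : R2, ∀ z ∈ Ioo a 0, φ y + z • unitNormal φ y ∈ Ω
  outer : ∀ y : R2, ∀ z ∈ Ioo 0 b, φ y + z • unitNormal φ y ∉ Ω

namespace ReferenceDomain

variable (D : ReferenceDomain)

/-- The unit outward normal at `φ(y)`. -/
def ν (y : R2) : R3 := unitNormal D.φ y

/-- The set of all `φ(y) + z ν(y)` with `z ∈ I`. -/
def tube (I : Set ℝ) : Set R3 := {x | ∃ y : R2, ∃ z ∈ I, x = D.φ y + z • D.ν y}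

open Classical in
/-- Normal coordinates on the tubular neighbourhood `N = tube (a, b)`: for `x ∈ N` the pair
`(y, z)` with `x = φ(y) + z ν(y)`, that is `y = φ⁻¹(π(x))` (up to periods) and `z = d(x)`, where
`π` is the projection to `∂Ω` and `d` the signed distance. -/
def tubeCoord (x : R3) : R2 × ℝ :=
  if h : ∃ p : R2 × ℝ, p.2 ∈ Ioo D.a D.b ∧ x = D.φ p.1 + p.2 • D.ν p.1 then h.choose else 0

/-- `S` is an admissible tubular neighbourhood of `∂Ω` for displacements with values in `[m, M]`:
an open subset of `tube (a, b)` that contains the compact set `tube [m, M]`. -/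
structure IsTubularNhd (m M : ℝ) (S : Set R3) : Prop where
  isOpen : IsOpen S
  subset_tube : S ⊆ D.tube (Ioo D.a D.b)
  tube_subset : D.tube (Icc m M) ⊆ S

end ReferenceDomain

/-- The parameters `a < m₂ < m₁ < m < 0 < M < M₁ < M₂ < b` and the mollifying kernel `ker`,
supported in `(-α, α)`, of the cut-off function. -/
structure CutoffData (a b : ℝ) where
  m₂ : ℝ
  m₁ : ℝ
  m : ℝ
  M : ℝ
  M₁ : ℝ
  M₂ : ℝ
  α : ℝ
  ker : ℝ → ℝ
  m₂_lt : m₂ < m₁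
  m₁_lt : m₁ < m
  m_neg : m < 0
  M_pos : 0 < M
  M_lt : M < M₁
  M₁_lt : M₁ < M₂
  α_pos : 0 < α
  α_lt : α < 2⁻¹ * min (m₁ - m₂) (M₂ - M₁)
  /-- The cut-off function is supported in `(a, b)`. -/
  lt_left : a < m₂ - α
  lt_right : M₂ + α < b
  ker_contDiff : ContDiff ℝ ∞ ker
  ker_nonneg : ∀ x, 0 ≤ ker x
  ker_tsupport : tsupport ker ⊆ Ioo (-α) α
  ker_integral : ∫ x, ker x = 1

namespace CutoffData

variable {a b : ℝ} (c : CutoffData a b)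

/-- The piecewise linear function `f`. -/
def ramp (x : ℝ) : ℝ :=
  if x ≤ c.m₂ then 0
  else if x ≤ c.m₂ - c.m₁ then 1 - (x - c.m₂ + c.m₁) / c.m₁
  else if x ≤ c.M₂ - c.M₁ then 1
  else if x ≤ c.M₂ then 1 - (x - c.M₂ + c.M₁) / c.M₁
  else 0

/-- The smooth cut-off function `f_Γ = f * ker`. -/
def cutoff (x : ℝ) : ℝ := ∫ y, c.ramp (x - y) * c.ker y

end CutoffData

namespace ReferenceDomain

variable (D : ReferenceDomain)

open Classical in
/-- The flow map `x ↦ x + f_Γ(d(x)) η(t, φ⁻¹(π(x))) ν(π(x))`; outside of the tubular neighbourhood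
`tube (a, b)` the cut-off factor vanishes and the map is the identity. -/
def flow (c : CutoffData D.a D.b) (η : ℝ → R2 → ℝ) (t : ℝ) (x : R3) : R3 :=
  if x ∈ D.tube (Ioo D.a D.b) then
    x + (c.cutoff (D.tubeCoord x).2 * η t (D.tubeCoord x).1) • D.ν (D.tubeCoord x).1
  else x

/-- The moving domain `Ω_η(t)`. -/
def moving (c : CutoffData D.a D.b) (η : ℝ → R2 → ℝ) (t : ℝ) : Set R3 :=
  D.flow c η t '' D.Ω

end ReferenceDomain

/-! ### The continuity equations -/

/-- The divergence, as the trace of the (weak) gradient. -/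
def divOf (L : R3 →L[ℝ] R3) : ℝ := ∑ i, (L (EuclideanSpace.single i 1)) i

/-- `∂ₜϕ + u · ∇ϕ` at the point `(s, x)`. -/
def transport (u : ℝ → R3 → R3) (ϕ : ℝ × R3 → ℝ) (s : ℝ) (x : R3) : ℝ :=
  fderiv ℝ ϕ (s, x) (1, 0) + fderiv ℝ ϕ (s, x) (0, u s x)

/-- Weak form of `∂ₜ r + div (r u) = 0` in the moving domain `A(t)`, tested with
`C_c^∞((0,T) × ℝ³)`. -/
def IsWeakContinuitySol (T : ℝ) (A : ℝ → Set R3) (u : ℝ → R3 → R3) (r : ℝ → R3 → ℝ) : Prop :=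
  ∀ ϕ : ℝ × R3 → ℝ, ContDiff ℝ ∞ ϕ → HasCompactSupport ϕ → tsupport ϕ ⊆ Ioo (0 : ℝ) T ×ˢ univ →
    ∫ s in (0 : ℝ)..T, ∫ x in A s, r s x * transport u ϕ s x = 0

/-- The closed orthant `[0,∞)^M`. -/
def orthant (M : ℕ) : Set (Fin M → ℝ) := {ρ | ∀ i, 0 ≤ ρ i}

/-- The class of renormalizing functions: `𝓑 ∈ C¹([0,∞)^M)`, `∇𝓑 ∈ L^∞((0,∞)^M)`, `𝓑(0) = 0`. -/
structure IsRenormalizer {M : ℕ} (𝓑 : (Fin M → ℝ) → ℝ) : Prop where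
  contDiffOn : ContDiffOn ℝ 1 𝓑 (orthant M)
  bounded_grad : ∃ C : ℝ, ∀ ρ : Fin M → ℝ, (∀ i, 0 < ρ i) → ‖fderiv ℝ 𝓑 ρ‖ ≤ C
  map_zero : 𝓑 0 = 0

/-- The integrand `𝓑(r)(∂ₜϕ + u · ∇ϕ) - (∇𝓑(r) · r - 𝓑(r)) (div u) ϕ`. -/
def renormIntegrand {M : ℕ} (𝓑 : (Fin M → ℝ) → ℝ) (r : ℝ → R3 → Fin M → ℝ) (u : ℝ → R3 → R3)
    (Du : ℝ → R3 → R3 →L[ℝ] R3) (ϕ : ℝ × R3 → ℝ) (s : ℝ) (x : R3) : ℝ :=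
  𝓑 (r s x) * transport u ϕ s x -
    (fderivWithin ℝ 𝓑 (orthant M) (r s x) (r s x) - 𝓑 (r s x)) * divOf (Du s x) * ϕ (s, x)

/-- The time-integrated weak form, on all intervals `[0,t]` with `t ∈ [0,T]` and up to the boundary
of the moving domain `A(t)`, of
`∂ₜ𝓑(r) + div (𝓑(r) u) + (∇𝓑(r) · r - 𝓑(r)) div u = 0`. All the integrals converge. -/
def IsRenormalizedSol {M : ℕ} (T : ℝ) (A : ℝ → Set R3) (u : ℝ → R3 → R3)
    (Du : ℝ → R3 → R3 →L[ℝ] R3) (𝓑 : (Fin M → ℝ) → ℝ) (r : ℝ → R3 → Fin M → ℝ) : Prop :=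
  ∀ ϕ : ℝ × R3 → ℝ, ContDiffOn ℝ ∞ ϕ (Icc (0 : ℝ) T ×ˢ univ) →
    IntegrableOn (fun z : ℝ × R3 => renormIntegrand 𝓑 r u Du ϕ z.1 z.2) (spaceTime T A) ∧
    ∀ t ∈ Icc (0 : ℝ) T,
      IntegrableOn (fun x => 𝓑 (r t x) * ϕ (t, x)) (A t) ∧
      ∫ s in (0 : ℝ)..t, ∫ x in A s, renormIntegrand 𝓑 r u Du ϕ s x =
        (∫ x in A t, 𝓑 (r t x) * ϕ (t, x)) - ∫ x in A 0, 𝓑 (r 0 x) * ϕ (0, x)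

end

/-!
The densities are extended by zero to the whole space, and the continuity equation, which is tested
with functions that do not vanish on the moving boundary, becomes an equation on `(0,T) × ℝ³`. The
velocity is only defined on `B`, but the densities live in a compact subset `K` of `B`, so for small
`ε` the mollified flux `div ((r u) * k_ε)` only sees the velocity near `K`.

*Mollified equation.* For every `x`, the function `s ↦ (r * k_ε)(s, x)` is almost everywhere the
primitive of the mollified flux (`TransportData.exists_moll_eq_primitive`). Hence it is absolutely
continuous, and the chain rule for the Lipschitz `C¹` function `𝓑` holds pointwise in `x`
(`IsRenormalizer.integral_eq_sub`). Integration over space gives the renormalized equation for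
`r * k_ε`, with the exact values at both endpoints (`TransportData.integral_mollIntegrand`).

*Representative.* The mollifications determine the densities at every time: at an arbitrary
`t ∈ [0,T]` one takes a weak `L²` limit of `r(s)`, `s → t`, through good times. The bounds in
`L^γᵢ`, nonnegativity and vanishing outside of `Ω_η(t)` are closed convex conditions and survive
(`exists_density_of_tendsto_moll`). For the last one, almost every point outside of `Ω_η(t)`
has to have a neighbourhood that stays outside of the domains for a short time, which holds because
the boundary is the graph of the continuous function `η` in normal coordinates
(`ReferenceDomain.moving_eq`, `ReferenceDomain.movingDomain`). The normal displacement is strictly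
increasing, since the slopes of the cut-off function lie between `-1 / M₁` and `1 / |m₁|`, while the
displacement lies between `m > m₁` and `M < M₁` (`CutoffData.strictMono_displacement`).

*Limit `ε → 0`.* This is the DiPerna–Lions argument at almost every fixed time
(`FixedTimeData.tendsto_fluxPairing`). The mollified flux is the transport term `u · ∇(r * k_ε)`
plus the Friedrichs commutator. The former is integrated by parts after multiplication with `∇𝓑`;
the latter is bounded in `L¹` by `‖r‖_{L^γ} ‖∇u‖_{L^p}` with conjugate exponents, and converges to
`r div u`. The hypotheses on the exponents say that the exponent conjugate to `min γᵢ` is at most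
`q` (`conjExponent_le_of_hypotheses`). The bounds are uniform in `ε` and integrable in time, so
dominated convergence applies (`TransportData.integral_renormIntegrand`).
-/

open Filter Topology

noncomputable section

/-! ### Mollification -/

/-- A fixed smooth bump function, supported in the unit ball. -/
def unitBump : ContDiffBump (0 : R3) := ⟨1 / 2, 1, by norm_num, by norm_num⟩

/-- The mollifying kernel at scale `ε`: a nonnegative smooth function with integral one, supported
in the ball of radius `ε`. -/
def mollKernel (ε : ℝ) (x : R3) : ℝ := (ε⁻¹) ^ 3 * unitBump.normed volume (ε⁻¹ • x)

/-- The mollification of `f` at scale `ε`. -/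
def moll {F : Type*} [NormedAddCommGroup F] [NormedSpace ℝ F] (ε : ℝ) (f : R3 → F) (x : R3) : F :=
  ∫ y, mollKernel ε (x - y) • f y

variable {F : Type*} [NormedAddCommGroup F] [NormedSpace ℝ F]

lemma mollKernel_contDiff (ε : ℝ) : ContDiff ℝ ∞ (mollKernel ε) := by
  unfold mollKernel
  exact contDiff_const.mul (unitBump.contDiff_normed.comp (contDiff_const_smul _))

lemma mollKernel_continuous (ε : ℝ) : Continuous (mollKernel ε) :=
  (mollKernel_contDiff ε).continuous

lemma mollKernel_differentiable (ε : ℝ) : Differentiable ℝ (mollKernel ε) :=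
  (mollKernel_contDiff ε).differentiable (by simp)

lemma continuous_fderiv_mollKernel (ε : ℝ) : Continuous (fderiv ℝ (mollKernel ε)) :=
  (mollKernel_contDiff ε).continuous_fderiv (by simp)

lemma mollKernel_nonneg {ε : ℝ} (hε : 0 < ε) (x : R3) : 0 ≤ mollKernel ε x :=
  mul_nonneg (by positivity) (unitBump.nonneg_normed _)

lemma mollKernel_eq_zero {ε : ℝ} (hε : 0 < ε) {x : R3} (hx : ε ≤ ‖x‖) : mollKernel ε x = 0 := by
  have : ε⁻¹ • x ∉ Function.support (unitBump.normed (volume : Measure R3)) := by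
    rw [unitBump.support_normed_eq]
    simp only [Metric.mem_ball, dist_zero_right, norm_smul, norm_inv, Real.norm_eq_abs,
      abs_of_pos hε, not_lt]
    rw [show unitBump.rOut = 1 from rfl, inv_mul_eq_div, le_div_iff₀ hε]
    simpa using hx
  rw [Function.notMem_support] at this
  simp [mollKernel, this]

lemma hasCompactSupport_mollKernel {ε : ℝ} (hε : 0 < ε) : HasCompactSupport (mollKernel ε) := by
  apply HasCompactSupport.of_support_subset_isCompact (isCompact_closedBall (0 : R3) ε)
  intro x hx
  by_contra h
  exact hx (mollKernel_eq_zero hε (by simpa using (not_le.1 (by simpa using h)).le))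

lemma integral_mollKernel {ε : ℝ} (hε : 0 < ε) : ∫ x, mollKernel ε x = 1 := by
  unfold mollKernel
  rw [integral_const_mul, Measure.integral_comp_inv_smul, unitBump.integral_normed]
  simp only [finrank_euclideanSpace, Fintype.card_fin, smul_eq_mul, mul_one]
  rw [abs_of_pos (by positivity)]
  field_simp

lemma integrable_mollKernel {ε : ℝ} (hε : 0 < ε) : Integrable (mollKernel ε) :=
  (mollKernel_continuous ε).integrable_of_hasCompactSupport (hasCompactSupport_mollKernel hε)

lemma lintegral_mollKernel {ε : ℝ} (hε : 0 < ε) : ∫⁻ x, ‖mollKernel ε x‖ₑ = 1 := by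
  rw [← ofReal_integral_norm_eq_lintegral_enorm (integrable_mollKernel hε)]
  simp [abs_of_nonneg (mollKernel_nonneg hε _), integral_mollKernel hε]

lemma fderiv_mollKernel_eq_zero {ε : ℝ} (hε : 0 < ε) {x : R3} (hx : ε < ‖x‖) :
    fderiv ℝ (mollKernel ε) x = 0 := by
  have : mollKernel ε =ᶠ[𝓝 x] fun _ => 0 := by
    filter_upwards [continuous_norm.continuousAt.eventually (lt_mem_nhds hx)] with y hy
    exact mollKernel_eq_zero hε hy.le
  rw [this.fderiv_eq]
  simp

lemma hasCompactSupport_fderiv_mollKernel {ε : ℝ} (hε : 0 < ε) :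
    HasCompactSupport (fderiv ℝ (mollKernel ε)) :=
  (hasCompactSupport_mollKernel hε).fderiv ℝ

lemma exists_bound_fderiv_mollKernel {ε : ℝ} (hε : 0 < ε) :
    ∃ C : ℝ, ∀ x, ‖fderiv ℝ (mollKernel ε) x‖ ≤ C :=
  (continuous_fderiv_mollKernel ε).bounded_above_of_compact_support
    (hasCompactSupport_fderiv_mollKernel hε)

lemma exists_bound_mollKernel {ε : ℝ} (hε : 0 < ε) : ∃ C : ℝ, ∀ x, ‖mollKernel ε x‖ ≤ C :=
  (mollKernel_continuous ε).bounded_above_of_compact_support (hasCompactSupport_mollKernel hε)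

/-- The first moment of the gradient of the kernel is bounded independently of the scale. -/
lemma exists_lintegral_fderiv_mollKernel_le :
    ∃ Λ : ℝ≥0∞, Λ ≠ ⊤ ∧ ∀ ε : ℝ, 0 < ε →
      ∫⁻ x, ‖fderiv ℝ (mollKernel ε) x‖ₑ * ‖x‖ₑ ≤ Λ := by
  have hb : ContDiff ℝ ∞ (unitBump.normed (volume : Measure R3)) := unitBump.contDiff_normed
  obtain ⟨C, hC⟩ := (hb.continuous_fderiv (by simp)).bounded_above_of_compact_support
    (unitBump.hasCompactSupport_normed.fderiv ℝ)
  have hC0 : 0 ≤ C := (norm_nonneg _).trans (hC 0)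
  refine ⟨ENNReal.ofReal C * volume (Metric.ball (0 : R3) 1), ?_, fun ε hε => ?_⟩
  · exact ENNReal.mul_ne_top (by simp) measure_ball_lt_top.ne
  have hder : ∀ x, ‖fderiv ℝ (mollKernel ε) x‖ ≤ (ε⁻¹) ^ 4 * C := by
    intro x
    have h1 : HasFDerivAt (mollKernel ε) ((ε⁻¹) ^ 3 •
        ((fderiv ℝ (unitBump.normed (volume : Measure R3)) (ε⁻¹ • x)).comp
          (ε⁻¹ • ContinuousLinearMap.id ℝ R3))) x := by
      have h2 : HasFDerivAt (fun x : R3 => ε⁻¹ • x) (ε⁻¹ • ContinuousLinearMap.id ℝ R3) x :=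
        (ε⁻¹ • ContinuousLinearMap.id ℝ R3).hasFDerivAt
      exact (((hb.differentiable (by simp)) _).hasFDerivAt.comp x h2).const_mul _
    rw [h1.fderiv, ContinuousLinearMap.comp_smul, ContinuousLinearMap.comp_id, smul_smul,
      norm_smul, Real.norm_eq_abs, abs_of_pos (by positivity)]
    calc _ ≤ ε⁻¹ ^ 3 * ε⁻¹ * C := by gcongr; exact hC _
      _ = _ := by ring
  calc ∫⁻ x, ‖fderiv ℝ (mollKernel ε) x‖ₑ * ‖x‖ₑ
      ≤ ∫⁻ x, (Metric.closedBall (0 : R3) ε).indicator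
          (fun _ => ENNReal.ofReal ((ε⁻¹) ^ 3 * C)) x := by
        refine lintegral_mono fun x => ?_
        by_cases hx : x ∈ Metric.closedBall (0 : R3) ε
        · rw [indicator_of_mem hx, ← ofReal_norm, ← ofReal_norm,
            ← ENNReal.ofReal_mul (norm_nonneg _)]
          apply ENNReal.ofReal_le_ofReal
          calc _ ≤ ((ε⁻¹) ^ 4 * C) * ε := by
                gcongr
                · exact hder x
                · simpa using hx
            _ = _ := by field_simp
        · rw [fderiv_mollKernel_eq_zero hε (by simpa using hx), ← ofReal_norm, norm_zero]
          simp
    _ = ENNReal.ofReal ((ε⁻¹) ^ 3 * C) * volume (Metric.closedBall (0 : R3) ε) := by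
        rw [lintegral_indicator measurableSet_closedBall, setLIntegral_const]
    _ = _ := by
        rw [Measure.addHaar_closedBall _ _ hε.le, ← mul_assoc, ← ENNReal.ofReal_mul (by positivity)]
        congr 2
        simp only [finrank_euclideanSpace, Fintype.card_fin]
        field_simp
    _ ≤ _ := le_rfl

lemma moll_eq_convolution (ε : ℝ) (f : R3 → F) :
    moll ε f = convolution (mollKernel ε) f (ContinuousLinearMap.lsmul ℝ ℝ) volume := by
  ext x
  rw [convolution_eq_swap]
  rfl

lemma moll_contDiff {ε : ℝ} (hε : 0 < ε) {f : R3 → F} (hf : LocallyIntegrable f) :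
    ContDiff ℝ ∞ (moll ε f) := by
  rw [moll_eq_convolution]
  exact (hasCompactSupport_mollKernel hε).contDiff_convolution_left _ (mollKernel_contDiff ε) hf

/-- Products with a bounded continuous factor `k (x - ·)` are integrable. -/
lemma integrable_kernel_smul {G : Type*} [NormedAddCommGroup G] [NormedSpace ℝ G]
    {k : R3 → G} (hk : Continuous k) (hkc : HasCompactSupport k)
    (L : G →L[ℝ] F →L[ℝ] F) {f : R3 → F} (hf : LocallyIntegrable f) (x : R3) :
    Integrable (fun y => L (k (x - y)) (f y)) := by
  have := hkc.convolutionExists_left L hk hf x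
  rw [ConvolutionExistsAt, ← integrable_comp_sub_left _ x] at this
  simpa using this

lemma integrable_mollKernel_smul {ε : ℝ} (hε : 0 < ε) {f : R3 → F} (hf : LocallyIntegrable f)
    (x : R3) : Integrable (fun y => mollKernel ε (x - y) • f y) :=
  integrable_kernel_smul (mollKernel_continuous ε) (hasCompactSupport_mollKernel hε)
    (ContinuousLinearMap.lsmul ℝ ℝ) hf x

lemma integrable_fderiv_mollKernel_smul {ε : ℝ} (hε : 0 < ε) {f : R3 → F}
    (hf : LocallyIntegrable f) (x e : R3) :
    Integrable (fun y => (fderiv ℝ (mollKernel ε) (x - y) e) • f y) := by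
  refine integrable_kernel_smul (k := fun z => fderiv ℝ (mollKernel ε) z e)
    ((continuous_fderiv_mollKernel ε).clm_apply continuous_const) ?_
    (ContinuousLinearMap.lsmul ℝ ℝ) hf x
  exact (hasCompactSupport_fderiv_mollKernel hε).comp_left (g := fun L : R3 →L[ℝ] ℝ => L e) rfl

lemma hasFDerivAt_moll {ε : ℝ} (hε : 0 < ε) {f : R3 → F} (hf : LocallyIntegrable f) (x : R3) :
    HasFDerivAt (moll ε f) (fderiv ℝ (moll ε f) x) x :=
  (((moll_contDiff hε hf).differentiable (by simp)) x).hasFDerivAt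

lemma fderiv_moll_apply [CompleteSpace F] {ε : ℝ} (hε : 0 < ε) {f : R3 → F}
    (hf : LocallyIntegrable f)
    (x e : R3) : fderiv ℝ (moll ε f) x e = ∫ y, (fderiv ℝ (mollKernel ε) (x - y) e) • f y := by
  have h := ((hasCompactSupport_mollKernel hε).hasFDerivAt_convolution_left
    (ContinuousLinearMap.lsmul ℝ ℝ) ((mollKernel_contDiff ε).of_le (by simp)) hf x).fderiv
  rw [moll_eq_convolution, h, convolution_eq_swap, ContinuousLinearMap.integral_apply]
  · rfl
  · exact ((hasCompactSupport_fderiv_mollKernel hε).convolutionExists_left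
      _ (continuous_fderiv_mollKernel ε) hf x).integrable_swap

/-- The mollification at scale `ε` vanishes away from the support. -/
lemma moll_eq_zero {ε : ℝ} (hε : 0 < ε) {f : R3 → F} {x : R3}
    (hf : ∀ y, ‖x - y‖ < ε → f y = 0) : moll ε f x = 0 := by
  unfold moll
  rw [integral_eq_zero_of_ae]
  filter_upwards with y
  rcases lt_or_ge ‖x - y‖ ε with h | h
  · simp [hf y h]
  · simp [mollKernel_eq_zero hε h]

lemma hasCompactSupport_moll {ε : ℝ} (hε : 0 < ε) {f : R3 → F} {K : Set R3} (hK : IsCompact K)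
    (hf : ∀ y, y ∉ K → f y = 0) : HasCompactSupport (moll ε f) := by
  refine HasCompactSupport.of_support_subset_isCompact (hK.cthickening (r := ε)) fun x hx => ?_
  by_contra h
  refine hx (moll_eq_zero hε fun y hy => hf y fun hyK => h ?_)
  exact Metric.mem_cthickening_of_dist_le x y ε K hyK (by rw [dist_eq_norm]; exact hy.le)

lemma stronglyMeasurable_moll (ε : ℝ) {f : R3 → F} (hf : StronglyMeasurable f) :
    StronglyMeasurable (moll ε f) := by
  have h : StronglyMeasurable fun z : R3 × R3 => mollKernel ε (z.1 - z.2) • f z.2 :=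
    ((mollKernel_continuous ε).comp (continuous_fst.sub continuous_snd)).stronglyMeasurable.smul
      (hf.comp_measurable measurable_snd)
  exact h.integral_prod_right'

end

section

/-! ### Convergence of mollifications in `L^p` -/

/-- Translations are continuous in `L^p` for finite `p`. -/
lemma tendsto_eLpNorm_translate_sub {F : Type*} [NormedAddCommGroup F] {p : ℝ≥0∞} (hp1 : 1 ≤ p)
    (hp : p ≠ ⊤) {f : R3 → F} (hf : MemLp f p) :
    Tendsto (fun h : R3 => eLpNorm (fun x => f (x + h) - f x) p volume) (𝓝 0) (𝓝 0) := by
  have : Fact (1 ≤ p) := ⟨hp1⟩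
  have : Fact (p ≠ ⊤) := ⟨hp⟩
  have hc : Continuous fun h : R3 => (DomAddAct.mk h +ᵥ hf.toLp f : Lp F p volume) := by
    have : Continuous (DomAddAct.mk : R3 → R3ᵈᵃᵃ) := by fun_prop
    exact this.vadd continuous_const
  have h0 : Tendsto (fun h : R3 => edist (DomAddAct.mk h +ᵥ hf.toLp f : Lp F p volume)
      (hf.toLp f)) (𝓝 0) (𝓝 0) := by
    have := (hc.edist (continuous_const (y := hf.toLp f))).tendsto 0
    simpa using this
  refine h0.congr fun h => ?_
  rw [DomAddAct.mk_vadd_toLp, Lp.edist_toLp_toLp]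
  congr 1
  ext x
  simp [add_comm]

variable {F : Type*} [NormedAddCommGroup F] [NormedSpace ℝ F]

/-- A double integral against a kernel `κ (x - y)` is bounded by the mass of the kernel times the
largest contribution of a single displacement `x - y` in its support. -/
lemma lintegral_kernel_mul_le {κ : R3 → ℝ≥0∞} (hκ : Measurable κ) {Ψ : R3 → R3 → ℝ≥0∞}
    (hΨ : Measurable (Function.uncurry Ψ)) {C : ℝ≥0∞}
    (hC : ∀ h, κ h ≠ 0 → ∫⁻ y, Ψ (y + h) y ≤ C) :
    ∫⁻ x, ∫⁻ y, κ (x - y) * Ψ x y ≤ (∫⁻ h, κ h) * C := by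
  have hΨ' : Measurable fun z : R3 × R3 => Ψ z.1 z.2 := hΨ
  have hΨ2 : Measurable fun z : R3 × R3 => Ψ (z.1 + z.2) z.1 :=
    hΨ'.comp ((measurable_fst.add measurable_snd).prodMk measurable_fst)
  calc ∫⁻ x, ∫⁻ y, κ (x - y) * Ψ x y = ∫⁻ y, ∫⁻ x, κ (x - y) * Ψ x y := by
        apply lintegral_lintegral_swap
        exact ((hκ.comp (measurable_fst.sub measurable_snd)).mul hΨ').aemeasurable
    _ = ∫⁻ y, ∫⁻ h, κ h * Ψ (y + h) y := by
        refine lintegral_congr fun y => ?_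
        rw [← lintegral_add_left_eq_self _ y]
        simp
    _ = ∫⁻ h, ∫⁻ y, κ h * Ψ (y + h) y := by
        apply lintegral_lintegral_swap
        exact ((hκ.comp measurable_snd).mul hΨ2).aemeasurable
    _ ≤ ∫⁻ h, κ h * C := by
        refine lintegral_mono fun h => ?_
        have hm : Measurable fun y => Ψ (y + h) y :=
          hΨ2.comp (measurable_id.prodMk measurable_const)
        rw [lintegral_const_mul _ hm]
        by_cases h0 : κ h = 0
        · simp [h0]
        · gcongr
          exact hC h h0
    _ = _ := lintegral_mul_const _ hκ

/-- Hölder's inequality for the pairing of two vector-valued functions. -/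
lemma lintegral_enorm_mul_enorm_le {α : Type*} [MeasurableSpace α] {μ : Measure α} {F G : Type*}
    [NormedAddCommGroup F] [NormedAddCommGroup G] {f : α → F} {g : α → G} {p q : ℝ≥0∞}
    [p.HolderConjugate q] (hf : AEStronglyMeasurable f μ) (hg : AEStronglyMeasurable g μ) :
    ∫⁻ x, ‖f x‖ₑ * ‖g x‖ₑ ∂μ ≤ eLpNorm f p μ * eLpNorm g q μ := by
  have h := eLpNorm_smul_le_mul_eLpNorm (p := p) (q := q) (r := 1) hg.norm hf.norm
  rw [eLpNorm_norm, eLpNorm_norm, eLpNorm_one_eq_lintegral_enorm] at h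
  refine le_trans (le_of_eq ?_) h
  refine lintegral_congr fun x => ?_
  simp [enorm_mul]

/-- Jensen's inequality for the power function. -/
lemma rpow_lintegral_le {α : Type*} [MeasurableSpace α] {μ : Measure α} [IsProbabilityMeasure μ]
    {g : α → ℝ≥0∞} (hg : AEMeasurable g μ) {p : ℝ} (hp : 1 ≤ p) :
    (∫⁻ x, g x ∂μ) ^ p ≤ ∫⁻ x, g x ^ p ∂μ := by
  have h := eLpNorm_le_eLpNorm_of_exponent_le (μ := μ) (p := 1) (q := ENNReal.ofReal p)
    (f := g) (by simpa using hp) hg.aestronglyMeasurable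
  rw [eLpNorm_one_eq_lintegral_enorm, eLpNorm_eq_lintegral_rpow_enorm_toReal (by simp; linarith)
    (by simp), ENNReal.toReal_ofReal (by linarith)] at h
  calc (∫⁻ x, g x ∂μ) ^ p ≤ ((∫⁻ x, g x ^ p ∂μ) ^ (1 / p)) ^ p := by
        gcongr
        simpa using h
    _ = _ := by
        rw [← ENNReal.rpow_mul, one_div_mul_cancel (by linarith), ENNReal.rpow_one]

lemma moll_sub_self [CompleteSpace F] {ε : ℝ} (hε : 0 < ε) {f : R3 → F}
    (hf : LocallyIntegrable f) (x : R3) :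
    moll ε f x - f x = ∫ y, mollKernel ε (x - y) • (f y - f x) := by
  simp_rw [smul_sub]
  rw [integral_sub (integrable_mollKernel_smul hε hf x), integral_smul_const,
    integral_sub_left_eq_self, integral_mollKernel hε, one_smul]
  · rfl
  · exact ((integrable_mollKernel hε).comp_sub_left x).smul_const _

/-- The mollification error at scale `ε` is bounded by the `L^p` modulus of continuity at `ε`. -/
lemma eLpNorm_moll_sub_le [CompleteSpace F] {p : ℝ≥0∞} (hp1 : 1 ≤ p) (hp : p ≠ ⊤) {ε : ℝ}
    (hε : 0 < ε) {f : R3 → F} (hfm : StronglyMeasurable f) (hf : LocallyIntegrable f) {δ : ℝ≥0∞}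
    (hδ : ∀ h : R3, ‖h‖ ≤ ε → eLpNorm (fun x => f (x + h) - f x) p volume ≤ δ) :
    eLpNorm (fun x => moll ε f x - f x) p volume ≤ δ := by
  have hp0 : p ≠ 0 := (zero_lt_one.trans_le hp1).ne'
  have hpr : 1 ≤ p.toReal := by
    rw [← ENNReal.toReal_one]; exact ENNReal.toReal_mono hp hp1
  have hpr0 : 0 < p.toReal := by linarith
  have hkm : Measurable fun x => ‖mollKernel ε x‖ₑ := (mollKernel_continuous ε).measurable.enorm
  rw [eLpNorm_eq_lintegral_rpow_enorm_toReal hp0 hp, one_div, ENNReal.rpow_inv_le_iff hpr0]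
  -- Jensen's inequality for the probability measure with density `k_ε(x - ·)`
  have key : ∀ x, ‖moll ε f x - f x‖ₑ ^ p.toReal ≤
      ∫⁻ y, ‖mollKernel ε (x - y)‖ₑ * ‖f x - f y‖ₑ ^ p.toReal := by
    intro x
    have hk : Measurable fun y => ‖mollKernel ε (x - y)‖ₑ :=
      hkm.comp (measurable_const.sub measurable_id)
    have hm : Measurable fun y => ‖f x - f y‖ₑ :=
      (stronglyMeasurable_const.sub hfm).enorm
    let ν : Measure R3 := volume.withDensity fun y => ‖mollKernel ε (x - y)‖ₑ
    have : IsProbabilityMeasure ν := ⟨by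
      rw [withDensity_apply _ MeasurableSet.univ, Measure.restrict_univ,
        lintegral_sub_left_eq_self (fun y => ‖mollKernel ε y‖ₑ), lintegral_mollKernel hε]⟩
    rw [moll_sub_self hε hf]
    calc _ ≤ (∫⁻ y, ‖mollKernel ε (x - y)‖ₑ * ‖f x - f y‖ₑ) ^ p.toReal := by
          gcongr
          refine (enorm_integral_le_lintegral_enorm _).trans (le_of_eq ?_)
          refine lintegral_congr fun y => ?_
          rw [enorm_smul, enorm_sub_rev]
      _ = (∫⁻ y, ‖f x - f y‖ₑ ∂ν) ^ p.toReal := by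
          rw [lintegral_withDensity_eq_lintegral_mul _ hk hm]; rfl
      _ ≤ ∫⁻ y, ‖f x - f y‖ₑ ^ p.toReal ∂ν := rpow_lintegral_le hm.aemeasurable hpr
      _ = _ := by
          rw [lintegral_withDensity_eq_lintegral_mul _ hk (hm.pow_const _)]; rfl
  refine (lintegral_mono key).trans ?_
  refine (lintegral_kernel_mul_le (C := δ ^ p.toReal) hkm ?_ ?_).trans ?_
  · have : StronglyMeasurable fun z : R3 × R3 => f z.1 - f z.2 :=
      (hfm.comp_measurable measurable_fst).sub (hfm.comp_measurable measurable_snd)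
    exact this.enorm.pow_const _
  · intro h hh
    have hh' : ‖h‖ ≤ ε := by
      by_contra hc
      exact hh (by rw [mollKernel_eq_zero hε (not_le.1 hc).le]; simp)
    have := hδ h hh'
    rwa [eLpNorm_eq_lintegral_rpow_enorm_toReal hp0 hp, one_div,
      ENNReal.rpow_inv_le_iff hpr0] at this
  · rw [lintegral_mollKernel hε, one_mul]

/-- Mollifications converge in `L^p`. -/
lemma tendsto_eLpNorm_moll_sub [CompleteSpace F] {p : ℝ≥0∞} (hp1 : 1 ≤ p) (hp : p ≠ ⊤)
    {f : R3 → F} (hfm : StronglyMeasurable f) (hf : MemLp f p) :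
    Tendsto (fun ε : ℝ => eLpNorm (fun x => moll ε f x - f x) p volume) (𝓝[>] 0) (𝓝 0) := by
  rw [ENNReal.tendsto_nhds_zero]
  intro δ hδ
  have h := (ENNReal.tendsto_nhds_zero.1 (tendsto_eLpNorm_translate_sub hp1 hp hf)) δ hδ
  obtain ⟨r, hr, hball⟩ := Metric.eventually_nhds_iff.1 h
  filter_upwards [Ioo_mem_nhdsGT hr] with ε hε
  refine eLpNorm_moll_sub_le hp1 hp hε.1 hfm (hf.locallyIntegrable hp1) fun h hh => hball ?_
  rw [dist_zero_right]
  exact hh.trans_lt hε.2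

lemma lintegral_enorm_mul_enorm_translate_le {F G : Type*}
    [NormedAddCommGroup F] [NormedAddCommGroup G] {f : R3 → F} {g : R3 → G} {p q : ℝ≥0∞}
    [p.HolderConjugate q] (hf : StronglyMeasurable f) (hg : StronglyMeasurable g) (h : R3) :
    ∫⁻ x, ‖f x‖ₑ * ‖g (x + h)‖ₑ ≤ eLpNorm f p * eLpNorm g q := by
  refine (lintegral_enorm_mul_enorm_le (p := p) (q := q) (g := fun x => g (x + h))
    hf.aestronglyMeasurable
    (hg.comp_measurable (measurable_id.add_const h)).aestronglyMeasurable).trans (le_of_eq ?_)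
  congr 1
  exact eLpNorm_comp_measurePreserving hg.aestronglyMeasurable (measurePreserving_add_right _ h)

/-- A mollification is controlled, in its pairings, by the pairings of the translates. -/
lemma lintegral_enorm_moll_mul_le {ε : ℝ} (hε : 0 < ε) {ρ : R3 → F} (hρ : StronglyMeasurable ρ)
    {b : R3 → ℝ≥0∞} (hb : Measurable b) {C : ℝ≥0∞}
    (hC : ∀ h : R3, ‖h‖ ≤ ε → ∫⁻ y, ‖ρ y‖ₑ * b (y + h) ≤ C) :
    ∫⁻ x, ‖moll ε ρ x‖ₑ * b x ≤ C := by
  have hkm : Measurable fun x => ‖mollKernel ε x‖ₑ := (mollKernel_continuous ε).measurable.enorm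
  calc ∫⁻ x, ‖moll ε ρ x‖ₑ * b x
      ≤ ∫⁻ x, ∫⁻ y, ‖mollKernel ε (x - y)‖ₑ * (‖ρ y‖ₑ * b x) := by
        refine lintegral_mono fun x => ?_
        calc _ ≤ (∫⁻ y, ‖mollKernel ε (x - y) • ρ y‖ₑ) * b x := by
              gcongr; exact enorm_integral_le_lintegral_enorm _
          _ = ∫⁻ y, ‖mollKernel ε (x - y) • ρ y‖ₑ * b x := by
              rw [lintegral_mul_const]
              exact ((((mollKernel_continuous ε).stronglyMeasurable.comp_measurable
                (measurable_const.sub measurable_id)).smul hρ)).enorm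
          _ = _ := by
              refine lintegral_congr fun y => ?_
              rw [enorm_smul, mul_assoc]
    _ ≤ (∫⁻ x, ‖mollKernel ε x‖ₑ) * C := by
        refine lintegral_kernel_mul_le hkm ?_ ?_
        · exact ((hρ.comp_measurable measurable_snd).enorm).mul (hb.comp measurable_fst)
        · intro h hh
          refine hC h ?_
          by_contra hc
          exact hh (by rw [mollKernel_eq_zero hε (not_le.1 hc).le]; simp)
    _ = C := by rw [lintegral_mollKernel hε, one_mul]

end

section

/-! ### Smooth approximation of weakly differentiable functions -/

variable {F : Type*} [NormedAddCommGroup F] [NormedSpace ℝ F]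

/-- In the interior of the domain, the gradient of the mollification is the mollification of the
weak gradient. -/
lemma fderiv_moll_of_hasWeakGradient [CompleteSpace F] {B : Set R3} {v : R3 → F}
    {g : R3 → R3 →L[ℝ] F} (hw : HasWeakGradient B v g) (hv0 : ∀ x, x ∉ B → v x = 0)
    (hg0 : ∀ x, x ∉ B → g x = 0) (hv : LocallyIntegrable v) (hg : LocallyIntegrable g)
    {ε : ℝ} (hε : 0 < ε) {x : R3} (hx : Metric.closedBall x ε ⊆ B) :
    fderiv ℝ (moll ε v) x = moll ε g x := by
  have hset : ∀ {H : Type _} [NormedAddCommGroup H] [NormedSpace ℝ H] (f : R3 → H),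
      (∀ y, y ∉ B → f y = 0) → ∫ y in B, f y = ∫ y, f y := fun f hf =>
    setIntegral_eq_integral_of_forall_compl_eq_zero fun y hy => hf y hy
  have hψ : ContDiff ℝ ∞ fun y => mollKernel ε (x - y) :=
    (mollKernel_contDiff ε).comp (contDiff_const.sub contDiff_id)
  have hsupp : Function.support (fun y => mollKernel ε (x - y)) ⊆ Metric.closedBall x ε := by
    intro y hy
    by_contra h
    refine hy (mollKernel_eq_zero hε ?_)
    rw [Metric.mem_closedBall, not_le, dist_comm, dist_eq_norm] at h
    exact h.le
  have hts : tsupport (fun y => mollKernel ε (x - y)) ⊆ Metric.closedBall x ε :=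
    closure_minimal hsupp Metric.isClosed_closedBall
  have hder : ∀ y e, fderiv ℝ (fun y => mollKernel ε (x - y)) y e =
      -fderiv ℝ (mollKernel ε) (x - y) e := by
    intro y e
    have h1 : HasFDerivAt (fun y : R3 => x - y) (-ContinuousLinearMap.id ℝ R3) y :=
      (hasFDerivAt_id y).const_sub x
    have h2 : HasFDerivAt (fun y => mollKernel ε (x - y)) _ y :=
      (mollKernel_differentiable ε (x - y)).hasFDerivAt.comp y h1
    rw [h2.fderiv]
    simp
  ext1 e
  rw [fderiv_moll_apply hε hv, moll, ContinuousLinearMap.integral_apply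
    (integrable_mollKernel_smul hε hg x)]
  have h := hw.integral_eq _ hψ (HasCompactSupport.of_support_subset_isCompact
    (isCompact_closedBall x ε) hsupp) (hts.trans hx) e
  rw [hset _ fun y hy => by simp [hv0 y hy], hset _ fun y hy => by simp [hg0 y hy]] at h
  simp only [hder, neg_smul, integral_neg, neg_inj] at h
  simpa using h

/-- A function with a weak gradient is approximated, together with its gradient, by test functions
in `L^p` on every set that has a positive distance from the complement of the domain. -/
lemma exists_contDiff_approx [CompleteSpace F] {B N : Set R3} (hB : Bornology.IsBounded B)
    {δ : ℝ} (hδ : 0 < δ) (hN : ∀ x ∈ N, Metric.closedBall x δ ⊆ B) (hNm : MeasurableSet N)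
    {p : ℝ≥0∞} (hp1 : 1 ≤ p) (hp : p ≠ ⊤) {v : R3 → F} {g : R3 → R3 →L[ℝ] F}
    (hw : HasWeakGradient B v g) (hv0 : ∀ x, x ∉ B → v x = 0) (hg0 : ∀ x, x ∉ B → g x = 0)
    (hvm : StronglyMeasurable v) (hgm : StronglyMeasurable g) (hv : MemLp v p) (hg : MemLp g p) :
    ∃ w : ℕ → R3 → F, (∀ n, ContDiff ℝ ∞ (w n)) ∧ (∀ n, HasCompactSupport (w n)) ∧
      Tendsto (fun n => eLpNorm (fun x => w n x - v x) p (volume.restrict N)) atTop (𝓝 0) ∧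
      Tendsto (fun n => eLpNorm (fun x => fderiv ℝ (w n) x - g x) p (volume.restrict N))
        atTop (𝓝 0) := by
  obtain ⟨ε, hεanti, hε, hε0⟩ := exists_seq_strictAnti_tendsto' hδ
  have hεt : Tendsto ε atTop (𝓝[>] 0) :=
    tendsto_nhdsWithin_iff.2 ⟨hε0, Eventually.of_forall fun n => (hε n).1⟩
  have hvl := hv.locallyIntegrable hp1
  have hgl := hg.locallyIntegrable hp1
  refine ⟨fun n => moll (ε n) v, fun n => moll_contDiff (hε n).1 hvl,
    fun n => hasCompactSupport_moll (hε n).1 hB.isCompact_closure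
      fun y hy => hv0 y fun hyB => hy (subset_closure hyB), ?_, ?_⟩
  · refine tendsto_of_tendsto_of_tendsto_of_le_of_le tendsto_const_nhds
      ((tendsto_eLpNorm_moll_sub hp1 hp hvm hv).comp hεt) (fun n => zero_le) fun n => ?_
    exact eLpNorm_restrict_le _ _ _ _
  · refine tendsto_of_tendsto_of_tendsto_of_le_of_le tendsto_const_nhds
      ((tendsto_eLpNorm_moll_sub hp1 hp hgm hg).comp hεt) (fun n => zero_le) fun n => ?_
    refine le_trans (le_of_eq ?_) (eLpNorm_restrict_le _ _ _ N)
    refine eLpNorm_congr_ae ?_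
    filter_upwards [ae_restrict_mem hNm] with x hx
    rw [fderiv_moll_of_hasWeakGradient hw hv0 hg0 hvl hgl (hε n).1
      ((Metric.closedBall_subset_closedBall (hε n).2.le).trans (hN x hx))]

end

section

/-! ### Renormalizing functions -/

variable {M : ℕ}

lemma orthant_eq_pi : orthant M = univ.pi fun _ => Ici (0 : ℝ) := by
  ext ρ
  simp [orthant, Pi.le_def]

lemma convex_orthant : Convex ℝ (orthant M) := by
  rw [orthant_eq_pi]
  exact convex_pi fun _ _ => convex_Ici 0

lemma uniqueDiffOn_orthant : UniqueDiffOn ℝ (orthant M) := by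
  rw [orthant_eq_pi]
  exact UniqueDiffOn.univ_pi fun _ => uniqueDiffOn_Ici 0

lemma zero_mem_orthant : (0 : Fin M → ℝ) ∈ orthant M := fun _ => le_rfl

lemma orthant_mem_nhds {ρ : Fin M → ℝ} (hρ : ∀ i, 0 < ρ i) : orthant M ∈ 𝓝 ρ := by
  rw [orthant_eq_pi]
  exact set_pi_mem_nhds finite_univ fun i _ => Ici_mem_nhds (hρ i)

namespace IsRenormalizer

variable {𝓑 : (Fin M → ℝ) → ℝ}

lemma continuousOn_fderivWithin (h : IsRenormalizer 𝓑) :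
    ContinuousOn (fderivWithin ℝ 𝓑 (orthant M)) (orthant M) :=
  h.contDiffOn.continuousOn_fderivWithin uniqueDiffOn_orthant (by simp)

lemma hasFDerivWithinAt (h : IsRenormalizer 𝓑) {ρ : Fin M → ℝ} (hρ : ρ ∈ orthant M) :
    HasFDerivWithinAt 𝓑 (fderivWithin ℝ 𝓑 (orthant M) ρ) (orthant M) ρ :=
  (h.contDiffOn.differentiableOn (by simp) ρ hρ).hasFDerivWithinAt

/-- The gradient, extended to the closed orthant, is bounded there, and the function is
Lipschitz continuous. -/
lemma exists_bound (h : IsRenormalizer 𝓑) : ∃ C : ℝ, 0 ≤ C ∧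
    (∀ ρ ∈ orthant M, ‖fderivWithin ℝ 𝓑 (orthant M) ρ‖ ≤ C) ∧
    ∀ ρ ∈ orthant M, ∀ σ ∈ orthant M, ‖𝓑 ρ - 𝓑 σ‖ ≤ C * ‖ρ - σ‖ := by
  obtain ⟨C, hC⟩ := h.bounded_grad
  have hC0 : 0 ≤ C := (norm_nonneg _).trans (hC (fun _ => 1) fun _ => one_pos)
  have hG : ∀ ρ ∈ orthant M, ‖fderivWithin ℝ 𝓑 (orthant M) ρ‖ ≤ C := by
    intro ρ hρ
    have hpos : ∀ t : ℝ, 0 < t → ∀ i, 0 < (ρ + fun _ => t : Fin M → ℝ) i := fun t ht i =>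
      add_pos_of_nonneg_of_pos (hρ i) ht
    have hlim : Tendsto (fun t : ℝ => ρ + fun _ => t) (𝓝[>] 0) (𝓝[orthant M] ρ) := by
      refine tendsto_nhdsWithin_iff.2 ⟨?_, ?_⟩
      · have : Continuous fun t : ℝ => (ρ + fun _ => t : Fin M → ℝ) := by fun_prop
        have h2 := (this.tendsto 0).mono_left (nhdsWithin_le_nhds (s := Ioi 0))
        have h3 : (ρ + fun _ => (0 : ℝ)) = ρ := by ext i; simp
        rwa [h3] at h2
      · filter_upwards [self_mem_nhdsWithin] with t ht
        exact fun i => (hpos t ht i).le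
    have := ((h.continuousOn_fderivWithin ρ hρ).tendsto.comp hlim).norm
    refine le_of_tendsto this ?_
    filter_upwards [self_mem_nhdsWithin] with t ht
    simp only [Function.comp_apply]
    rw [fderivWithin_of_mem_nhds (orthant_mem_nhds (hpos t ht))]
    exact hC _ (hpos t ht)
  exact ⟨C, hC0, hG, fun ρ hρ σ hσ =>
    convex_orthant.norm_image_sub_le_of_norm_hasFDerivWithin_le
      (fun x hx => h.hasFDerivWithinAt hx) hG hσ hρ⟩

lemma stronglyMeasurable_comp (h : IsRenormalizer 𝓑) {α : Type*} [MeasurableSpace α]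
    {f : α → Fin M → ℝ} (hf : StronglyMeasurable f) (h0 : ∀ a, f a ∈ orthant M) :
    StronglyMeasurable fun a => 𝓑 (f a) := by
  have h1 : Continuous fun σ : orthant M => 𝓑 σ :=
    continuousOn_iff_continuous_domRestrict.1 h.contDiffOn.continuousOn
  have h2 : Measurable fun a => (⟨f a, h0 a⟩ : orthant M) := hf.measurable.subtype_mk
  exact (h1.measurable.comp h2).stronglyMeasurable

lemma stronglyMeasurable_fderivWithin_comp (h : IsRenormalizer 𝓑) {α : Type*} [MeasurableSpace α]
    {f : α → Fin M → ℝ} (hf : StronglyMeasurable f) (h0 : ∀ a, f a ∈ orthant M) :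
    StronglyMeasurable fun a => fderivWithin ℝ 𝓑 (orthant M) (f a) := by
  have h1 : Continuous fun σ : orthant M => fderivWithin ℝ 𝓑 (orthant M) σ :=
    continuousOn_iff_continuous_domRestrict.1 h.continuousOn_fderivWithin
  have h2 : StronglyMeasurable fun a => (⟨f a, h0 a⟩ : orthant M) :=
    hf.measurable.subtype_mk.stronglyMeasurable
  exact h1.comp_stronglyMeasurable h2

end IsRenormalizer

/-- Mollifications stay in the orthant, also where the defining integral diverges and takes the
junk value zero. -/
lemma moll_mem_orthant {ε : ℝ} (hε : 0 < ε) {ρ : R3 → Fin M → ℝ}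
    (h0 : ∀ x, ρ x ∈ orthant M) (x : R3) : moll ε ρ x ∈ orthant M := by
  by_cases h : Integrable fun y => mollKernel ε (x - y) • ρ y
  · intro i
    have := (ContinuousLinearMap.proj (R := ℝ) (φ := fun _ : Fin M => ℝ) i).integral_comp_comm h
    simp only [ContinuousLinearMap.proj_apply] at this
    rw [moll, ← this]
    exact integral_nonneg fun y => mul_nonneg (mollKernel_nonneg hε _) (h0 y i)
  · rw [moll, integral_undef h]
    exact zero_mem_orthant

end

noncomputable section

/-! ### Mollified fluxes and commutators -/

section Flux

variable {F : Type*} [NormedAddCommGroup F] [NormedSpace ℝ F]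

/-- The divergence `div ((ρ v) * k_ε)` of the mollified flux of the density `ρ` with velocity `v`,
written with the gradient of the mollifying kernel `k_ε`. -/
def flux (ε : ℝ) (v : R3 → R3) (ρ : R3 → F) (x : R3) : F :=
  ∫ y, (fderiv ℝ (mollKernel ε) (x - y) (v y)) • ρ y

/-- The Friedrichs commutator `div ((ρ v) * k_ε) - v · ∇(ρ * k_ε)`. -/
def mollCommutator (ε : ℝ) (v : R3 → R3) (ρ : R3 → F) (x : R3) : F :=
  ∫ y, (fderiv ℝ (mollKernel ε) (x - y) (v y - v x)) • ρ y

lemma stronglyMeasurable_fderiv_mollKernel_smul (ε : ℝ) {v : R3 → R3} {ρ : R3 → F}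
    (hv : StronglyMeasurable v) (hρ : StronglyMeasurable ρ) :
    StronglyMeasurable fun z : R3 × R3 =>
      (fderiv ℝ (mollKernel ε) (z.1 - z.2) (v z.2)) • ρ z.2 := by
  have h1 : StronglyMeasurable fun z : R3 × R3 => fderiv ℝ (mollKernel ε) (z.1 - z.2) :=
    ((continuous_fderiv_mollKernel ε).comp (continuous_fst.sub continuous_snd)).stronglyMeasurable
  have h2 : StronglyMeasurable fun z : R3 × R3 => v z.2 := hv.comp_measurable measurable_snd
  have h3 : StronglyMeasurable fun z : R3 × R3 => fderiv ℝ (mollKernel ε) (z.1 - z.2) (v z.2) :=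
    isBoundedBilinearMap_apply.continuous.comp_stronglyMeasurable (h1.prodMk h2)
  exact h3.smul (hρ.comp_measurable measurable_snd)

lemma stronglyMeasurable_flux (ε : ℝ) {v : R3 → R3} {ρ : R3 → F}
    (hv : StronglyMeasurable v) (hρ : StronglyMeasurable ρ) : StronglyMeasurable (flux ε v ρ) :=
  (stronglyMeasurable_fderiv_mollKernel_smul ε hv hρ).integral_prod_right'

lemma enorm_fderiv_smul_le (ε : ℝ) (h w : R3) (c : F) :
    ‖(fderiv ℝ (mollKernel ε) h w) • c‖ₑ ≤ ‖fderiv ℝ (mollKernel ε) h‖ₑ * (‖w‖ₑ * ‖c‖ₑ) := by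
  rw [enorm_smul, ← mul_assoc]
  gcongr
  exact ContinuousLinearMap.le_opENorm _ _

lemma integrable_flux_integrand {ε : ℝ} (hε : 0 < ε) {v : R3 → R3} {ρ : R3 → F}
    (hv : StronglyMeasurable v) (hρ : StronglyMeasurable ρ)
    (hvρ : ∫⁻ y, ‖ρ y‖ₑ * ‖v y‖ₑ < ⊤) (x : R3) :
    Integrable fun y => (fderiv ℝ (mollKernel ε) (x - y) (v y)) • ρ y := by
  obtain ⟨C, hC⟩ := exists_bound_fderiv_mollKernel hε
  refine ⟨((stronglyMeasurable_fderiv_mollKernel_smul ε hv hρ).comp_measurable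
    (measurable_const.prodMk measurable_id)).aestronglyMeasurable, ?_⟩
  refine lt_of_le_of_lt (lintegral_mono (g := fun y => ENNReal.ofReal C * (‖ρ y‖ₑ * ‖v y‖ₑ))
    fun y => ?_) ?_
  · refine (enorm_fderiv_smul_le _ _ _ _).trans ?_
    rw [mul_comm ‖v y‖ₑ]
    refine mul_le_mul_left ?_ _
    rw [← ofReal_norm]
    exact ENNReal.ofReal_le_ofReal (hC _)
  · have hm : Measurable fun y => ‖ρ y‖ₑ * ‖v y‖ₑ := hρ.enorm.mul hv.enorm
    rw [lintegral_const_mul _ hm]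
    exact ENNReal.mul_lt_top (by simp) hvρ

lemma flux_sub {ε : ℝ} (hε : 0 < ε) {v w : R3 → R3} {ρ : R3 → F}
    (hv : StronglyMeasurable v) (hw : StronglyMeasurable w) (hρ : StronglyMeasurable ρ)
    (hvρ : ∫⁻ y, ‖ρ y‖ₑ * ‖v y‖ₑ < ⊤) (hwρ : ∫⁻ y, ‖ρ y‖ₑ * ‖w y‖ₑ < ⊤) (x : R3) :
    flux ε (fun y => v y - w y) ρ x = flux ε v ρ x - flux ε w ρ x := by
  unfold flux
  rw [← integral_sub (integrable_flux_integrand hε hv hρ hvρ x)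
    (integrable_flux_integrand hε hw hρ hwρ x)]
  simp [sub_smul]

lemma flux_eq_zero {ε : ℝ} (hε : 0 < ε) {v : R3 → R3} {ρ : R3 → F} {x : R3}
    (h : ∀ y, ‖x - y‖ ≤ ε → ρ y = 0) : flux ε v ρ x = 0 := by
  unfold flux
  refine integral_eq_zero_of_ae (Eventually.of_forall fun y => ?_)
  rcases le_or_gt ‖x - y‖ ε with hy | hy
  · simp [h y hy]
  · simp [fderiv_mollKernel_eq_zero hε hy]

/-- The mollified flux is the transport term of the mollified density plus the commutator. -/
lemma flux_eq_fderiv_add_mollCommutator [CompleteSpace F] {ε : ℝ} (hε : 0 < ε) {v : R3 → R3}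
    {ρ : R3 → F} (hv : StronglyMeasurable v) (hρ : StronglyMeasurable ρ) (hρi : Integrable ρ)
    (hvρ : ∫⁻ y, ‖ρ y‖ₑ * ‖v y‖ₑ < ⊤) (x : R3) :
    flux ε v ρ x = fderiv ℝ (moll ε ρ) x (v x) + mollCommutator ε v ρ x := by
  rw [fderiv_moll_apply hε hρi.locallyIntegrable, flux, mollCommutator]
  have h1 := integrable_flux_integrand hε hv hρ hvρ x
  have h2 := integrable_fderiv_mollKernel_smul hε hρi.locallyIntegrable x (v x)
  simp_rw [map_sub, sub_smul]
  rw [integral_sub h1 h2]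
  abel

/-- At a fixed scale, the mollified flux is controlled by the product of density and velocity. -/
lemma lintegral_flux_le (ε : ℝ) {v : R3 → R3} {ρ : R3 → F}
    (hv : StronglyMeasurable v) (hρ : StronglyMeasurable ρ) :
    ∫⁻ x, ‖flux ε v ρ x‖ₑ ≤
      (∫⁻ h, ‖fderiv ℝ (mollKernel ε) h‖ₑ) * ∫⁻ y, ‖ρ y‖ₑ * ‖v y‖ₑ := by
  calc ∫⁻ x, ‖flux ε v ρ x‖ₑ
      ≤ ∫⁻ x, ∫⁻ y, ‖fderiv ℝ (mollKernel ε) (x - y)‖ₑ * (‖ρ y‖ₑ * ‖v y‖ₑ) := by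
        refine lintegral_mono fun x => (enorm_integral_le_lintegral_enorm _).trans ?_
        refine lintegral_mono fun y => (enorm_fderiv_smul_le _ _ _ _).trans ?_
        rw [mul_comm ‖v y‖ₑ]
    _ ≤ _ := by
        refine lintegral_kernel_mul_le (Ψ := fun _ y => ‖ρ y‖ₑ * ‖v y‖ₑ)
          (continuous_fderiv_mollKernel ε).enorm.measurable ?_ fun h _ => le_rfl
        exact (hρ.enorm.mul hv.enorm).comp measurable_snd

lemma lintegral_enorm_fderiv_mollKernel_lt_top {ε : ℝ} (hε : 0 < ε) :
    ∫⁻ h, ‖fderiv ℝ (mollKernel ε) h‖ₑ < ⊤ :=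
  ((continuous_fderiv_mollKernel ε).integrable_of_hasCompactSupport
    (hasCompactSupport_fderiv_mollKernel hε)).2

/-- The mean value inequality, with the average of the gradient over the segment. -/
lemma enorm_sub_le_lintegral_fderiv {v : R3 → R3} (hv : ContDiff ℝ 1 v) (x y : R3) :
    ‖v y - v x‖ₑ ≤
      ‖x - y‖ₑ * ∫⁻ θ in Ioc (0 : ℝ) 1, ‖fderiv ℝ v (y + θ • (x - y))‖ₑ := by
  have hline : ∀ θ : ℝ, HasDerivAt (fun θ : ℝ => v (y + θ • (x - y)))
      (fderiv ℝ v (y + θ • (x - y)) (x - y)) θ := by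
    intro θ
    have h1 : HasDerivAt (fun θ : ℝ => y + θ • (x - y)) (x - y) θ := by
      simpa using ((hasDerivAt_id θ).smul_const (x - y)).const_add y
    exact ((hv.differentiable (by simp)) _).hasFDerivAt.comp_hasDerivAt θ h1
  have hc : Continuous fun θ : ℝ => fderiv ℝ v (y + θ • (x - y)) :=
    (hv.continuous_fderiv (by simp)).comp (by fun_prop)
  have hint := intervalIntegral.integral_eq_sub_of_hasDerivAt (fun θ _ => hline θ)
    ((hc.clm_apply continuous_const).intervalIntegrable 0 1)
  simp only [one_smul, add_sub_cancel, zero_smul, add_zero] at hint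
  rw [enorm_sub_rev, ← hint, intervalIntegral.integral_of_le zero_le_one]
  refine (enorm_integral_le_lintegral_enorm _).trans ?_
  rw [← lintegral_const_mul _ hc.enorm.measurable]
  refine lintegral_mono fun θ => ?_
  rw [mul_comm]
  exact ContinuousLinearMap.le_opENorm _ _

/-- Pairing of a density with the averages of a continuous function over the segments
`[y, y + h]`, which lie in `N` as soon as `y` carries some of the density. -/
lemma lintegral_mul_segment_le {F G : Type*} [NormedAddCommGroup F] [NormedAddCommGroup G]
    {γ p : ℝ≥0∞} [γ.HolderConjugate p] {g : R3 → G} (hg : Continuous g) (hgm : StronglyMeasurable g)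
    {ρ : R3 → F} (hρ : StronglyMeasurable ρ) {N : Set R3} (hN : MeasurableSet N) {h : R3}
    (hρN : ∀ y k, ρ y ≠ 0 → ‖k‖ ≤ ‖h‖ → y + k ∈ N) :
    ∫⁻ y, ‖ρ y‖ₑ * ∫⁻ θ in Ioc (0 : ℝ) 1, ‖g (y + θ • h)‖ₑ ≤
      eLpNorm ρ γ * eLpNorm g p (volume.restrict N) := by
  have hind : StronglyMeasurable (N.indicator g) := hgm.indicator hN
  have hm2 : Measurable fun z : R3 × ℝ => ‖ρ z.1‖ₑ * ‖g (z.1 + z.2 • h)‖ₑ :=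
    (hρ.enorm.comp measurable_fst).mul (hg.comp (by fun_prop)).enorm.measurable
  calc ∫⁻ y, ‖ρ y‖ₑ * ∫⁻ θ in Ioc (0 : ℝ) 1, ‖g (y + θ • h)‖ₑ
      = ∫⁻ y, ∫⁻ θ in Ioc (0 : ℝ) 1, ‖ρ y‖ₑ * ‖g (y + θ • h)‖ₑ := by
        refine lintegral_congr fun y => ?_
        have : Continuous fun θ : ℝ => g (y + θ • h) := hg.comp (by fun_prop)
        rw [lintegral_const_mul _ this.enorm.measurable]
    _ = ∫⁻ θ in Ioc (0 : ℝ) 1, ∫⁻ y, ‖ρ y‖ₑ * ‖g (y + θ • h)‖ₑ :=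
        lintegral_lintegral_swap hm2.aemeasurable
    _ ≤ ∫⁻ θ in Ioc (0 : ℝ) 1, eLpNorm ρ γ * eLpNorm g p (volume.restrict N) := by
        refine setLIntegral_mono measurable_const fun θ hθ => ?_
        rw [← eLpNorm_indicator_eq_eLpNorm_restrict hN]
        refine le_trans (lintegral_mono fun y => ?_)
          (lintegral_enorm_mul_enorm_translate_le hρ hind (θ • h))
        by_cases hy : ρ y = 0
        · simp [hy]
        · rw [indicator_of_mem (hρN y (θ • h) hy ?_)]
          rw [norm_smul, Real.norm_eq_abs, abs_of_pos hθ.1]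
          exact mul_le_of_le_one_left (norm_nonneg _) hθ.2
    _ = _ := by simp

/-- The `L¹` bound for the commutator: it costs one derivative of the velocity, and no derivative
of the density. -/
lemma lintegral_mollCommutator_le {γ p : ℝ≥0∞} [γ.HolderConjugate p] {Λ : ℝ≥0∞} {ε : ℝ}
    (hε : 0 < ε) (hΛ : ∫⁻ x, ‖fderiv ℝ (mollKernel ε) x‖ₑ * ‖x‖ₑ ≤ Λ)
    {v : R3 → R3} (hv : ContDiff ℝ 1 v) {ρ : R3 → F} (hρ : StronglyMeasurable ρ) {N : Set R3}
    (hN : MeasurableSet N) (hρN : ∀ y h, ρ y ≠ 0 → ‖h‖ ≤ ε → y + h ∈ N) :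
    ∫⁻ x, ‖mollCommutator ε v ρ x‖ₑ ≤
      Λ * (eLpNorm ρ γ * eLpNorm (fderiv ℝ v) p (volume.restrict N)) := by
  have hvc := hv.continuous_fderiv (n := 1) (by simp)
  have hm : Measurable fun z : (R3 × R3) × ℝ =>
      ‖fderiv ℝ v (z.1.2 + z.2 • (z.1.1 - z.1.2))‖ₑ := by
    apply Continuous.measurable
    exact (hvc.comp (by fun_prop)).enorm
  refine le_trans (lintegral_mono fun x => (enorm_integral_le_lintegral_enorm _).trans
    (lintegral_mono (g := fun y => (‖fderiv ℝ (mollKernel ε) (x - y)‖ₑ * ‖x - y‖ₑ) *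
      (‖ρ y‖ₑ * ∫⁻ θ in Ioc (0 : ℝ) 1, ‖fderiv ℝ v (y + θ • (x - y))‖ₑ)) fun y =>
      (enorm_fderiv_smul_le _ _ _ _).trans ?_)) ?_
  · refine (mul_le_mul_right (mul_le_mul_left (enorm_sub_le_lintegral_fderiv hv x y) _) _).trans
      (le_of_eq ?_)
    ring
  · refine le_trans (lintegral_kernel_mul_le
      (κ := fun h => ‖fderiv ℝ (mollKernel ε) h‖ₑ * ‖h‖ₑ)
      (Ψ := fun x y => ‖ρ y‖ₑ * ∫⁻ θ in Ioc (0 : ℝ) 1, ‖fderiv ℝ v (y + θ • (x - y))‖ₑ)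
      ((continuous_fderiv_mollKernel ε).enorm.measurable.mul continuous_enorm.measurable)
      ((hρ.enorm.comp measurable_snd).mul hm.lintegral_prod_right') fun h hh => ?_)
      (mul_le_mul_left hΛ _)
    simp only [add_sub_cancel_left]
    refine lintegral_mul_segment_le hvc hvc.stronglyMeasurable hρ hN fun y k hy hk => ?_
    refine hρN y k hy (hk.trans ?_)
    by_contra hc
    exact hh (by rw [fderiv_mollKernel_eq_zero hε (not_le.1 hc), ← ofReal_norm]; simp)

end Flux

end

/-! ### The commutator for smooth velocities -/

lemma divOf_sub (L L' : R3 →L[ℝ] R3) : divOf (L - L') = divOf L - divOf L' := by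
  simp [divOf, Finset.sum_sub_distrib]

lemma norm_divOf_le (L : R3 →L[ℝ] R3) : ‖divOf L‖ ≤ 3 * ‖L‖ := by
  have : ∀ i : Fin 3, ‖(L (EuclideanSpace.single i 1)) i‖ ≤ ‖L‖ := fun i =>
    (PiLp.norm_apply_le _ i).trans ((L.le_opNorm _).trans (by simp))
  calc ‖divOf L‖ ≤ ∑ i : Fin 3, ‖(L (EuclideanSpace.single i 1)) i‖ := norm_sum_le _ _
    _ ≤ ∑ _i : Fin 3, ‖L‖ := Finset.sum_le_sum fun i _ => this i
    _ = _ := by simp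

lemma continuous_divOf : Continuous divOf := by
  unfold divOf
  refine continuous_finsetSum _ fun i _ => ?_
  exact (EuclideanSpace.proj (𝕜 := ℝ) i).continuous.comp
    ((ContinuousLinearMap.apply ℝ R3 (EuclideanSpace.single i (1 : ℝ))).continuous)

lemma fderiv_apply_eq_sum (L : R3 →L[ℝ] ℝ) (w : R3) :
    L w = ∑ i, L (EuclideanSpace.single i 1) * w i := by
  conv_lhs => rw [← (EuclideanSpace.basisFun (Fin 3) ℝ).sum_repr w]
  simp [mul_comm]

/-- Integration by parts for the divergence. -/
lemma integral_mul_divOf_fderiv {f : R3 → ℝ} (hf : ContDiff ℝ 1 f) (hfc : HasCompactSupport f)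
    {w : R3 → R3} (hw : ContDiff ℝ 1 w) :
    ∫ x, f x * divOf (fderiv ℝ w x) = -∫ x, fderiv ℝ f x (w x) := by
  have hf' := hf.continuous_fderiv (by simp)
  have hw' := hw.continuous_fderiv (by simp)
  have hwi : ∀ i, ContDiff ℝ 1 fun x => w x i := fun i =>
    (EuclideanSpace.proj (𝕜 := ℝ) i).contDiff.comp hw
  have hwd : ∀ i x e, fderiv ℝ (fun x => w x i) x e = (fderiv ℝ w x e) i := by
    intro i x e
    have h : HasFDerivAt (fun x => w x i)
        ((EuclideanSpace.proj (𝕜 := ℝ) i : R3 →L[ℝ] ℝ).comp (fderiv ℝ w x)) x :=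
      (EuclideanSpace.proj (𝕜 := ℝ) i : R3 →L[ℝ] ℝ).hasFDerivAt.comp x
        ((hw.differentiable (by simp)) x).hasFDerivAt
    rw [h.fderiv]
    rfl
  have hcs' : HasCompactSupport (fderiv ℝ f) := hfc.fderiv ℝ
  have key : ∀ i, ∫ x, f x * (fderiv ℝ w x (EuclideanSpace.single i 1)) i =
      -∫ x, fderiv ℝ f x (EuclideanSpace.single i 1) * w x i := by
    intro i
    have := integral_mul_fderiv_eq_neg_fderiv_mul_of_integrable (μ := (volume : Measure R3))
      (f := f) (g := fun x => w x i) (v := EuclideanSpace.single i (1 : ℝ)) ?_ ?_ ?_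
      (fun x _ => (hf.differentiable (by simp)) x) (fun x _ => ((hwi i).differentiable (by simp)) x)
    · simpa only [hwd] using this
    · refine ((hf'.clm_apply continuous_const).mul
        (hwi i).continuous).integrable_of_hasCompactSupport ?_
      exact (hcs'.comp_left (g := fun L : R3 →L[ℝ] ℝ => L _) rfl).mul_right
    · refine (hf.continuous.mul (((hwi i).continuous_fderiv (by simp)).clm_apply
        continuous_const)).integrable_of_hasCompactSupport hfc.mul_right
    · exact (hf.continuous.mul (hwi i).continuous).integrable_of_hasCompactSupport hfc.mul_right
  have hsum : ∀ x, fderiv ℝ f x (w x) = ∑ i, fderiv ℝ f x (EuclideanSpace.single i 1) * w x i :=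
    fun x => fderiv_apply_eq_sum _ _
  simp only [hsum, divOf, Finset.mul_sum]
  rw [integral_finsetSum, integral_finsetSum, ← Finset.sum_neg_distrib]
  · exact Finset.sum_congr rfl fun i _ => key i
  · intro i _
    refine ((hf'.clm_apply continuous_const).mul
      (hwi i).continuous).integrable_of_hasCompactSupport ?_
    exact (hcs'.comp_left (g := fun L : R3 →L[ℝ] ℝ => L _) rfl).mul_right
  · intro i _
    refine Continuous.integrable_of_hasCompactSupport ?_ hfc.mul_right
    exact hf.continuous.mul ((EuclideanSpace.proj (𝕜 := ℝ) i).continuous.comp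
      (hw'.clm_apply continuous_const))

/-- An integration by parts: the divergence of the mollified field is the mollified divergence. -/
lemma integral_fderiv_mollKernel_apply {ε : ℝ} (hε : 0 < ε) {w : R3 → R3} (hw : ContDiff ℝ 1 w)
    (x : R3) :
    ∫ y, fderiv ℝ (mollKernel ε) (x - y) (w y) = moll ε (fun y => divOf (fderiv ℝ w y)) x := by
  have hk : ContDiff ℝ 1 fun y => mollKernel ε (x - y) :=
    ((mollKernel_contDiff ε).of_le (by simp)).comp (contDiff_const.sub contDiff_id)
  have hc : HasCompactSupport fun y => mollKernel ε (x - y) :=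
    (hasCompactSupport_mollKernel hε).comp_homeomorph (Homeomorph.subLeft x)
  have hder : ∀ y e, fderiv ℝ (fun y => mollKernel ε (x - y)) y e =
      -fderiv ℝ (mollKernel ε) (x - y) e := by
    intro y e
    have h1 : HasFDerivAt (fun y : R3 => x - y) (-ContinuousLinearMap.id ℝ R3) y :=
      (hasFDerivAt_id y).const_sub x
    have h2 : HasFDerivAt (fun y => mollKernel ε (x - y)) _ y :=
      (mollKernel_differentiable ε (x - y)).hasFDerivAt.comp y h1
    rw [h2.fderiv]
    simp
  have := integral_mul_divOf_fderiv hk hc hw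
  simp only [hder, integral_neg, neg_neg] at this
  rw [← this]
  rfl

lemma integral_fderiv_mollKernel_const {ε : ℝ} (hε : 0 < ε) (x e : R3) :
    ∫ y, fderiv ℝ (mollKernel ε) (x - y) e = 0 := by
  rw [integral_fderiv_mollKernel_apply hε (w := fun _ => e) contDiff_const]
  simp [moll, divOf]

/-- The mollification of a uniformly continuous function converges uniformly. -/
lemma norm_moll_sub_le {F : Type*} [NormedAddCommGroup F] [NormedSpace ℝ F] [CompleteSpace F]
    {ε δ : ℝ} (hε : 0 < ε) {f : R3 → F} (hf : Continuous f) {x : R3}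
    (hδ : ∀ y, ‖x - y‖ ≤ ε → ‖f y - f x‖ ≤ δ) : ‖moll ε f x - f x‖ ≤ δ := by
  rw [moll_sub_self hε hf.locallyIntegrable]
  have hi : Integrable fun y => mollKernel ε (x - y) := (integrable_mollKernel hε).comp_sub_left x
  calc ‖∫ y, mollKernel ε (x - y) • (f y - f x)‖ ≤ ∫ y, mollKernel ε (x - y) * δ := by
        refine norm_integral_le_of_norm_le (hi.mul_const δ) (Eventually.of_forall fun y => ?_)
        rw [norm_smul, Real.norm_of_nonneg (mollKernel_nonneg hε _)]
        rcases le_or_gt ‖x - y‖ ε with h | h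
        · exact mul_le_mul_of_nonneg_left (hδ y h) (mollKernel_nonneg hε _)
        · simp [mollKernel_eq_zero hε h.le]
    _ = δ := by
        rw [integral_mul_const, integral_sub_left_eq_self, integral_mollKernel hε, one_mul]

/-- For a smooth velocity, the Friedrichs commutator converges to `ρ div v` in `L¹`. -/
lemma tendsto_lintegral_mollCommutator_sub {F : Type*} [NormedAddCommGroup F] [NormedSpace ℝ F]
    [CompleteSpace F] {v : R3 → R3} (hv : ContDiff ℝ 1 v) (hvc : HasCompactSupport v) {ρ : R3 → F}
    (hρ : StronglyMeasurable ρ) (hρi : Integrable ρ) :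
    Tendsto (fun ε : ℝ => ∫⁻ x, ‖mollCommutator ε v ρ x - divOf (fderiv ℝ v x) • ρ x‖ₑ)
      (𝓝[>] 0) (𝓝 0) := by
  obtain ⟨Λ, hΛtop, hΛ⟩ := exists_lintegral_fderiv_mollKernel_le
  obtain ⟨Lip, hLip⟩ := hv.lipschitzWith_of_hasCompactSupport hvc (by simp)
  set d : R3 → ℝ := fun x => divOf (fderiv ℝ v x) with hd
  have hdc : Continuous d := continuous_divOf.comp (hv.continuous_fderiv (by simp))
  have hdu : UniformContinuous d :=
    ((hvc.fderiv ℝ).comp_left (g := divOf) (by simp [divOf])).uniformContinuous_of_continuous hdc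
  -- the kernel of the commutator has mean `moll ε d`; what remains is an oscillation of `ρ`
  have hsplit : ∀ ε : ℝ, 0 < ε → ∀ x, mollCommutator ε v ρ x - d x • ρ x =
      (∫ y, (fderiv ℝ (mollKernel ε) (x - y) (v y - v x)) • (ρ y - ρ x)) +
        (moll ε d x - d x) • ρ x := by
    intro ε hε x
    have hk1 : Continuous fun y => fderiv ℝ (mollKernel ε) (x - y) (v y - v x) :=
      ((continuous_fderiv_mollKernel ε).comp (by fun_prop)).clm_apply
        (hv.continuous.sub continuous_const)
    have hk1c : HasCompactSupport fun y => fderiv ℝ (mollKernel ε) (x - y) (v y - v x) := by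
      have h0 : HasCompactSupport fun y => fderiv ℝ (mollKernel ε) (x - y) :=
        (hasCompactSupport_fderiv_mollKernel hε).comp_homeomorph (Homeomorph.subLeft x)
      refine h0.mono fun y hy => ?_
      rw [Function.mem_support] at hy ⊢
      exact fun h => hy (by simp [h])
    have hk1i := hk1.integrable_of_hasCompactSupport hk1c (μ := (volume : Measure R3))
    have hi1 : Integrable fun y => (fderiv ℝ (mollKernel ε) (x - y) (v y - v x)) • ρ y := by
      obtain ⟨C, hC⟩ := hk1.bounded_above_of_compact_support hk1c
      exact hρi.bdd_smul C hk1.aestronglyMeasurable (Eventually.of_forall hC)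
    have hval : ∫ y, fderiv ℝ (mollKernel ε) (x - y) (v y - v x) = moll ε d x := by
      simp_rw [map_sub]
      rw [integral_sub, integral_fderiv_mollKernel_apply hε hv,
        integral_fderiv_mollKernel_const hε, sub_zero]
      · refine (((continuous_fderiv_mollKernel ε).comp (by fun_prop)).clm_apply
          hv.continuous).integrable_of_hasCompactSupport ?_
        refine hvc.mono fun y hy => ?_
        rw [Function.mem_support] at hy ⊢
        exact fun h => hy (by simp [h])
      · refine (((continuous_fderiv_mollKernel ε).comp (by fun_prop)).clm_apply
          continuous_const).integrable_of_hasCompactSupport ?_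
        exact ((hasCompactSupport_fderiv_mollKernel hε).comp_homeomorph
          (Homeomorph.subLeft x)).comp_left (g := fun L : R3 →L[ℝ] ℝ => L (v x)) rfl
    simp_rw [smul_sub]
    rw [integral_sub hi1 (hk1i.smul_const _), integral_smul_const, hval, mollCommutator, sub_smul]
    abel
  rw [ENNReal.tendsto_nhds_zero]
  intro δ hδ
  -- `η` is chosen so small that the two error terms add up to less than `δ`
  obtain ⟨η, hη, hηδ⟩ : ∃ η : ℝ, 0 < η ∧
      Λ * (Lip * ENNReal.ofReal η) + ENNReal.ofReal η * ∫⁻ x, ‖ρ x‖ₑ ≤ δ := by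
    have hlim : Tendsto (fun η : ℝ => Λ * (Lip * ENNReal.ofReal η) +
        ENNReal.ofReal η * ∫⁻ x, ‖ρ x‖ₑ) (𝓝[>] 0) (𝓝 0) := by
      have h0 : Tendsto (fun η : ℝ => ENNReal.ofReal η) (𝓝[>] 0) (𝓝 0) := by
        have := (ENNReal.continuous_ofReal.tendsto 0).mono_left
          (nhdsWithin_le_nhds (s := Ioi (0 : ℝ)))
        simpa using this
      have h1 := ENNReal.Tendsto.const_mul (a := Λ)
        (ENNReal.Tendsto.const_mul (a := (Lip : ℝ≥0∞)) h0 (Or.inr (by simp))) (Or.inr hΛtop)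
      have h2 := ENNReal.Tendsto.mul_const (b := ∫⁻ x, ‖ρ x‖ₑ) h0 (Or.inr hρi.2.ne)
      simpa using h1.add h2
    obtain ⟨η, h1, h2⟩ := ((ENNReal.tendsto_nhds_zero.1 hlim δ hδ).and self_mem_nhdsWithin).exists
    exact ⟨η, h2, h1⟩
  have htr := (ENNReal.tendsto_nhds_zero.1 (tendsto_eLpNorm_translate_sub le_rfl (by simp)
    (memLp_one_iff_integrable.2 hρi))) (ENNReal.ofReal η) (by simpa using hη)
  obtain ⟨r₁, hr₁, htr⟩ := Metric.eventually_nhds_iff.1 htr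
  obtain ⟨r₂, hr₂, hdr⟩ := Metric.uniformContinuous_iff.1 hdu η hη
  filter_upwards [Ioo_mem_nhdsGT hr₁, Ioo_mem_nhdsGT hr₂] with ε hε₁ hε₂
  have hε : 0 < ε := hε₁.1
  refine le_trans ?_ hηδ
  have hm1 : StronglyMeasurable fun x => ∫ y, (fderiv ℝ (mollKernel ε) (x - y) (v y - v x)) •
      (ρ y - ρ x) := by
    have h1 : StronglyMeasurable fun z : R3 × R3 =>
        fderiv ℝ (mollKernel ε) (z.1 - z.2) (v z.2 - v z.1) := by
      apply Continuous.stronglyMeasurable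
      have := hv.continuous
      exact ((continuous_fderiv_mollKernel ε).comp (by fun_prop)).clm_apply (by fun_prop)
    exact (h1.smul ((hρ.comp_measurable measurable_snd).sub
      (hρ.comp_measurable measurable_fst))).integral_prod_right'
  refine (lintegral_mono fun x => (hsplit ε hε x ▸ enorm_add_le _ _)).trans ?_
  rw [lintegral_add_left hm1.enorm]
  gcongr
  · refine (lintegral_mono fun x => (enorm_integral_le_lintegral_enorm _).trans
      (lintegral_mono (g := fun y => (‖fderiv ℝ (mollKernel ε) (x - y)‖ₑ * ‖x - y‖ₑ) *
        (Lip * ‖ρ x - ρ y‖ₑ)) fun y => (enorm_fderiv_smul_le _ _ _ _).trans ?_)).trans ?_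
    · have h1 : ‖v y - v x‖ₑ ≤ Lip * ‖x - y‖ₑ := by
        have := hLip y x
        rwa [edist_eq_enorm_sub, edist_eq_enorm_sub, enorm_sub_rev y x] at this
      rw [enorm_sub_rev (ρ y)]
      refine (mul_le_mul_right (mul_le_mul_left h1 _) _).trans (le_of_eq ?_)
      ring
    · have hρ2 : Measurable fun z : R3 × R3 => ‖ρ z.1 - ρ z.2‖ₑ :=
        ((hρ.comp_measurable measurable_fst).sub (hρ.comp_measurable measurable_snd)).enorm
      refine le_trans (lintegral_kernel_mul_le
        (κ := fun h => ‖fderiv ℝ (mollKernel ε) h‖ₑ * ‖h‖ₑ)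
        (Ψ := fun x y => Lip * ‖ρ x - ρ y‖ₑ)
        ((continuous_fderiv_mollKernel ε).enorm.measurable.mul continuous_enorm.measurable)
        (hρ2.const_mul _) (C := Lip * ENNReal.ofReal η) fun h hh => ?_)
        (mul_le_mul_left (hΛ ε hε) _)
      have hh' : ‖h‖ ≤ ε := by
        by_contra hc
        exact hh (by rw [fderiv_mollKernel_eq_zero hε (not_le.1 hc), ← ofReal_norm]; simp)
      have hρ3 : Measurable fun y : R3 => ‖ρ (y + h) - ρ y‖ₑ :=
        hρ2.comp ((measurable_id.add_const h).prodMk measurable_id)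
      rw [lintegral_const_mul _ hρ3]
      gcongr
      have := htr (y := h) (by rw [dist_zero_right]; exact hh'.trans_lt hε₁.2)
      rwa [eLpNorm_one_eq_lintegral_enorm] at this
  · rw [← lintegral_const_mul _ hρ.enorm]
    refine lintegral_mono fun x => ?_
    rw [enorm_smul]
    gcongr
    rw [← ofReal_norm]
    refine ENNReal.ofReal_le_ofReal (norm_moll_sub_le hε hdc fun y hy => ?_)
    rw [← dist_eq_norm]
    refine (hdr ?_).le
    rw [dist_comm, dist_eq_norm]
    exact hy.trans_lt hε₂.2

noncomputable section

/-! ### Renormalization at a fixed time -/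

lemma mollCommutator_eq_zero {F : Type*} [NormedAddCommGroup F] [NormedSpace ℝ F] {ε : ℝ}
    (hε : 0 < ε) {v : R3 → R3} {ρ : R3 → F} {x : R3} (h : ∀ y, ‖x - y‖ ≤ ε → ρ y = 0) :
    mollCommutator ε v ρ x = 0 := by
  unfold mollCommutator
  refine integral_eq_zero_of_ae (Eventually.of_forall fun y => ?_)
  rcases le_or_gt ‖x - y‖ ε with hy | hy
  · simp [h y hy]
  · simp [fderiv_mollKernel_eq_zero hε hy]

variable {M : ℕ}

/-- The pairing of `∇𝓑(ρ_ε) · div ((ρ v) * k_ε)` with the test function `ζ`, where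
`ρ_ε = ρ * k_ε`. -/
def fluxPairing (𝓑 : (Fin M → ℝ) → ℝ) (ζ : R3 → ℝ) (ρ : R3 → Fin M → ℝ) (ε : ℝ)
    (v : R3 → R3) : ℝ :=
  ∫ x, ζ x * fderivWithin ℝ 𝓑 (orthant M) (moll ε ρ x) (flux ε v ρ x)

/-- The spatial part of the renormalized equation, tested with `ζ`; `g` is the velocity
gradient. -/
def renormPairing (𝓑 : (Fin M → ℝ) → ℝ) (ζ : R3 → ℝ) (ρ : R3 → Fin M → ℝ) (v : R3 → R3)
    (g : R3 → R3 →L[ℝ] R3) : ℝ :=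
  ∫ x, (𝓑 (ρ x) * fderiv ℝ ζ x (v x) -
    (fderivWithin ℝ 𝓑 (orthant M) (ρ x) (ρ x) - 𝓑 (ρ x)) * divOf (g x) * ζ x)

/-- The data of the renormalization at a fixed time: a renormalizing function with gradient bound
`Cb`, densities `ρ` in `L^γ` with support in the compact set `K`, and a test function `ζ` bounded by
`Z` together with its gradient on a set `N` that contains the `ε₀`-neighbourhood of `K`. -/
structure FixedTimeData (𝓑 : (Fin M → ℝ) → ℝ) (Cb : ℝ) (K N : Set R3) (ε₀ : ℝ) (ζ : R3 → ℝ)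
    (Z : ℝ) (ρ : R3 → Fin M → ℝ) (γ : ℝ≥0∞) : Prop where
  renorm : IsRenormalizer 𝓑
  Cb_nonneg : 0 ≤ Cb
  grad_le : ∀ ρ ∈ orthant M, ‖fderivWithin ℝ 𝓑 (orthant M) ρ‖ ≤ Cb
  lip : ∀ ρ ∈ orthant M, ∀ σ ∈ orthant M, ‖𝓑 ρ - 𝓑 σ‖ ≤ Cb * ‖ρ - σ‖
  isCompact : IsCompact K
  measurableSet : MeasurableSet N
  add_mem : ∀ y ∈ K, ∀ h, ‖h‖ ≤ ε₀ → y + h ∈ N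
  test : ContDiff ℝ 1 ζ
  test_le : ∀ x ∈ N, ‖ζ x‖ ≤ Z
  grad_test_le : ∀ x ∈ N, ‖fderiv ℝ ζ x‖ ≤ Z
  Z_nonneg : 0 ≤ Z
  one_le : 1 ≤ γ
  density_meas : StronglyMeasurable ρ
  density_mem : ∀ x, ρ x ∈ orthant M
  density_zero : ∀ x, x ∉ K → ρ x = 0
  density_memLp : MemLp ρ γ

lemma integrable_of_memLp_of_isCompact {F : Type*} [NormedAddCommGroup F] {γ : ℝ≥0∞}
    (hγ : 1 ≤ γ) {K : Set R3} (hK : IsCompact K) {ρ : R3 → F} (h0 : ∀ x, x ∉ K → ρ x = 0)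
    (h : MemLp ρ γ) : Integrable ρ := by
  have h1 : IntegrableOn ρ K := (h.locallyIntegrable hγ).integrableOn_isCompact hK
  exact (integrableOn_iff_integrable_of_support_subset fun x hx => by
    by_contra hxK; exact hx (h0 x hxK)).1 h1

namespace FixedTimeData

variable {𝓑 : (Fin M → ℝ) → ℝ} {Cb : ℝ} {K N : Set R3} {ε₀ : ℝ} {ζ : R3 → ℝ} {Z : ℝ}
  {ρ : R3 → Fin M → ℝ} {γ : ℝ≥0∞}

lemma integrable (d : FixedTimeData 𝓑 Cb K N ε₀ ζ Z ρ γ) : Integrable ρ :=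
  integrable_of_memLp_of_isCompact d.one_le d.isCompact d.density_zero d.density_memLp

lemma density_eq_zero (d : FixedTimeData 𝓑 Cb K N ε₀ ζ Z ρ γ) {x : R3} (hx : x ∉ N) {y : R3}
    (hy : ‖x - y‖ ≤ ε₀) : ρ y = 0 := by
  refine d.density_zero y fun hyK => hx ?_
  simpa using d.add_mem y hyK (x - y) hy

lemma lintegral_mul_le (d : FixedTimeData 𝓑 Cb K N ε₀ ζ Z ρ γ) {p : ℝ≥0∞} [γ.HolderConjugate p]
    {G : Type*} [NormedAddCommGroup G] {w : R3 → G} (hw : StronglyMeasurable w) {h : R3}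
    (hh : ‖h‖ ≤ ε₀) :
    ∫⁻ y, ‖ρ y‖ₑ * ‖w (y + h)‖ₑ ≤ eLpNorm ρ γ * eLpNorm w p (volume.restrict N) := by
  rw [← eLpNorm_indicator_eq_eLpNorm_restrict d.measurableSet]
  refine le_trans (lintegral_mono fun y => ?_)
    (lintegral_enorm_mul_enorm_translate_le d.density_meas (hw.indicator d.measurableSet) h)
  by_cases hy : y ∈ K
  · rw [indicator_of_mem (d.add_mem y hy h hh)]
  · simp [d.density_zero y hy]

lemma lintegral_mul_self_le (d : FixedTimeData 𝓑 Cb K N ε₀ ζ Z ρ γ) (hε₀ : 0 < ε₀) {p : ℝ≥0∞}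
    [γ.HolderConjugate p] {G : Type*} [NormedAddCommGroup G] {w : R3 → G}
    (hw : StronglyMeasurable w) :
    ∫⁻ y, ‖ρ y‖ₑ * ‖w y‖ₑ ≤ eLpNorm ρ γ * eLpNorm w p (volume.restrict N) := by
  simpa using d.lintegral_mul_le (p := p) hw (h := 0) (by simpa using hε₀.le)

lemma moll_mem (d : FixedTimeData 𝓑 Cb K N ε₀ ζ Z ρ γ) {ε : ℝ} (hε : 0 < ε) (x : R3) :
    moll ε ρ x ∈ orthant M :=
  moll_mem_orthant hε d.density_mem x

lemma continuous_grad_moll (d : FixedTimeData 𝓑 Cb K N ε₀ ζ Z ρ γ) {ε : ℝ} (hε : 0 < ε) :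
    Continuous fun x => fderivWithin ℝ 𝓑 (orthant M) (moll ε ρ x) :=
  d.renorm.continuousOn_fderivWithin.comp_continuous
    (moll_contDiff hε d.integrable.locallyIntegrable).continuous (d.moll_mem hε)

lemma norm_renorm_le (d : FixedTimeData 𝓑 Cb K N ε₀ ζ Z ρ γ) {σ : Fin M → ℝ}
    (hσ : σ ∈ orthant M) : ‖𝓑 σ‖ ≤ Cb * ‖σ‖ := by
  simpa [d.renorm.map_zero] using d.lip σ hσ 0 zero_mem_orthant

/-- The chain rule for the renormalized mollification. -/
lemma hasFDerivAt_renorm_moll (d : FixedTimeData 𝓑 Cb K N ε₀ ζ Z ρ γ) {ε : ℝ} (hε : 0 < ε)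
    (x : R3) : HasFDerivAt (fun x => 𝓑 (moll ε ρ x))
      ((fderivWithin ℝ 𝓑 (orthant M) (moll ε ρ x)).comp (fderiv ℝ (moll ε ρ) x)) x := by
  have h1 := hasFDerivAt_moll hε d.integrable.locallyIntegrable x
  exact (d.renorm.hasFDerivWithinAt (d.moll_mem hε x)).comp_hasFDerivAt x h1
    (Eventually.of_forall fun y => d.moll_mem hε y)

lemma contDiff_renorm_moll (d : FixedTimeData 𝓑 Cb K N ε₀ ζ Z ρ γ) {ε : ℝ} (hε : 0 < ε) :
    ContDiff ℝ 1 fun x => 𝓑 (moll ε ρ x) := by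
  rw [contDiff_one_iff_hasFDerivAt]
  exact ⟨_, (d.continuous_grad_moll hε).clm_comp
    ((moll_contDiff hε d.integrable.locallyIntegrable).continuous_fderiv (by simp)),
    d.hasFDerivAt_renorm_moll hε⟩

/-- A factor that is bounded by `Z * Cb` on `N`. -/
lemma enorm_mul_grad_le (d : FixedTimeData 𝓑 Cb K N ε₀ ζ Z ρ γ) {σ w : Fin M → ℝ}
    (hσ : σ ∈ orthant M) {x : R3} (hw : x ∉ N → w = 0) :
    ‖ζ x * fderivWithin ℝ 𝓑 (orthant M) σ w‖ₑ ≤ ENNReal.ofReal (Z * Cb) * ‖w‖ₑ := by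
  by_cases hx : x ∈ N
  · rw [← ofReal_norm, ← ofReal_norm, ← ENNReal.ofReal_mul (mul_nonneg d.Z_nonneg d.Cb_nonneg),
      norm_mul]
    apply ENNReal.ofReal_le_ofReal
    calc _ ≤ Z * (Cb * ‖w‖) := by
          refine mul_le_mul (d.test_le x hx) ?_ (norm_nonneg _) d.Z_nonneg
          exact (ContinuousLinearMap.le_opNorm _ _).trans (by gcongr; exact d.grad_le σ hσ)
      _ = _ := by ring
  · simp [hw hx]

lemma flux_eq_zero (d : FixedTimeData 𝓑 Cb K N ε₀ ζ Z ρ γ) {ε : ℝ} (hε : 0 < ε) (hε' : ε ≤ ε₀)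
    {v : R3 → R3} {x : R3} (hx : x ∉ N) : flux ε v ρ x = 0 :=
  _root_.flux_eq_zero hε fun _ hy => d.density_eq_zero hx (hy.trans hε')

lemma moll_eq_zero (d : FixedTimeData 𝓑 Cb K N ε₀ ζ Z ρ γ) {ε : ℝ} (hε : 0 < ε) (hε' : ε ≤ ε₀)
    {x : R3} (hx : x ∉ N) : moll ε ρ x = 0 :=
  _root_.moll_eq_zero hε fun _ hy => d.density_eq_zero hx (hy.le.trans hε')

lemma integrable_fluxPairing (d : FixedTimeData 𝓑 Cb K N ε₀ ζ Z ρ γ) {ε : ℝ} (hε : 0 < ε)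
    (hε' : ε ≤ ε₀) {v : R3 → R3} (hv : StronglyMeasurable v)
    (hvρ : ∫⁻ y, ‖ρ y‖ₑ * ‖v y‖ₑ < ⊤) :
    Integrable fun x => ζ x * fderivWithin ℝ 𝓑 (orthant M) (moll ε ρ x) (flux ε v ρ x) := by
  have hfm := stronglyMeasurable_flux ε hv d.density_meas
  refine ⟨?_, ?_⟩
  · have h1 := isBoundedBilinearMap_apply.continuous.comp_stronglyMeasurable
      ((d.continuous_grad_moll hε).stronglyMeasurable.prodMk hfm)
    exact (d.test.continuous.stronglyMeasurable.mul h1).aestronglyMeasurable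
  · refine lt_of_le_of_lt (lintegral_mono fun x => d.enorm_mul_grad_le (d.moll_mem hε x)
      fun hx => d.flux_eq_zero hε hε' hx) ?_
    rw [lintegral_const_mul _ hfm.enorm]
    refine ENNReal.mul_lt_top (by simp) ((lintegral_flux_le ε hv d.density_meas).trans_lt ?_)
    exact ENNReal.mul_lt_top (lintegral_enorm_fderiv_mollKernel_lt_top hε) hvρ

lemma enorm_fluxPairing_le (d : FixedTimeData 𝓑 Cb K N ε₀ ζ Z ρ γ) {ε : ℝ} (hε : 0 < ε)
    (hε' : ε ≤ ε₀) {v : R3 → R3} (hv : StronglyMeasurable v) :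
    ‖fluxPairing 𝓑 ζ ρ ε v‖ₑ ≤ ENNReal.ofReal (Z * Cb) *
      ((∫⁻ h, ‖fderiv ℝ (mollKernel ε) h‖ₑ) * ∫⁻ y, ‖ρ y‖ₑ * ‖v y‖ₑ) := by
  refine (enorm_integral_le_lintegral_enorm _).trans ((lintegral_mono fun x =>
    d.enorm_mul_grad_le (d.moll_mem hε x) fun hx => d.flux_eq_zero hε hε' hx).trans ?_)
  rw [lintegral_const_mul _ (stronglyMeasurable_flux ε hv d.density_meas).enorm]
  gcongr
  exact lintegral_flux_le ε hv d.density_meas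

lemma fluxPairing_sub (d : FixedTimeData 𝓑 Cb K N ε₀ ζ Z ρ γ) {ε : ℝ} (hε : 0 < ε)
    (hε' : ε ≤ ε₀) {v w : R3 → R3} (hv : StronglyMeasurable v) (hw : StronglyMeasurable w)
    (hvρ : ∫⁻ y, ‖ρ y‖ₑ * ‖v y‖ₑ < ⊤) (hwρ : ∫⁻ y, ‖ρ y‖ₑ * ‖w y‖ₑ < ⊤) :
    fluxPairing 𝓑 ζ ρ ε (fun y => v y - w y) =
      fluxPairing 𝓑 ζ ρ ε v - fluxPairing 𝓑 ζ ρ ε w := by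
  unfold fluxPairing
  rw [← integral_sub (d.integrable_fluxPairing hε hε' hv hvρ)
    (d.integrable_fluxPairing hε hε' hw hwρ)]
  refine integral_congr_ae (Eventually.of_forall fun x => ?_)
  simp only [flux_sub hε hv hw d.density_meas hvρ hwρ, map_sub, mul_sub]

lemma lintegral_mul_lt_top (d : FixedTimeData 𝓑 Cb K N ε₀ ζ Z ρ γ) {G : Type*}
    [NormedAddCommGroup G] {v : R3 → G}
    (hv : Continuous v) (hvc : HasCompactSupport v) : ∫⁻ y, ‖ρ y‖ₑ * ‖v y‖ₑ < ⊤ := by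
  obtain ⟨C, hC⟩ := hv.bounded_above_of_compact_support hvc
  refine lt_of_le_of_lt (lintegral_mono (g := fun y => ‖ρ y‖ₑ * ENNReal.ofReal C) fun y => ?_) ?_
  · refine mul_le_mul_right ?_ _
    rw [← ofReal_norm]
    exact ENNReal.ofReal_le_ofReal (hC y)
  · rw [lintegral_mul_const _ d.density_meas.enorm]
    exact ENNReal.mul_lt_top d.integrable.2 (by simp)

lemma integrable_grad_mollCommutator (d : FixedTimeData 𝓑 Cb K N ε₀ ζ Z ρ γ) {ε : ℝ}
    (hε : 0 < ε) (hε' : ε ≤ ε₀) {v : R3 → R3} (hv : ContDiff ℝ 1 v) (hvc : HasCompactSupport v) :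
    Integrable fun x =>
      ζ x * fderivWithin ℝ 𝓑 (orthant M) (moll ε ρ x) (mollCommutator ε v ρ x) := by
  -- the commutator term is the difference of two terms that are known to be integrable
  have h1 := d.integrable_fluxPairing hε hε' hv.continuous.stronglyMeasurable
    (d.lintegral_mul_lt_top hv.continuous hvc)
  have h2 : Integrable fun x => ζ x * fderivWithin ℝ 𝓑 (orthant M) (moll ε ρ x)
      (fderiv ℝ (moll ε ρ) x (v x)) := by
    have hmc := moll_contDiff hε d.integrable.locallyIntegrable
    refine Continuous.integrable_of_hasCompactSupport (d.test.continuous.mul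
      ((d.continuous_grad_moll hε).clm_apply
        ((hmc.continuous_fderiv (by simp)).clm_apply hv.continuous))) ?_
    refine hvc.mono fun x hx => ?_
    rw [Function.mem_support] at hx ⊢
    exact fun h => hx (by simp [h])
  refine (h1.sub h2).congr (Eventually.of_forall fun x => ?_)
  simp only [Pi.sub_apply]
  rw [flux_eq_fderiv_add_mollCommutator hε hv.continuous.stronglyMeasurable d.density_meas
    d.integrable (d.lintegral_mul_lt_top hv.continuous hvc), map_add]
  ring

/-- For a smooth velocity, an integration by parts removes all derivatives from the mollified
density, up to the commutator. -/
lemma fluxPairing_eq (d : FixedTimeData 𝓑 Cb K N ε₀ ζ Z ρ γ) {ε : ℝ} (hε : 0 < ε)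
    (hε' : ε ≤ ε₀) {v : R3 → R3} (hv : ContDiff ℝ 1 v) (hvc : HasCompactSupport v) :
    fluxPairing 𝓑 ζ ρ ε v =
      -(∫ x, 𝓑 (moll ε ρ x) * (fderiv ℝ ζ x (v x) + ζ x * divOf (fderiv ℝ v x))) +
      ∫ x, ζ x * fderivWithin ℝ 𝓑 (orthant M) (moll ε ρ x) (mollCommutator ε v ρ x) := by
  have hf := d.contDiff_renorm_moll hε
  have hfc : HasCompactSupport fun x => 𝓑 (moll ε ρ x) :=
    (hasCompactSupport_moll hε d.isCompact d.density_zero).comp_left d.renorm.map_zero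
  have hw : ContDiff ℝ 1 fun x => ζ x • v x := d.test.smul hv
  have hdiv : ∀ x, divOf (fderiv ℝ (fun x => ζ x • v x) x) =
      fderiv ℝ ζ x (v x) + ζ x * divOf (fderiv ℝ v x) := by
    intro x
    have h1 : HasFDerivAt (fun x => ζ x • v x) _ x :=
      ((d.test.differentiable (by simp)) x).hasFDerivAt.smul
        ((hv.differentiable (by simp)) x).hasFDerivAt
    rw [h1.fderiv, fderiv_apply_eq_sum (fderiv ℝ ζ x) (v x)]
    simp only [divOf, add_apply, smul_apply,
      ContinuousLinearMap.smulRight_apply, PiLp.add_apply, PiLp.smul_apply, smul_eq_mul,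
      Finset.sum_add_distrib, Finset.mul_sum]
    ring
  have hparts := integral_mul_divOf_fderiv hf hfc hw
  simp only [hdiv] at hparts
  rw [hparts, neg_neg, ← integral_add']
  · refine integral_congr_ae (Eventually.of_forall fun x => ?_)
    simp only [Pi.add_apply]
    rw [(d.hasFDerivAt_renorm_moll hε x).fderiv,
      flux_eq_fderiv_add_mollCommutator hε hv.continuous.stronglyMeasurable d.density_meas
      d.integrable (d.lintegral_mul_lt_top hv.continuous hvc)]
    simp only [map_add, map_smul, ContinuousLinearMap.comp_apply, smul_eq_mul]
    ring
  · refine Continuous.integrable_of_hasCompactSupport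
      ((hf.continuous_fderiv (by simp)).clm_apply hw.continuous) ?_
    refine (hfc.fderiv ℝ).mono fun x hx => ?_
    rw [Function.mem_support] at hx ⊢
    exact fun h => hx (by simp [h])
  · exact d.integrable_grad_mollCommutator hε hε' hv hvc

/-- The bound of the flux pairing by the Sobolev norm of a smooth velocity, uniformly in the
scale of the mollification. -/
lemma enorm_fluxPairing_le_of_contDiff (d : FixedTimeData 𝓑 Cb K N ε₀ ζ Z ρ γ) {p Λ : ℝ≥0∞}
    [γ.HolderConjugate p] {ε : ℝ} (hε : 0 < ε) (hε' : ε ≤ ε₀)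
    (hΛ : ∫⁻ x, ‖fderiv ℝ (mollKernel ε) x‖ₑ * ‖x‖ₑ ≤ Λ) {v : R3 → R3} (hv : ContDiff ℝ 1 v)
    (hvc : HasCompactSupport v) :
    ‖fluxPairing 𝓑 ζ ρ ε v‖ₑ ≤ ENNReal.ofReal (Z * Cb) * (3 + Λ) * eLpNorm ρ γ *
      (eLpNorm v p (volume.restrict N) + eLpNorm (fderiv ℝ v) p (volume.restrict N)) := by
  have hvm := hv.continuous.stronglyMeasurable
  have hdv := hv.continuous_fderiv (n := 1) (by simp)
  have hZC := mul_nonneg d.Z_nonneg d.Cb_nonneg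
  rw [d.fluxPairing_eq hε hε' hv hvc]
  -- the part that is integrated by parts
  have hA : ‖∫ x, 𝓑 (moll ε ρ x) * (fderiv ℝ ζ x (v x) + ζ x * divOf (fderiv ℝ v x))‖ₑ ≤
      ENNReal.ofReal (Z * Cb) * (eLpNorm ρ γ * eLpNorm v p (volume.restrict N) +
        3 * (eLpNorm ρ γ * eLpNorm (fderiv ℝ v) p (volume.restrict N))) := by
    refine (enorm_integral_le_lintegral_enorm _).trans ?_
    calc _ ≤ ∫⁻ x, ENNReal.ofReal (Z * Cb) *
          (‖moll ε ρ x‖ₑ * ‖v x‖ₑ + 3 * (‖moll ε ρ x‖ₑ * ‖fderiv ℝ v x‖ₑ)) := by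
          refine lintegral_mono fun x => ?_
          by_cases hx : x ∈ N
          · have h3 : (3 : ℝ≥0∞) = ENNReal.ofReal 3 := by simp
            rw [← ofReal_norm, ← ofReal_norm, ← ofReal_norm, ← ofReal_norm, h3,
              ← ENNReal.ofReal_mul (by positivity), ← ENNReal.ofReal_mul (by positivity),
              ← ENNReal.ofReal_mul (by positivity), ← ENNReal.ofReal_add (by positivity)
              (by positivity), ← ENNReal.ofReal_mul hZC]
            apply ENNReal.ofReal_le_ofReal
            rw [norm_mul]
            calc _ ≤ (Cb * ‖moll ε ρ x‖) * (Z * ‖v x‖ + Z * (3 * ‖fderiv ℝ v x‖)) := by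
                  refine mul_le_mul (d.norm_renorm_le (d.moll_mem hε x)) ?_ (norm_nonneg _)
                    (mul_nonneg d.Cb_nonneg (norm_nonneg _))
                  refine (norm_add_le _ _).trans (add_le_add ?_ ?_)
                  · refine (ContinuousLinearMap.le_opNorm _ _).trans ?_
                    exact mul_le_mul_of_nonneg_right (d.grad_test_le x hx) (norm_nonneg _)
                  · rw [norm_mul]
                    exact mul_le_mul (d.test_le x hx) (norm_divOf_le _) (norm_nonneg _) d.Z_nonneg
              _ = _ := by ring
          · simp [d.moll_eq_zero hε hε' hx, d.renorm.map_zero]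
      _ = ENNReal.ofReal (Z * Cb) * ((∫⁻ x, ‖moll ε ρ x‖ₑ * ‖v x‖ₑ) +
            3 * ∫⁻ x, ‖moll ε ρ x‖ₑ * ‖fderiv ℝ v x‖ₑ) := by
          have hmm : Measurable fun x => ‖moll ε ρ x‖ₑ :=
            (moll_contDiff hε d.integrable.locallyIntegrable).continuous.enorm.measurable
          have m1 : Measurable fun x => ‖moll ε ρ x‖ₑ * ‖v x‖ₑ := hmm.mul hvm.enorm
          have m2 : Measurable fun x => ‖moll ε ρ x‖ₑ * ‖fderiv ℝ v x‖ₑ :=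
            hmm.mul hdv.enorm.measurable
          have m3 : Measurable fun x =>
              ‖moll ε ρ x‖ₑ * ‖v x‖ₑ + 3 * (‖moll ε ρ x‖ₑ * ‖fderiv ℝ v x‖ₑ) :=
            m1.add (m2.const_mul 3)
          rw [lintegral_const_mul _ m3, lintegral_add_left m1, lintegral_const_mul _ m2]
      _ ≤ _ := by
          gcongr
          · exact lintegral_enorm_moll_mul_le hε d.density_meas hvm.enorm fun h hh =>
              d.lintegral_mul_le hvm (hh.trans hε')
          · exact lintegral_enorm_moll_mul_le hε d.density_meas hdv.enorm.measurable fun h hh =>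
              d.lintegral_mul_le hdv.stronglyMeasurable (hh.trans hε')
  -- the commutator
  have hB : ‖∫ x, ζ x * fderivWithin ℝ 𝓑 (orthant M) (moll ε ρ x) (mollCommutator ε v ρ x)‖ₑ ≤
      ENNReal.ofReal (Z * Cb) *
        (Λ * (eLpNorm ρ γ * eLpNorm (fderiv ℝ v) p (volume.restrict N))) := by
    refine (enorm_integral_le_lintegral_enorm _).trans ((lintegral_mono fun x =>
      d.enorm_mul_grad_le (d.moll_mem hε x) fun hx => mollCommutator_eq_zero hε fun y hy =>
        d.density_eq_zero hx (hy.trans hε')).trans ?_)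
    rw [lintegral_const_mul' _ _ (by simp)]
    gcongr
    refine lintegral_mollCommutator_le hε hΛ hv d.density_meas d.measurableSet fun y h hy hh =>
      d.add_mem y ?_ h (hh.trans hε')
    by_contra hyK
    exact hy (d.density_zero y hyK)
  refine (enorm_add_le _ _).trans ?_
  rw [enorm_neg]
  refine (add_le_add hA hB).trans ?_
  have : (1 : ℝ≥0∞) ≤ 3 + Λ := le_add_right (by norm_num)
  calc _ = ENNReal.ofReal (Z * Cb) * eLpNorm ρ γ * (1 * eLpNorm v p (volume.restrict N) +
        (3 + Λ) * eLpNorm (fderiv ℝ v) p (volume.restrict N)) := by ring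
    _ ≤ ENNReal.ofReal (Z * Cb) * eLpNorm ρ γ * ((3 + Λ) * eLpNorm v p (volume.restrict N) +
        (3 + Λ) * eLpNorm (fderiv ℝ v) p (volume.restrict N)) := by gcongr
    _ = _ := by ring

end FixedTimeData

end

section

variable {M : ℕ}

namespace FixedTimeData

variable {𝓑 : (Fin M → ℝ) → ℝ} {Cb : ℝ} {K N : Set R3} {ε₀ : ℝ} {ζ : R3 → ℝ} {Z : ℝ}
  {ρ : R3 → Fin M → ℝ} {γ : ℝ≥0∞}

lemma tendsto_moll (d : FixedTimeData 𝓑 Cb K N ε₀ ζ Z ρ γ) :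
    Tendsto (fun ε : ℝ => eLpNorm (fun x => moll ε ρ x - ρ x) 1 volume) (𝓝[>] 0) (𝓝 0) :=
  tendsto_eLpNorm_moll_sub le_rfl (by simp) d.density_meas (memLp_one_iff_integrable.2 d.integrable)

/-- Since `𝓑` is Lipschitz, the renormalized mollifications converge, even after multiplication
with a bounded function. -/
lemma tendsto_integral_renorm_moll_mul (d : FixedTimeData 𝓑 Cb K N ε₀ ζ Z ρ γ) {h : R3 → ℝ}
    (hm : StronglyMeasurable h) {H : ℝ} (hε₀ : 0 < ε₀) (hH : ∀ x ∈ N, ‖h x‖ ≤ H) :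
    Tendsto (fun ε : ℝ => ∫ x, 𝓑 (moll ε ρ x) * h x) (𝓝[>] 0) (𝓝 (∫ x, 𝓑 (ρ x) * h x)) := by
  have hint : ∀ σ : R3 → Fin M → ℝ, Integrable σ → (∀ x, σ x ∈ orthant M) →
      StronglyMeasurable (fun x => 𝓑 (σ x)) → (∀ x, x ∉ N → σ x = 0) →
      Integrable fun x => 𝓑 (σ x) * h x := by
    intro σ hσ hσ0 hσm hσN
    refine (hσ.norm.const_mul (Cb * H)).mono' (hσm.mul hm).aestronglyMeasurable
      (Eventually.of_forall fun x => ?_)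
    by_cases hx : x ∈ N
    · rw [norm_mul]
      calc _ ≤ (Cb * ‖σ x‖) * H :=
            mul_le_mul (d.norm_renorm_le (hσ0 x)) (hH x hx) (norm_nonneg _)
              (mul_nonneg d.Cb_nonneg (norm_nonneg _))
        _ = _ := by ring
    · simp [hσN x hx, d.renorm.map_zero]
  have hρN : ∀ x, x ∉ N → ρ x = 0 := fun x hx =>
    d.density_eq_zero hx (by simpa using hε₀.le)
  have hi := hint ρ d.integrable d.density_mem
    (d.renorm.stronglyMeasurable_comp d.density_meas d.density_mem) hρN
  rw [tendsto_iff_edist_tendsto_0]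
  have hlim := ENNReal.Tendsto.const_mul (a := ENNReal.ofReal (Cb * H)) d.tendsto_moll
    (Or.inr (by simp))
  rw [mul_zero] at hlim
  refine tendsto_of_tendsto_of_tendsto_of_le_of_le' tendsto_const_nhds hlim
    (Eventually.of_forall fun _ => zero_le) ?_
  filter_upwards [Ioo_mem_nhdsGT hε₀] with ε hε
  have hmc := moll_contDiff hε.1 d.integrable.locallyIntegrable
  have hmi : Integrable (moll ε ρ) := hmc.continuous.integrable_of_hasCompactSupport
    (hasCompactSupport_moll hε.1 d.isCompact d.density_zero)
  have hi2 := hint (moll ε ρ) hmi (d.moll_mem hε.1)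
    (d.contDiff_renorm_moll hε.1).continuous.stronglyMeasurable
    (fun x hx => d.moll_eq_zero hε.1 hε.2.le hx)
  rw [edist_eq_enorm_sub, ← integral_sub hi2 hi, eLpNorm_one_eq_lintegral_enorm,
    ← lintegral_const_mul' _ _ (by simp)]
  refine (enorm_integral_le_lintegral_enorm _).trans (lintegral_mono fun x => ?_)
  rw [← sub_mul]
  by_cases hx : x ∈ N
  · have hH0 : 0 ≤ H := (norm_nonneg _).trans (hH x hx)
    rw [← ofReal_norm, ← ofReal_norm, ← ENNReal.ofReal_mul (mul_nonneg d.Cb_nonneg hH0), norm_mul]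
    apply ENNReal.ofReal_le_ofReal
    calc _ ≤ (Cb * ‖moll ε ρ x - ρ x‖) * H :=
          mul_le_mul (d.lip _ (d.moll_mem hε.1 x) _ (d.density_mem x)) (hH x hx) (norm_nonneg _)
            (mul_nonneg d.Cb_nonneg (norm_nonneg _))
      _ = _ := by ring
  · simp [hρN x hx, d.moll_eq_zero hε.1 hε.2.le hx]

/-- The commutator term converges: the commutator does so in `L¹`, and its coefficient
`ζ ∇𝓑(ρ_ε)` is bounded and converges almost everywhere along subsequences. -/
lemma tendsto_integral_grad_mollCommutator (d : FixedTimeData 𝓑 Cb K N ε₀ ζ Z ρ γ) (hε₀ : 0 < ε₀)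
    {v : R3 → R3} (hv : ContDiff ℝ 1 v) (hvc : HasCompactSupport v) :
    Tendsto (fun ε : ℝ => ∫ x, ζ x * fderivWithin ℝ 𝓑 (orthant M) (moll ε ρ x)
      (mollCommutator ε v ρ x)) (𝓝[>] 0)
      (𝓝 (∫ x, ζ x * fderivWithin ℝ 𝓑 (orthant M) (ρ x) (divOf (fderiv ℝ v x) • ρ x))) := by
  have hρN : ∀ x, x ∉ N → ρ x = 0 := fun x hx =>
    d.density_eq_zero hx (by simpa using hε₀.le)
  have hdc : Continuous fun x => divOf (fderiv ℝ v x) :=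
    continuous_divOf.comp (hv.continuous_fderiv (by simp))
  obtain ⟨D, hD⟩ := hdc.bounded_above_of_compact_support
    ((hvc.fderiv ℝ).comp_left (g := divOf) (by simp [divOf]))
  set τ : R3 → Fin M → ℝ := fun x => divOf (fderiv ℝ v x) • ρ x with hτ
  have hτm : StronglyMeasurable τ := hdc.stronglyMeasurable.smul d.density_meas
  have hτi : Integrable τ := d.integrable.bdd_smul D hdc.aestronglyMeasurable
    (Eventually.of_forall hD)
  have hτN : ∀ x, x ∉ N → τ x = 0 := fun x hx => by simp [hτ, hρN x hx]
  have hZC := mul_nonneg d.Z_nonneg d.Cb_nonneg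
  have hbound : ∀ σ ∈ orthant M, ∀ x, ‖ζ x * fderivWithin ℝ 𝓑 (orthant M) σ (τ x)‖ ≤
      Z * Cb * ‖τ x‖ := by
    intro σ hσ x
    have := d.enorm_mul_grad_le (x := x) hσ (hτN x)
    rwa [← ofReal_norm, ← ofReal_norm, ← ENNReal.ofReal_mul hZC,
      ENNReal.ofReal_le_ofReal_iff (mul_nonneg hZC (norm_nonneg _))] at this
  have hm1 : ∀ ε : ℝ, 0 < ε → AEStronglyMeasurable (fun x => ζ x *
      fderivWithin ℝ 𝓑 (orthant M) (moll ε ρ x) (τ x)) volume := fun ε hε =>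
    (d.test.continuous.stronglyMeasurable.mul
      (isBoundedBilinearMap_apply.continuous.comp_stronglyMeasurable
      ((d.continuous_grad_moll hε).stronglyMeasurable.prodMk hτm))).aestronglyMeasurable
  -- the gradient converges almost everywhere along subsequences
  have hsecond : Tendsto (fun ε : ℝ => ∫ x, ζ x * fderivWithin ℝ 𝓑 (orthant M) (moll ε ρ x)
      (τ x)) (𝓝[>] 0) (𝓝 (∫ x, ζ x * fderivWithin ℝ 𝓑 (orthant M) (ρ x) (τ x))) := by
    refine tendsto_of_subseq_tendsto fun ns hns => ?_
    have hpos : ∀ᶠ n in atTop, 0 < ns n := hns.eventually self_mem_nhdsWithin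
    have hmeas := tendstoInMeasure_of_tendsto_eLpNorm one_ne_zero
      (fun n => (stronglyMeasurable_moll (ns n) d.density_meas).aestronglyMeasurable)
      d.density_meas.aestronglyMeasurable (d.tendsto_moll.comp hns)
    obtain ⟨ms, hms, hae⟩ := hmeas.exists_seq_tendsto_ae
    refine ⟨ms, ?_⟩
    have hpos' := hms.tendsto_atTop.eventually hpos
    refine tendsto_integral_filter_of_dominated_convergence (fun x => Z * Cb * ‖τ x‖) ?_ ?_
      (hτi.norm.const_mul _) ?_
    · filter_upwards [hpos'] with n hn
      exact hm1 _ hn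
    · filter_upwards [hpos'] with n hn
      exact Eventually.of_forall fun x => hbound _ (d.moll_mem hn x) x
    · filter_upwards [hae] with x hx
      have h1 : Tendsto (fun n => moll (ns (ms n)) ρ x) atTop (𝓝[orthant M] (ρ x)) :=
        tendsto_nhdsWithin_iff.2 ⟨hx, hpos'.mono fun n hn => d.moll_mem hn x⟩
      have h2 := ((d.renorm.continuousOn_fderivWithin (ρ x) (d.density_mem x)).tendsto.comp h1)
      exact (((ContinuousLinearMap.apply ℝ ℝ (τ x)).continuous.tendsto _).comp h2).const_mul _
  have hfirst : Tendsto (fun ε : ℝ => ∫ x, ζ x * fderivWithin ℝ 𝓑 (orthant M) (moll ε ρ x)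
      (mollCommutator ε v ρ x - τ x)) (𝓝[>] 0) (𝓝 0) := by
    rw [tendsto_iff_edist_tendsto_0]
    have hlim := ENNReal.Tendsto.const_mul (a := ENNReal.ofReal (Z * Cb))
      (tendsto_lintegral_mollCommutator_sub hv hvc d.density_meas d.integrable) (Or.inr (by simp))
    rw [mul_zero] at hlim
    refine tendsto_of_tendsto_of_tendsto_of_le_of_le' tendsto_const_nhds hlim
      (Eventually.of_forall fun _ => zero_le) ?_
    filter_upwards [Ioo_mem_nhdsGT hε₀] with ε hε
    rw [edist_zero_right, ← lintegral_const_mul' _ _ (by simp)]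
    refine (enorm_integral_le_lintegral_enorm _).trans (lintegral_mono fun x => ?_)
    refine d.enorm_mul_grad_le (d.moll_mem hε.1 x) fun hx => ?_
    rw [mollCommutator_eq_zero hε.1 fun y hy => d.density_eq_zero hx (hy.trans hε.2.le), hτN x hx,
      sub_zero]
  have hsum := hfirst.add hsecond
  rw [zero_add] at hsum
  refine hsum.congr' ?_
  filter_upwards [Ioo_mem_nhdsGT hε₀] with ε hε
  have h1 := d.integrable_grad_mollCommutator hε.1 hε.2.le hv hvc
  have h2 : Integrable fun x => ζ x * fderivWithin ℝ 𝓑 (orthant M) (moll ε ρ x) (τ x) :=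
    (hτi.norm.const_mul _).mono' (hm1 ε hε.1)
      (Eventually.of_forall fun x => hbound _ (d.moll_mem hε.1 x) x)
  simp_rw [map_sub, mul_sub]
  rw [integral_sub h1 h2, sub_add_cancel]

/-- Integrability of both parts of the renormalized equation, with bounds for their integrals in
terms of `|ρ| |v|` and `|ρ| |g|`. -/
lemma integrable_renormPairing (d : FixedTimeData 𝓑 Cb K N ε₀ ζ Z ρ γ) (hε₀ : 0 < ε₀)
    {v : R3 → R3} {g : R3 → R3 →L[ℝ] R3} (hv : StronglyMeasurable v) (hg : StronglyMeasurable g)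
    (hvρ : ∫⁻ y, ‖ρ y‖ₑ * ‖v y‖ₑ < ⊤) (hgρ : ∫⁻ y, ‖ρ y‖ₑ * ‖g y‖ₑ < ⊤) :
    Integrable (fun x => 𝓑 (ρ x) * fderiv ℝ ζ x (v x)) ∧
    Integrable (fun x => (fderivWithin ℝ 𝓑 (orthant M) (ρ x) (ρ x) - 𝓑 (ρ x)) *
      divOf (g x) * ζ x) ∧
    ‖∫ x, 𝓑 (ρ x) * fderiv ℝ ζ x (v x)‖ₑ ≤
      ENNReal.ofReal (Z * Cb) * ∫⁻ y, ‖ρ y‖ₑ * ‖v y‖ₑ ∧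
    ‖∫ x, (fderivWithin ℝ 𝓑 (orthant M) (ρ x) (ρ x) - 𝓑 (ρ x)) * divOf (g x) * ζ x‖ₑ ≤
      ENNReal.ofReal (Z * Cb) * (6 * ∫⁻ y, ‖ρ y‖ₑ * ‖g y‖ₑ) := by
  have hρN : ∀ x, x ∉ N → ρ x = 0 := fun x hx =>
    d.density_eq_zero hx (by simpa using hε₀.le)
  have hZC := mul_nonneg d.Z_nonneg d.Cb_nonneg
  have hZ0 := d.Z_nonneg
  have hC0 := d.Cb_nonneg
  have b1 : ∀ x, ‖𝓑 (ρ x) * fderiv ℝ ζ x (v x)‖ₑ ≤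
      ENNReal.ofReal (Z * Cb) * (‖ρ x‖ₑ * ‖v x‖ₑ) := by
    intro x
    by_cases hx : x ∈ N
    · rw [← ofReal_norm, ← ofReal_norm, ← ofReal_norm, ← ENNReal.ofReal_mul (norm_nonneg _),
        ← ENNReal.ofReal_mul hZC, norm_mul]
      apply ENNReal.ofReal_le_ofReal
      calc _ ≤ (Cb * ‖ρ x‖) * (Z * ‖v x‖) := by
            refine mul_le_mul (d.norm_renorm_le (d.density_mem x)) ?_ (norm_nonneg _)
              (by positivity)
            exact (ContinuousLinearMap.le_opNorm _ _).trans
              (mul_le_mul_of_nonneg_right (d.grad_test_le x hx) (norm_nonneg _))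
        _ = _ := by ring
    · simp [hρN x hx, d.renorm.map_zero]
  have b2 : ∀ x, ‖(fderivWithin ℝ 𝓑 (orthant M) (ρ x) (ρ x) - 𝓑 (ρ x)) * divOf (g x) * ζ x‖ₑ ≤
      ENNReal.ofReal (Z * Cb) * (6 * (‖ρ x‖ₑ * ‖g x‖ₑ)) := by
    intro x
    by_cases hx : x ∈ N
    · have h6 : (6 : ℝ≥0∞) = ENNReal.ofReal 6 := by simp
      rw [← ofReal_norm, ← ofReal_norm, ← ofReal_norm, h6, ← ENNReal.ofReal_mul (norm_nonneg _),
        ← ENNReal.ofReal_mul (by norm_num), ← ENNReal.ofReal_mul hZC, norm_mul, norm_mul]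
      apply ENNReal.ofReal_le_ofReal
      calc _ ≤ (Cb * ‖ρ x‖ + Cb * ‖ρ x‖) * (3 * ‖g x‖) * Z := by
            refine mul_le_mul (mul_le_mul ((norm_sub_le _ _).trans (add_le_add ?_
              (d.norm_renorm_le (d.density_mem x)))) (norm_divOf_le _) (norm_nonneg _)
              (by positivity)) (d.test_le x hx) (norm_nonneg _) (by positivity)
            exact (ContinuousLinearMap.le_opNorm _ _).trans
              (mul_le_mul_of_nonneg_right (d.grad_le _ (d.density_mem x)) (norm_nonneg _))
        _ = _ := by ring
    · simp [hρN x hx, d.renorm.map_zero]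
  have m1 : StronglyMeasurable fun x => 𝓑 (ρ x) * fderiv ℝ ζ x (v x) :=
    (d.renorm.stronglyMeasurable_comp d.density_meas d.density_mem).mul
      (isBoundedBilinearMap_apply.continuous.comp_stronglyMeasurable
        ((d.test.continuous_fderiv (by simp)).stronglyMeasurable.prodMk hv))
  have m2 : StronglyMeasurable fun x => (fderivWithin ℝ 𝓑 (orthant M) (ρ x) (ρ x) - 𝓑 (ρ x)) *
      divOf (g x) * ζ x :=
    (((isBoundedBilinearMap_apply.continuous.comp_stronglyMeasurable
      ((d.renorm.stronglyMeasurable_fderivWithin_comp d.density_meas d.density_mem).prodMk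
        d.density_meas)).sub (d.renorm.stronglyMeasurable_comp d.density_meas d.density_mem)).mul
      (continuous_divOf.comp_stronglyMeasurable hg)).mul d.test.continuous.stronglyMeasurable
  have n1 : Measurable fun y => ‖ρ y‖ₑ * ‖v y‖ₑ := d.density_meas.enorm.mul hv.enorm
  have n2 : Measurable fun y => ‖ρ y‖ₑ * ‖g y‖ₑ := d.density_meas.enorm.mul hg.enorm
  have l1 : ∫⁻ x, ‖𝓑 (ρ x) * fderiv ℝ ζ x (v x)‖ₑ ≤
      ENNReal.ofReal (Z * Cb) * ∫⁻ y, ‖ρ y‖ₑ * ‖v y‖ₑ :=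
    (lintegral_mono b1).trans (by rw [lintegral_const_mul _ n1])
  have l2 : ∫⁻ x, ‖(fderivWithin ℝ 𝓑 (orthant M) (ρ x) (ρ x) - 𝓑 (ρ x)) * divOf (g x) * ζ x‖ₑ ≤
      ENNReal.ofReal (Z * Cb) * (6 * ∫⁻ y, ‖ρ y‖ₑ * ‖g y‖ₑ) :=
    (lintegral_mono b2).trans
      (by rw [lintegral_const_mul _ (n2.const_mul 6), lintegral_const_mul _ n2])
  refine ⟨⟨m1.aestronglyMeasurable, l1.trans_lt (ENNReal.mul_lt_top (by simp) hvρ)⟩,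
    ⟨m2.aestronglyMeasurable, l2.trans_lt (ENNReal.mul_lt_top (by simp)
      (ENNReal.mul_lt_top (by simp) hgρ))⟩,
    (enorm_integral_le_lintegral_enorm _).trans l1, (enorm_integral_le_lintegral_enorm _).trans l2⟩

/-- Convergence of the flux pairing for a smooth velocity. -/
lemma tendsto_fluxPairing_of_contDiff (d : FixedTimeData 𝓑 Cb K N ε₀ ζ Z ρ γ) (hε₀ : 0 < ε₀)
    {v : R3 → R3} (hv : ContDiff ℝ 1 v) (hvc : HasCompactSupport v) :
    Tendsto (fun ε : ℝ => fluxPairing 𝓑 ζ ρ ε v) (𝓝[>] 0)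
      (𝓝 (-renormPairing 𝓑 ζ ρ v (fderiv ℝ v))) := by
  have hdv := hv.continuous_fderiv (n := 1) (by simp)
  have hζ' := d.test.continuous_fderiv (n := 1) (by simp)
  have hdc : Continuous fun x => divOf (fderiv ℝ v x) := continuous_divOf.comp hdv
  have hhc : Continuous fun x => fderiv ℝ ζ x (v x) + ζ x * divOf (fderiv ℝ v x) :=
    (hζ'.clm_apply hv.continuous).add (d.test.continuous.mul hdc)
  obtain ⟨H, hH⟩ := hhc.bounded_above_of_compact_support (by
    refine HasCompactSupport.add (hvc.mono fun x hx => ?_) ?_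
    · rw [Function.mem_support] at hx ⊢
      exact fun h => hx (by simp [h])
    · exact ((hvc.fderiv ℝ).comp_left (g := divOf) (by simp [divOf])).mul_left)
  have h1 := (d.tendsto_integral_renorm_moll_mul hhc.stronglyMeasurable hε₀
    fun x _ => hH x).neg.add (d.tendsto_integral_grad_mollCommutator hε₀ hv hvc)
  have hvρ := d.lintegral_mul_lt_top hv.continuous hvc
  have hgρ := d.lintegral_mul_lt_top hdv (hvc.fderiv ℝ)
  obtain ⟨i1, i2, -, -⟩ := d.integrable_renormPairing hε₀ hv.continuous.stronglyMeasurable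
    hdv.stronglyMeasurable hvρ hgρ
  -- the terms `𝓑(ρ) div v` of both limits cancel in part
  have hval : -renormPairing 𝓑 ζ ρ v (fderiv ℝ v) =
      -(∫ x, 𝓑 (ρ x) * (fderiv ℝ ζ x (v x) + ζ x * divOf (fderiv ℝ v x))) +
      ∫ x, ζ x * fderivWithin ℝ 𝓑 (orthant M) (ρ x) (divOf (fderiv ℝ v x) • ρ x) := by
    obtain ⟨D, hD⟩ := hdc.bounded_above_of_compact_support
      ((hvc.fderiv ℝ).comp_left (g := divOf) (by simp [divOf]))
    have i3 : Integrable fun x => 𝓑 (ρ x) * (ζ x * divOf (fderiv ℝ v x)) := by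
      obtain ⟨D', hD'⟩ := (d.test.continuous.mul hdc).bounded_above_of_compact_support
        ((hvc.fderiv ℝ).comp_left (g := divOf) (by simp [divOf])).mul_left
      refine (d.integrable.norm.const_mul (Cb * D')).mono'
        ((d.renorm.stronglyMeasurable_comp d.density_meas d.density_mem).mul
          (d.test.continuous.mul hdc).stronglyMeasurable).aestronglyMeasurable
        (Eventually.of_forall fun x => ?_)
      rw [norm_mul]
      calc _ ≤ (Cb * ‖ρ x‖) * D' := mul_le_mul (d.norm_renorm_le (d.density_mem x)) (hD' x)
            (norm_nonneg _) (mul_nonneg d.Cb_nonneg (norm_nonneg _))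
        _ = _ := by ring
    have e1 : ∫ x, 𝓑 (ρ x) * (fderiv ℝ ζ x (v x) + ζ x * divOf (fderiv ℝ v x)) =
        (∫ x, 𝓑 (ρ x) * fderiv ℝ ζ x (v x)) + ∫ x, 𝓑 (ρ x) * (ζ x * divOf (fderiv ℝ v x)) := by
      rw [← integral_add i1 i3]
      simp only [mul_add]
    have e2 : ∫ x, ζ x * fderivWithin ℝ 𝓑 (orthant M) (ρ x) (divOf (fderiv ℝ v x) • ρ x) =
        (∫ x, (fderivWithin ℝ 𝓑 (orthant M) (ρ x) (ρ x) - 𝓑 (ρ x)) *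
          divOf (fderiv ℝ v x) * ζ x) + ∫ x, 𝓑 (ρ x) * (ζ x * divOf (fderiv ℝ v x)) := by
      rw [← integral_add i2 i3]
      refine integral_congr_ae (Eventually.of_forall fun x => ?_)
      simp only [map_smul, smul_eq_mul]
      ring
    rw [renormPairing, integral_sub i1 i2, e1, e2]
    ring
  rw [hval]
  refine h1.congr' ?_
  filter_upwards [Ioo_mem_nhdsGT hε₀] with ε hε
  rw [d.fluxPairing_eq hε.1 hε.2.le hv hvc]

end FixedTimeData

end

section

/-- A velocity field `v` with weak gradient `g` on the bounded set `B`, both extended by zero and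
of class `L^p`, together with a set `N` that has distance at least `δ` from the complement
of `B`. -/
structure SobolevVelocity (B N : Set R3) (δ : ℝ) (p : ℝ≥0∞) (v : R3 → R3)
    (g : R3 → R3 →L[ℝ] R3) : Prop where
  isBounded : Bornology.IsBounded B
  pos : 0 < δ
  closedBall_subset : ∀ x ∈ N, Metric.closedBall x δ ⊆ B
  one_le : 1 ≤ p
  ne_top : p ≠ ⊤
  weakGradient : HasWeakGradient B v g
  zero : ∀ x, x ∉ B → v x = 0
  grad_zero : ∀ x, x ∉ B → g x = 0
  meas : StronglyMeasurable v
  grad_meas : StronglyMeasurable g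
  memLp : MemLp v p
  grad_memLp : MemLp g p

variable {M : ℕ}

namespace FixedTimeData

variable {𝓑 : (Fin M → ℝ) → ℝ} {Cb : ℝ} {K N : Set R3} {ε₀ : ℝ} {ζ : R3 → ℝ} {Z : ℝ}
  {ρ : R3 → Fin M → ℝ} {γ p : ℝ≥0∞} {B : Set R3} {δ : ℝ} {v : R3 → R3} {g : R3 → R3 →L[ℝ] R3}

lemma lintegral_mul_lt_top_of_memLp (d : FixedTimeData 𝓑 Cb K N ε₀ ζ Z ρ γ) (hε₀ : 0 < ε₀)
    [γ.HolderConjugate p] {G : Type*} [NormedAddCommGroup G] {w : R3 → G}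
    (hw : StronglyMeasurable w) (hwp : MemLp w p) : ∫⁻ y, ‖ρ y‖ₑ * ‖w y‖ₑ < ⊤ :=
  (d.lintegral_mul_self_le hε₀ (p := p) hw).trans_lt (ENNReal.mul_lt_top d.density_memLp.2
    ((eLpNorm_restrict_le _ _ _ _).trans_lt hwp.2))

/-- Stability of the flux pairing with respect to the velocity, uniformly in the scale. -/
lemma edist_fluxPairing_le (d : FixedTimeData 𝓑 Cb K N ε₀ ζ Z ρ γ) [γ.HolderConjugate p]
    (V : SobolevVelocity B N δ p v g) {Λ : ℝ≥0∞} {ε : ℝ} (hε : 0 < ε) (hε' : ε ≤ ε₀)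
    (hΛ : ∫⁻ x, ‖fderiv ℝ (mollKernel ε) x‖ₑ * ‖x‖ₑ ≤ Λ) (hΛ' : Λ ≠ ⊤) {w : R3 → R3}
    (hw : ContDiff ℝ 1 w) (hwc : HasCompactSupport w) :
    edist (fluxPairing 𝓑 ζ ρ ε v) (fluxPairing 𝓑 ζ ρ ε w) ≤
      ENNReal.ofReal (Z * Cb) * (3 + Λ) * eLpNorm ρ γ *
      (eLpNorm (fun x => v x - w x) p (volume.restrict N) +
        eLpNorm (fun x => g x - fderiv ℝ w x) p (volume.restrict N)) := by
  have hε₀ : 0 < ε₀ := hε.trans_le hε'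
  obtain ⟨z, hz, hzc, hz1, hz2⟩ := exists_contDiff_approx V.isBounded V.pos V.closedBall_subset
    d.measurableSet V.one_le V.ne_top V.weakGradient V.zero V.grad_zero V.meas V.grad_meas
    V.memLp V.grad_memLp
  have hz' : ∀ n, ContDiff ℝ 1 (z n) := fun n => (hz n).of_le (by simp)
  have hvρ := d.lintegral_mul_lt_top_of_memLp hε₀ V.meas V.memLp
  have hwρ := d.lintegral_mul_lt_top hw.continuous hwc
  have hzρ := fun n => d.lintegral_mul_lt_top (hz' n).continuous (hzc n)
  have hzm := fun n => (hz' n).continuous.stronglyMeasurable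
  have hwm := hw.continuous.stronglyMeasurable
  have hρ : eLpNorm ρ γ volume ≠ ⊤ := d.density_memLp.eLpNorm_ne_top
  -- at a fixed scale the pairing is continuous with respect to the velocity in `L^p`
  have hlim : Tendsto (fun n => fluxPairing 𝓑 ζ ρ ε (z n)) atTop
      (𝓝 (fluxPairing 𝓑 ζ ρ ε v)) := by
    rw [tendsto_iff_edist_tendsto_0]
    have h0 : Tendsto (fun n => ENNReal.ofReal (Z * Cb) *
        ((∫⁻ h, ‖fderiv ℝ (mollKernel ε) h‖ₑ) * (eLpNorm ρ γ *
          eLpNorm (fun x => z n x - v x) p (volume.restrict N)))) atTop (𝓝 0) := by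
      have h1 := ENNReal.Tendsto.const_mul (a := eLpNorm ρ γ volume) hz1 (Or.inr hρ)
      have h2 := ENNReal.Tendsto.const_mul (a := ∫⁻ h, ‖fderiv ℝ (mollKernel ε) h‖ₑ) h1
        (Or.inr (lintegral_enorm_fderiv_mollKernel_lt_top hε).ne)
      simpa using ENNReal.Tendsto.const_mul (a := ENNReal.ofReal (Z * Cb)) h2 (Or.inr (by simp))
    refine tendsto_of_tendsto_of_tendsto_of_le_of_le tendsto_const_nhds h0
      (fun _ => zero_le) fun n => ?_
    rw [edist_eq_enorm_sub, ← d.fluxPairing_sub hε hε' (hzm n) V.meas (hzρ n) hvρ]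
    refine (d.enorm_fluxPairing_le hε hε' ((hzm n).sub V.meas)).trans ?_
    gcongr
    exact d.lintegral_mul_self_le hε₀ ((hzm n).sub V.meas)
  have hrhs : Tendsto (fun n => ENNReal.ofReal (Z * Cb) * (3 + Λ) * eLpNorm ρ γ *
      ((eLpNorm (fun x => z n x - v x) p (volume.restrict N) +
        eLpNorm (fun x => v x - w x) p (volume.restrict N)) +
      (eLpNorm (fun x => fderiv ℝ (z n) x - g x) p (volume.restrict N) +
        eLpNorm (fun x => g x - fderiv ℝ w x) p (volume.restrict N)))) atTop
      (𝓝 (ENNReal.ofReal (Z * Cb) * (3 + Λ) * eLpNorm ρ γ *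
      ((0 + eLpNorm (fun x => v x - w x) p (volume.restrict N)) +
      (0 + eLpNorm (fun x => g x - fderiv ℝ w x) p (volume.restrict N))))) := by
    refine ENNReal.Tendsto.const_mul ((hz1.add tendsto_const_nhds).add
      (hz2.add tendsto_const_nhds)) (Or.inr ?_)
    exact ENNReal.mul_ne_top (ENNReal.mul_ne_top (by simp) (by simp [hΛ'])) hρ
  rw [zero_add, zero_add] at hrhs
  refine le_of_tendsto_of_tendsto (hlim.edist tendsto_const_nhds) hrhs
    (Eventually.of_forall fun n => ?_)
  simp only
  rw [edist_eq_enorm_sub, ← d.fluxPairing_sub hε hε' (hzm n) hwm (hzρ n) hwρ]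
  refine (d.enorm_fluxPairing_le_of_contDiff (p := p) hε hε' hΛ ((hz' n).sub hw)
    ((hzc n).sub hwc)).trans ?_
  have hdz := fun n => ((hz' n).continuous_fderiv (by simp)).aestronglyMeasurable
    (μ := volume.restrict N)
  have hdw := (hw.continuous_fderiv (by simp)).aestronglyMeasurable (μ := volume.restrict N)
  have tri : ∀ {G : Type} [NormedAddCommGroup G] (a b c : R3 → G),
      AEStronglyMeasurable a (volume.restrict N) → AEStronglyMeasurable b (volume.restrict N) →
      AEStronglyMeasurable c (volume.restrict N) →
      eLpNorm (fun x => a x - c x) p (volume.restrict N) ≤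
        eLpNorm (fun x => a x - b x) p (volume.restrict N) +
        eLpNorm (fun x => b x - c x) p (volume.restrict N) := by
    intro G _ a b c ha hb hc
    refine le_trans (le_of_eq ?_) (eLpNorm_add_le (ha.sub hb) (hb.sub hc) V.one_le)
    congr 1
    ext x
    simp
  have hfd : fderiv ℝ (fun y => z n y - w y) = fun x => fderiv ℝ (z n) x - fderiv ℝ w x := by
    ext1 x
    exact fderiv_fun_sub (((hz' n).differentiable (by simp)) x) ((hw.differentiable (by simp)) x)
  rw [hfd]
  gcongr
  · exact tri _ _ _ (hzm n).aestronglyMeasurable V.meas.aestronglyMeasurable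
      hwm.aestronglyMeasurable
  · exact tri _ _ _ (hdz n) V.grad_meas.aestronglyMeasurable hdw

/-- The bound of the flux pairing by the Sobolev norm of the velocity, uniformly in the scale. -/
lemma enorm_fluxPairing_le_of_sobolev (d : FixedTimeData 𝓑 Cb K N ε₀ ζ Z ρ γ)
    [γ.HolderConjugate p] (V : SobolevVelocity B N δ p v g) {Λ : ℝ≥0∞} {ε : ℝ} (hε : 0 < ε)
    (hε' : ε ≤ ε₀) (hΛ : ∫⁻ x, ‖fderiv ℝ (mollKernel ε) x‖ₑ * ‖x‖ₑ ≤ Λ) (hΛ' : Λ ≠ ⊤) :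
    ‖fluxPairing 𝓑 ζ ρ ε v‖ₑ ≤ ENNReal.ofReal (Z * Cb) * (3 + Λ) * eLpNorm ρ γ *
      (eLpNorm v p (volume.restrict N) + eLpNorm g p (volume.restrict N)) := by
  have h := d.edist_fluxPairing_le V hε hε' hΛ hΛ' (w := fun _ => 0) contDiff_const
    HasCompactSupport.zero
  have h0 : fluxPairing 𝓑 ζ ρ ε (fun _ => 0) = 0 := by simp [fluxPairing, flux]
  rw [h0, edist_zero_right] at h
  simpa using h

/-- The renormalization lemma at a fixed time. For smooth velocities it follows from an integration
by parts and the convergence of the commutator; the general case follows by approximation, since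
both sides are continuous in the velocity, uniformly in the scale. -/
lemma tendsto_fluxPairing (d : FixedTimeData 𝓑 Cb K N ε₀ ζ Z ρ γ) [γ.HolderConjugate p]
    (hε₀ : 0 < ε₀) (V : SobolevVelocity B N δ p v g) :
    Tendsto (fun ε : ℝ => fluxPairing 𝓑 ζ ρ ε v) (𝓝[>] 0) (𝓝 (-renormPairing 𝓑 ζ ρ v g)) := by
  obtain ⟨Λ, hΛtop, hΛ⟩ := exists_lintegral_fderiv_mollKernel_le
  obtain ⟨z, hz, hzc, hz1, hz2⟩ := exists_contDiff_approx V.isBounded V.pos V.closedBall_subset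
    d.measurableSet V.one_le V.ne_top V.weakGradient V.zero V.grad_zero V.meas V.grad_meas
    V.memLp V.grad_memLp
  have hz' : ∀ n, ContDiff ℝ 1 (z n) := fun n => (hz n).of_le (by simp)
  have hdz := fun n => (hz' n).continuous_fderiv (n := 1) (by simp)
  have hρ : eLpNorm ρ γ volume ≠ ⊤ := d.density_memLp.eLpNorm_ne_top
  set X : ℕ → ℝ≥0∞ := fun n => eLpNorm (fun x => v x - z n x) p (volume.restrict N) +
    eLpNorm (fun x => g x - fderiv ℝ (z n) x) p (volume.restrict N) with hX
  have hX0 : Tendsto X atTop (𝓝 0) := by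
    have := hz1.add hz2
    rw [add_zero] at this
    refine this.congr fun n => ?_
    congr 1
    · rw [← eLpNorm_neg]
      congr 1
      ext1 x
      simp
    · rw [← eLpNorm_neg]
      congr 1
      ext1 x
      simp
  -- stability of the limit
  have hlimit : ∀ n, edist (-renormPairing 𝓑 ζ ρ (z n) (fderiv ℝ (z n)))
      (-renormPairing 𝓑 ζ ρ v g) ≤ ENNReal.ofReal (Z * Cb) * (1 + 6) * eLpNorm ρ γ * X n := by
    intro n
    have hzm := (hz' n).continuous.stronglyMeasurable
    have hdzm := (hdz n).stronglyMeasurable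
    have hvρ := d.lintegral_mul_lt_top_of_memLp hε₀ V.meas V.memLp
    have hgρ := d.lintegral_mul_lt_top_of_memLp hε₀ V.grad_meas V.grad_memLp
    have hzρ := d.lintegral_mul_lt_top (hz' n).continuous (hzc n)
    have hdzρ := d.lintegral_mul_lt_top (hdz n) ((hzc n).fderiv ℝ)
    obtain ⟨i1, i2, -, -⟩ := d.integrable_renormPairing hε₀ V.meas V.grad_meas hvρ hgρ
    obtain ⟨i3, i4, -, -⟩ := d.integrable_renormPairing hε₀ hzm hdzm hzρ hdzρ
    have k1 : ∫⁻ y, ‖ρ y‖ₑ * ‖v y - z n y‖ₑ ≤ eLpNorm ρ γ *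
        eLpNorm (fun x => v x - z n x) p (volume.restrict N) :=
      d.lintegral_mul_self_le hε₀ (V.meas.sub hzm)
    have k2 : ∫⁻ y, ‖ρ y‖ₑ * ‖g y - fderiv ℝ (z n) y‖ₑ ≤ eLpNorm ρ γ *
        eLpNorm (fun x => g x - fderiv ℝ (z n) x) p (volume.restrict N) :=
      d.lintegral_mul_self_le hε₀ (V.grad_meas.sub hdzm)
    have f1 : ∫⁻ y, ‖ρ y‖ₑ * ‖v y - z n y‖ₑ < ⊤ := by
      refine k1.trans_lt (ENNReal.mul_lt_top d.density_memLp.2 ?_)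
      refine (eLpNorm_restrict_le _ _ _ _).trans_lt (V.memLp.sub ?_).2
      exact (hz' n).continuous.memLp_of_hasCompactSupport (hzc n)
    have f2 : ∫⁻ y, ‖ρ y‖ₑ * ‖g y - fderiv ℝ (z n) y‖ₑ < ⊤ := by
      refine k2.trans_lt (ENNReal.mul_lt_top d.density_memLp.2 ?_)
      refine (eLpNorm_restrict_le _ _ _ _).trans_lt (V.grad_memLp.sub ?_).2
      exact (hdz n).memLp_of_hasCompactSupport ((hzc n).fderiv ℝ)
    obtain ⟨-, -, j1, j2⟩ := d.integrable_renormPairing hε₀ (V.meas.sub hzm)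
      (V.grad_meas.sub hdzm) f1 f2
    have e1 : -renormPairing 𝓑 ζ ρ (z n) (fderiv ℝ (z n)) - -renormPairing 𝓑 ζ ρ v g =
        (∫ x, 𝓑 (ρ x) * fderiv ℝ ζ x ((v - z n) x)) -
        ∫ x, (fderivWithin ℝ 𝓑 (orthant M) (ρ x) (ρ x) - 𝓑 (ρ x)) *
          divOf ((g - fderiv ℝ (z n)) x) * ζ x := by
      simp only [Pi.sub_apply, map_sub, divOf_sub, mul_sub, sub_mul (_ * _) (_ * _) (ζ _)]
      rw [integral_sub i1 i3, integral_sub i2 i4, renormPairing, renormPairing,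
        integral_sub i1 i2, integral_sub i3 i4]
      ring
    rw [edist_eq_enorm_sub, e1]
    refine (enorm_sub_le).trans ((add_le_add j1 j2).trans ?_)
    calc _ ≤ ENNReal.ofReal (Z * Cb) * (eLpNorm ρ γ *
          eLpNorm (fun x => v x - z n x) p (volume.restrict N)) + ENNReal.ofReal (Z * Cb) *
          (6 * (eLpNorm ρ γ *
            eLpNorm (fun x => g x - fderiv ℝ (z n) x) p (volume.restrict N))) := by
          gcongr
          · exact k1
          · exact k2
      _ = ENNReal.ofReal (Z * Cb) * eLpNorm ρ γ *
          (1 * eLpNorm (fun x => v x - z n x) p (volume.restrict N) +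
          6 * eLpNorm (fun x => g x - fderiv ℝ (z n) x) p (volume.restrict N)) := by ring
      _ ≤ ENNReal.ofReal (Z * Cb) * eLpNorm ρ γ *
          ((1 + 6) * eLpNorm (fun x => v x - z n x) p (volume.restrict N) +
          (1 + 6) * eLpNorm (fun x => g x - fderiv ℝ (z n) x) p (volume.restrict N)) := by
          gcongr
          · exact le_add_right le_rfl
          · exact le_add_left le_rfl
      _ = _ := by rw [hX]; ring
  -- three-`ε` argument: first choose the smooth velocity, then the scale
  rw [EMetric.tendsto_nhds]
  intro η hη
  have hη3 : 0 < η / 3 := ENNReal.div_pos hη.ne' (by simp)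
  have hA : Tendsto (fun n => ENNReal.ofReal (Z * Cb) * (3 + Λ) * eLpNorm ρ γ * X n) atTop
      (𝓝 0) := by
    have := ENNReal.Tendsto.const_mul
      (a := ENNReal.ofReal (Z * Cb) * (3 + Λ) * eLpNorm ρ γ volume) hX0
      (Or.inr (ENNReal.mul_ne_top (ENNReal.mul_ne_top (by simp) (by simp [hΛtop])) hρ))
    simpa using this
  have hB : Tendsto (fun n => ENNReal.ofReal (Z * Cb) * (1 + 6) * eLpNorm ρ γ * X n) atTop
      (𝓝 0) := by
    have := ENNReal.Tendsto.const_mul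
      (a := ENNReal.ofReal (Z * Cb) * (1 + 6) * eLpNorm ρ γ volume) hX0
      (Or.inr (ENNReal.mul_ne_top (ENNReal.mul_ne_top (by simp) (by simp)) hρ))
    simpa using this
  obtain ⟨n, hn1, hn2⟩ := ((hA.eventually_lt_const hη3).and (hB.eventually_lt_const hη3)).exists
  have hC := EMetric.tendsto_nhds.1 (d.tendsto_fluxPairing_of_contDiff hε₀ (hz' n) (hzc n)) _ hη3
  filter_upwards [hC, Ioo_mem_nhdsGT hε₀] with ε h1 hε
  calc edist (fluxPairing 𝓑 ζ ρ ε v) (-renormPairing 𝓑 ζ ρ v g)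
      ≤ edist (fluxPairing 𝓑 ζ ρ ε v) (fluxPairing 𝓑 ζ ρ ε (z n)) +
        edist (fluxPairing 𝓑 ζ ρ ε (z n)) (-renormPairing 𝓑 ζ ρ (z n) (fderiv ℝ (z n))) +
        edist (-renormPairing 𝓑 ζ ρ (z n) (fderiv ℝ (z n))) (-renormPairing 𝓑 ζ ρ v g) :=
        edist_triangle4 _ _ _ _
    _ < η / 3 + η / 3 + η / 3 := by
        refine ENNReal.add_lt_add (ENNReal.add_lt_add ?_ h1) ((hlimit n).trans_lt hn2)
        exact (d.edist_fluxPairing_le V hε.1 hε.2.le (hΛ ε hε.1) hΛtop (hz' n) (hzc n)).trans_lt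
          hn1
    _ = η := ENNReal.add_thirds η

end FixedTimeData

end

/-! ### Weak derivatives in time -/

/-- A function on an interval whose weak derivative vanishes is constant. -/
lemma ae_eq_const_of_integral_deriv_mul {T : ℝ} (hT : 0 < T) {w : ℝ → ℝ}
    (hw : IntegrableOn w (Ioo 0 T))
    (h : ∀ ψ : ℝ → ℝ, ContDiff ℝ ∞ ψ → HasCompactSupport ψ → tsupport ψ ⊆ Ioo 0 T →
      ∫ s in Ioo 0 T, deriv ψ s * w s = 0) :
    ∃ c : ℝ, ∀ᵐ s ∂(volume.restrict (Ioo 0 T)), w s = c := by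
  -- a bump function of integral one in the interval
  obtain ⟨χ, hχc, hχs, hχt, hχ1⟩ : ∃ χ : ℝ → ℝ, ContDiff ℝ ∞ χ ∧ HasCompactSupport χ ∧
      tsupport χ ⊆ Ioo 0 T ∧ ∫ s, χ s = 1 := by
    let b : ContDiffBump (T / 2) := ⟨T / 8, T / 4, by positivity, by linarith⟩
    refine ⟨b.normed volume, b.contDiff_normed, b.hasCompactSupport_normed, ?_, b.integral_normed⟩
    rw [b.tsupport_normed_eq]
    intro s hs
    rw [Metric.mem_closedBall, Real.dist_eq, abs_le] at hs
    have : b.rOut = T / 4 := rfl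
    rw [this] at hs
    constructor <;> linarith [hs.1, hs.2]
  refine ⟨∫ s in Ioo 0 T, χ s * w s, ?_⟩
  set c := ∫ s in Ioo 0 T, χ s * w s with hc
  have key : ∀ g : ℝ → ℝ, ContDiff ℝ ∞ g → HasCompactSupport g → tsupport g ⊆ Ioo 0 T →
      ∫ x, g x • (w x - c) ∂(volume.restrict (Ioo 0 T)) = 0 := by
    intro g hg hgs hgt
    -- subtract a multiple of the bump to obtain a derivative of a test function
    set I := ∫ s, g s with hI
    set f : ℝ → ℝ := fun s => g s - I * χ s with hf
    have hfc : ContDiff ℝ ∞ f := hg.sub (contDiff_const.mul hχc)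
    have hgi : Integrable g := hg.continuous.integrable_of_hasCompactSupport hgs
    have hχi : Integrable χ := hχc.continuous.integrable_of_hasCompactSupport hχs
    have hfs : HasCompactSupport f := hgs.sub hχs.mul_left
    have hft : tsupport f ⊆ Ioo 0 T := by
      refine (tsupport_sub _ _).trans (union_subset hgt ?_)
      exact (closure_mono fun x hx => by
        rw [Function.mem_support] at hx ⊢
        exact fun h0 => hx (by simp [h0])).trans hχt
    have hf0 : ∫ s, f s = 0 := by
      rw [hf, integral_sub hgi (hχi.const_mul _), integral_const_mul, hχ1, hI]
      ring
    set ψ : ℝ → ℝ := fun t => ∫ s in (0 : ℝ)..t, f s with hψ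
    have hψd : ∀ t, HasDerivAt ψ (f t) t := fun t =>
      intervalIntegral.integral_hasDerivAt_right (hfc.continuous.intervalIntegrable _ _)
        (hfc.continuous.stronglyMeasurableAtFilter _ _) hfc.continuous.continuousAt
    have hψ' : deriv ψ = f := funext fun t => (hψd t).deriv
    have hψc : ContDiff ℝ ∞ ψ := by
      rw [contDiff_infty_iff_deriv, hψ']
      exact ⟨fun t => (hψd t).differentiableAt, hfc⟩
    -- the primitive vanishes outside of an interval that contains the support of `f`
    obtain ⟨α, β, hα, hβ, hαβ⟩ : ∃ α β : ℝ, 0 < α ∧ β < T ∧ ∀ s, s ∉ Icc α β → f s = 0 := by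
      rcases (tsupport f).eq_empty_or_nonempty with he | hne
      · refine ⟨T / 2, T / 2, by positivity, by linarith, fun s _ => ?_⟩
        exact image_eq_zero_of_notMem_tsupport (by simp [he])
      · have hcomp : IsCompact (tsupport f) := hfs
        refine ⟨sInf (tsupport f), sSup (tsupport f), (hft (hcomp.sInf_mem hne)).1,
          (hft (hcomp.sSup_mem hne)).2, fun s hs => ?_⟩
        refine image_eq_zero_of_notMem_tsupport fun hst => hs ⟨?_, ?_⟩
        · exact csInf_le hcomp.bddBelow hst
        · exact le_csSup hcomp.bddAbove hst
    have hψ0 : ∀ t, t < α → ψ t = 0 := by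
      intro t ht
      refine intervalIntegral.integral_zero_ae (Eventually.of_forall fun s hs =>
          hαβ s fun hs' => ?_)
      rcases mem_uIoc.1 hs with h | h
      · linarith [hs'.1, h.2]
      · linarith [hs'.1, h.2]
    have hψ1 : ∀ t, β < t → ψ t = 0 := by
      intro t ht
      have e1 : ψ t - ψ (α - 1) = ∫ s in (α - 1)..t, f s := by
        rw [hψ]
        simp only
        rw [intervalIntegral.integral_interval_sub_left] <;>
          exact hfc.continuous.intervalIntegrable _ _
      rw [hψ0 (α - 1) (by linarith), sub_zero] at e1
      rw [e1]
      rcases le_or_gt (α - 1) t with hle | hlt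
      · rw [intervalIntegral.integral_of_le hle,
          setIntegral_eq_integral_of_forall_compl_eq_zero, hf0]
        intro s hs
        refine hαβ s fun hs' => hs ⟨?_, ?_⟩
        · linarith [hs'.1]
        · linarith [hs'.2]
      · refine intervalIntegral.integral_zero_ae (Eventually.of_forall fun s hs =>
          hαβ s fun hs' => ?_)
        rcases mem_uIoc.1 hs with h | h
        · linarith [hs'.1, h.2]
        · linarith [hs'.1, h.2]
    have hψsupp : Function.support ψ ⊆ Icc α β := by
      intro t ht
      rw [Function.mem_support] at ht
      constructor
      · by_contra h; exact ht (hψ0 t (not_le.1 h))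
      · by_contra h; exact ht (hψ1 t (not_le.1 h))
    have hres := h ψ hψc (HasCompactSupport.of_support_subset_isCompact isCompact_Icc hψsupp)
      ((closure_minimal hψsupp isClosed_Icc).trans fun s hs =>
        ⟨hα.trans_le hs.1, hs.2.trans_lt hβ⟩)
    rw [hψ'] at hres
    have hbdd : ∀ {k : ℝ → ℝ}, Continuous k → HasCompactSupport k →
        IntegrableOn (fun s => k s * w s) (Ioo 0 T) := by
      intro k hk hks
      obtain ⟨C, hC⟩ := hk.bounded_above_of_compact_support hks
      exact hw.bdd_mul hk.aestronglyMeasurable (Eventually.of_forall hC)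
    have hgI : ∫ s in Ioo 0 T, g s = I := by
      rw [hI]
      refine setIntegral_eq_integral_of_forall_compl_eq_zero fun s hs => ?_
      exact image_eq_zero_of_notMem_tsupport fun h' => hs (hgt h')
    have e2 : ∫ s in Ioo 0 T, f s * w s = (∫ s in Ioo 0 T, g s * w s) - I * c := by
      rw [hc, ← integral_const_mul, ← integral_sub (hbdd hg.continuous hgs)
        ((hbdd hχc.continuous hχs).const_mul _)]
      refine integral_congr_ae (Eventually.of_forall fun s => ?_)
      simp only [hf]
      ring
    simp only [smul_eq_mul, mul_sub]
    rw [integral_sub (hbdd hg.continuous hgs) (hgi.integrableOn.mul_const _), integral_mul_const,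
      hgI]
    linarith
  have hwl : LocallyIntegrableOn (fun s => w s - c) (Ioo 0 T) (volume.restrict (Ioo 0 T)) := by
    have h1 : Integrable (fun s => w s - c) (volume.restrict (Ioo 0 T)) :=
      hw.sub (integrable_const c)
    exact h1.locallyIntegrable.locallyIntegrableOn _
  have := isOpen_Ioo.ae_eq_zero_of_integral_contDiff_smul_eq_zero hwl key
  filter_upwards [this, ae_restrict_mem measurableSet_Ioo] with s hs hmem
  exact sub_eq_zero.1 (hs hmem)

/-- A function with an integrable weak derivative on an interval is almost everywhere a primitive
of it. -/
lemma ae_eq_primitive_of_weak_deriv {T : ℝ} (hT : 0 < T) {f k : ℝ → ℝ}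
    (hf : IntegrableOn f (Ioo 0 T)) (hk : IntegrableOn k (Ioo 0 T))
    (h : ∀ ψ : ℝ → ℝ, ContDiff ℝ ∞ ψ → HasCompactSupport ψ → tsupport ψ ⊆ Ioo 0 T →
      ∫ s in Ioo 0 T, (deriv ψ s * f s + ψ s * k s) = 0) :
    ∃ c : ℝ, ∀ᵐ s ∂(volume.restrict (Ioo 0 T)), f s = c + ∫ τ in (0 : ℝ)..s, k τ := by
  have hkI : IntervalIntegrable k volume 0 T := by
    rw [intervalIntegrable_iff_integrableOn_Ioo_of_le hT.le]
    exact hk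
  set P : ℝ → ℝ := fun s => ∫ τ in (0 : ℝ)..s, k τ with hP
  have hPac : AbsolutelyContinuousOnInterval P 0 T :=
    hkI.absolutelyContinuousOnInterval_intervalIntegral left_mem_uIcc
  have hPc : ContinuousOn P (Icc 0 T) := by
    have := hPac.continuousOn
    rwa [uIcc_of_le hT.le] at this
  have hPi : IntegrableOn P (Ioo 0 T) :=
    (hPc.integrableOn_compact isCompact_Icc).mono_set Ioo_subset_Icc_self
  -- after an integration by parts for the absolutely continuous primitive, the weak derivative
  -- of the difference vanishes
  suffices key : ∀ ψ : ℝ → ℝ, ContDiff ℝ ∞ ψ → HasCompactSupport ψ → tsupport ψ ⊆ Ioo 0 T →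
      ∫ s in Ioo 0 T, deriv ψ s * (f - P) s = 0 by
    obtain ⟨c, hc⟩ := ae_eq_const_of_integral_deriv_mul hT (hf.sub hPi) key
    refine ⟨c, hc.mono fun s hs => ?_⟩
    rw [← hs]
    simp [hP]
  intro ψ hψ hψs hψt
  have hψ1 : ContDiff ℝ 1 ψ := hψ.of_le (by simp)
  have hψac : AbsolutelyContinuousOnInterval ψ 0 T := hψ1.contDiffOn.absolutelyContinuousOnInterval
  have hparts := hψac.integral_mul_deriv_eq_deriv_mul hPac
  have h0 : ψ 0 = 0 := image_eq_zero_of_notMem_tsupport fun h' => (hψt h').1.false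
  have hT0 : ψ T = 0 := image_eq_zero_of_notMem_tsupport fun h' => (hψt h').2.false
  have hder : ∫ x in (0 : ℝ)..T, ψ x * deriv P x = ∫ x in (0 : ℝ)..T, ψ x * k x := by
    refine intervalIntegral.integral_congr_ae ?_
    filter_upwards [hkI.ae_hasDerivAt_integral] with x hx hxm
    rw [(hx (uIoc_subset_uIcc hxm) 0 left_mem_uIcc).deriv]
  have toIoo : ∀ q : ℝ → ℝ, ∫ x in (0 : ℝ)..T, q x = ∫ x in Ioo 0 T, q x := fun q => by
    rw [intervalIntegral.integral_of_le hT.le, integral_Ioc_eq_integral_Ioo]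
  rw [hder, h0, hT0, zero_mul, zero_mul, sub_zero, zero_sub, toIoo, toIoo] at hparts
  have hψ'c : Continuous (deriv ψ) := hψ1.continuous_deriv (by simp)
  have hbdd : ∀ {b q : ℝ → ℝ}, Continuous b → HasCompactSupport b → IntegrableOn q (Ioo 0 T) →
      IntegrableOn (fun s => b s * q s) (Ioo 0 T) := by
    intro b q hb hbs hq
    obtain ⟨C, hC⟩ := hb.bounded_above_of_compact_support hbs
    exact hq.bdd_mul hb.aestronglyMeasurable (Eventually.of_forall hC)
  have h1 := h ψ hψ hψs hψt
  rw [integral_add (hbdd hψ'c hψs.deriv hf) (hbdd hψ.continuous hψs hk)] at h1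
  simp only [Pi.sub_apply, mul_sub]
  rw [integral_sub (hbdd hψ'c hψs.deriv hf) (hbdd hψ'c hψs.deriv hPi)]
  linarith

/-! ### Weak limits in `L²` -/

/-- A family that is bounded in `L²` along a filter has a weak limit point, which lies in every
closed convex set that eventually contains the family. -/
lemma exists_weak_limit {ι : Type*} {F : Filter ι} [F.NeBot] {f : ι → Lp ℝ 2 (volume : Measure R3)}
    {C : ℝ} (hf : ∀ᶠ s in F, ‖f s‖ ≤ C) :
    ∃ W : Lp ℝ 2 (volume : Measure R3), ∀ 𝒞 : Set (Lp ℝ 2 (volume : Measure R3)),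
      IsClosed 𝒞 → Convex ℝ 𝒞 → (∀ᶠ s in F, f s ∈ 𝒞) → W ∈ 𝒞 := by
  let H := Lp ℝ 2 (volume : Measure R3)
  let Φ : ι → WeakDual ℝ H := fun s =>
    StrongDual.toWeakDual (InnerProductSpace.toDual ℝ H (f s))
  have hcomp := WeakDual.isCompact_closedBall (𝕜 := ℝ) (0 : StrongDual ℝ H) C
  have hball : ∀ᶠ s in F, Φ s ∈ (WeakDual.toStrongDual ⁻¹'
      Metric.closedBall (0 : StrongDual ℝ H) C : Set (WeakDual ℝ H)) := by
    filter_upwards [hf] with s hs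
    rw [mem_preimage, Metric.mem_closedBall, dist_zero_right]
    exact ((InnerProductSpace.toDual ℝ H).norm_map (f s)).trans_le hs
  obtain ⟨ℓ, -, hℓ⟩ := hcomp.exists_mapClusterPt (u := Φ) (f := F)
    (Filter.le_principal_iff.2 (Filter.mem_map.2 hball))
  refine ⟨(InnerProductSpace.toDual ℝ H).symm (WeakDual.toStrongDual ℓ), fun 𝒞 hcl hcv hev => ?_⟩
  by_contra hW
  obtain ⟨φ, u, h1, h2⟩ := geometric_hahn_banach_closed_point hcv hcl hW
  -- the separating functional is the inner product with an element of `L²`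
  set g := (InnerProductSpace.toDual ℝ H).symm φ with hg
  have hφ : ∀ a : H, φ a = inner ℝ g a := fun a => by
    rw [hg, InnerProductSpace.toDual_symm_apply]
  have hclosed : IsClosed {m : WeakDual ℝ H | m g ≤ u} :=
    isClosed_le (WeakDual.eval_continuous g) continuous_const
  have hmem : ∀ᶠ s in F, Φ s ∈ {m : WeakDual ℝ H | m g ≤ u} := by
    filter_upwards [hev] with s hs
    have h3 := h1 _ hs
    rw [hφ, real_inner_comm] at h3
    exact h3.le
  have h4 : ℓ ∈ closure {m : WeakDual ℝ H | m g ≤ u} :=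
    mem_closure_iff_clusterPt.2 (ClusterPt.mono hℓ
      (Filter.le_principal_iff.2 (Filter.mem_map.2 hmem)))
  rw [hclosed.closure_eq] at h4
  rw [hφ, real_inner_comm, InnerProductSpace.toDual_symm_apply] at h2
  exact absurd h4 (not_le.2 h2)

section

variable {M : ℕ}

/-! ### The continuity equation in a moving domain -/

/-- A moving domain `A(t)`, `t ∈ [0,T]`, that stays in a compact subset `K` of a bounded open set
`B`. The field `exterior` is the continuity of the motion that the transport theory needs: almost
every point outside of `A(t)` has a neighbourhood that the domain does not meet for a short time. It
constrains the domains from outside only, as the densities are extended by zero. -/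
structure MovingDomain (T : ℝ) (A : ℝ → Set R3) (K B : Set R3) (ε₀ : ℝ) : Prop where
  pos : 0 < T
  measurableSet : ∀ t ∈ Icc 0 T, MeasurableSet (A t)
  measurableSet_spaceTime : MeasurableSet (spaceTime T A)
  subset : ∀ t ∈ Icc 0 T, A t ⊆ K
  isCompact : IsCompact K
  isOpen : IsOpen B
  isBounded : Bornology.IsBounded B
  radius_pos : 0 < ε₀
  closedBall_subset : ∀ x ∈ K, Metric.closedBall x (2 * ε₀) ⊆ B
  exterior : ∀ t ∈ Icc 0 T, ∀ᵐ x : R3, x ∉ A t →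
    ∀ᶠ z in 𝓝[Icc 0 T ×ˢ univ] (t, x), z.2 ∉ A z.1

/-- Jointly measurable densities `R`, extended by zero outside of the moving domain, that solve the
continuity equations with the jointly measurable velocity `U`, extended by zero outside of `B`. -/
structure TransportData (T : ℝ) (A : ℝ → Set R3) (K B : Set R3) (γ : Fin M → ℝ≥0∞)
    (γ₀ p C : ℝ≥0∞) (R : ℝ → R3 → Fin M → ℝ) (U : ℝ → R3 → R3)
    (DU : ℝ → R3 → R3 →L[ℝ] R3) : Prop where
  density_meas : StronglyMeasurable fun z : ℝ × R3 => R z.1 z.2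
  density_mem : ∀ s x, R s x ∈ orthant M
  density_zero : ∀ s x, s ∉ Ioo 0 T ∨ x ∉ A s → R s x = 0
  density_le : ∀ᵐ s ∂(volume.restrict (Ioo 0 T)), ∀ i, eLpNorm (fun x => R s x i) (γ i) ≤ C
  bound_ne_top : C ≠ ⊤
  two_le : 2 ≤ γ₀
  one_le_velocity : 1 ≤ p
  ne_top : p ≠ ⊤
  le_exponent : ∀ i, γ₀ ≤ γ i
  velocity_meas : StronglyMeasurable fun z : ℝ × R3 => U z.1 z.2
  grad_meas : StronglyMeasurable fun z : ℝ × R3 => DU z.1 z.2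
  velocity_zero : ∀ s x, x ∉ B → U s x = 0
  grad_zero : ∀ s x, x ∉ B → DU s x = 0
  weakGradient : ∀ᵐ s ∂(volume.restrict (Ioo 0 T)), HasWeakGradient B (U s) (DU s)
  memLp : ∀ᵐ s ∂(volume.restrict (Ioo 0 T)), MemLp (U s) p ∧ MemLp (DU s) p
  lintegral_lt_top : ∫⁻ s in Ioo 0 T, (eLpNorm (U s) p + eLpNorm (DU s) p) < ⊤
  continuity : ∀ i, ∀ ϕ : ℝ × R3 → ℝ, ContDiff ℝ ∞ ϕ → HasCompactSupport ϕ →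
    tsupport ϕ ⊆ Ioo (0 : ℝ) T ×ˢ univ →
    ∫ s in Ioo 0 T, ∫ x, R s x i * transport U ϕ s x = 0

lemma stronglyMeasurable_moll_prod (ε : ℝ) {F : Type*} [NormedAddCommGroup F] [NormedSpace ℝ F]
    {R : ℝ → R3 → F} (hR : StronglyMeasurable fun z : ℝ × R3 => R z.1 z.2) :
    StronglyMeasurable fun z : ℝ × R3 => moll ε (R z.1) z.2 := by
  have h : StronglyMeasurable fun w : (ℝ × R3) × R3 =>
      mollKernel ε (w.1.2 - w.2) • R w.1.1 w.2 :=
    ((mollKernel_continuous ε).comp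
      ((continuous_snd.comp continuous_fst).sub continuous_snd)).stronglyMeasurable.smul
      (hR.comp_measurable ((measurable_fst.comp measurable_fst).prodMk measurable_snd))
  exact h.integral_prod_right'

lemma stronglyMeasurable_flux_integrand_prod (ε : ℝ) {F : Type*} [NormedAddCommGroup F]
    [NormedSpace ℝ F] {R : ℝ → R3 → F} {U : ℝ → R3 → R3}
    (hR : StronglyMeasurable fun z : ℝ × R3 => R z.1 z.2)
    (hU : StronglyMeasurable fun z : ℝ × R3 => U z.1 z.2) :
    StronglyMeasurable fun w : (ℝ × R3) × R3 =>
      (fderiv ℝ (mollKernel ε) (w.1.2 - w.2) (U w.1.1 w.2)) • R w.1.1 w.2 := by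
  have hm : Measurable fun w : (ℝ × R3) × R3 => (w.1.1, w.2) :=
    (measurable_fst.comp measurable_fst).prodMk measurable_snd
  have h1 : StronglyMeasurable fun w : (ℝ × R3) × R3 =>
      fderiv ℝ (mollKernel ε) (w.1.2 - w.2) :=
    ((continuous_fderiv_mollKernel ε).comp
      ((continuous_snd.comp continuous_fst).sub continuous_snd)).stronglyMeasurable
  exact (isBoundedBilinearMap_apply.continuous.comp_stronglyMeasurable
    (h1.prodMk (hU.comp_measurable hm))).smul (hR.comp_measurable hm)

lemma stronglyMeasurable_flux_prod (ε : ℝ) {F : Type*} [NormedAddCommGroup F]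
    [NormedSpace ℝ F] {R : ℝ → R3 → F} {U : ℝ → R3 → R3}
    (hR : StronglyMeasurable fun z : ℝ × R3 => R z.1 z.2)
    (hU : StronglyMeasurable fun z : ℝ × R3 => U z.1 z.2) :
    StronglyMeasurable fun z : ℝ × R3 => flux ε (U z.1) (R z.1) z.2 :=
  (stronglyMeasurable_flux_integrand_prod ε hR hU).integral_prod_right'

/-- The mollified flux is bounded, uniformly in space, by the integral of `|v| |ρ|`. -/
lemma enorm_flux_le {ε : ℝ} {F : Type*} [NormedAddCommGroup F] [NormedSpace ℝ F] {C : ℝ}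
    (hC : ∀ x, ‖fderiv ℝ (mollKernel ε) x‖ ≤ C) {v : R3 → R3} {ρ : R3 → F}
    (hv : StronglyMeasurable v) (hρ : StronglyMeasurable ρ) (x : R3) :
    ‖flux ε v ρ x‖ₑ ≤ ENNReal.ofReal C * ∫⁻ y, ‖ρ y‖ₑ * ‖v y‖ₑ := by
  refine (enorm_integral_le_lintegral_enorm _).trans ?_
  have hm : Measurable fun y => ‖ρ y‖ₑ * ‖v y‖ₑ := hρ.enorm.mul hv.enorm
  rw [← lintegral_const_mul _ hm]
  refine lintegral_mono fun y => (enorm_fderiv_smul_le ε _ _ _).trans ?_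
  rw [mul_comm ‖v y‖ₑ]
  gcongr
  rw [← ofReal_norm]
  exact ENNReal.ofReal_le_ofReal (hC _)

/-- The mollified flux is continuous in space. -/
lemma continuous_flux {ε : ℝ} (hε : 0 < ε) {F : Type*} [NormedAddCommGroup F] [NormedSpace ℝ F]
    {v : R3 → R3} {ρ : R3 → F} (hv : StronglyMeasurable v) (hρ : StronglyMeasurable ρ)
    (hvρ : ∫⁻ y, ‖ρ y‖ₑ * ‖v y‖ₑ < ⊤) : Continuous (flux ε v ρ) := by
  obtain ⟨C, hC⟩ := exists_bound_fderiv_mollKernel hε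
  have hm : StronglyMeasurable fun y => ‖ρ y‖ * ‖v y‖ := hρ.norm.mul hv.norm
  have hi : Integrable fun y => ‖ρ y‖ * ‖v y‖ := by
    refine ⟨hm.aestronglyMeasurable, ?_⟩
    rw [hasFiniteIntegral_iff_enorm]
    simpa [enorm_mul] using hvρ
  refine continuous_of_dominated (bound := fun y => C * (‖ρ y‖ * ‖v y‖))
    (fun x => ((stronglyMeasurable_fderiv_mollKernel_smul ε hv hρ).comp_measurable
      (measurable_const.prodMk measurable_id)).aestronglyMeasurable)
    (fun x => Eventually.of_forall fun y => ?_) (hi.const_mul C)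
    (Eventually.of_forall fun y => ?_)
  · rw [norm_smul]
    calc _ ≤ (C * ‖v y‖) * ‖ρ y‖ := by
          gcongr
          exact (ContinuousLinearMap.le_opNorm _ _).trans
            (mul_le_mul_of_nonneg_right (hC _) (norm_nonneg _))
      _ = _ := by ring
  · exact (((continuous_fderiv_mollKernel ε).comp (continuous_id.sub continuous_const)).clm_apply
      continuous_const).smul continuous_const

lemma eLpNorm_le_sum_eLpNorm {μ : Measure R3} {γ : ℝ≥0∞} (hγ : 1 ≤ γ) {ρ : R3 → Fin M → ℝ}
    (hρ : StronglyMeasurable ρ) : eLpNorm ρ γ μ ≤ ∑ i, eLpNorm (fun x => ρ x i) γ μ := by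
  have hm : ∀ i, AEStronglyMeasurable (fun x => ‖ρ x i‖) μ := fun i =>
    ((measurable_pi_apply i).comp hρ.measurable).norm.aestronglyMeasurable
  calc eLpNorm ρ γ μ ≤ eLpNorm (∑ i, fun x => ‖ρ x i‖) γ μ := by
        refine eLpNorm_mono_real fun x => ?_
        rw [Finset.sum_apply]
        refine (pi_norm_le_iff_of_nonneg (Finset.sum_nonneg fun i _ => norm_nonneg _)).2 fun i => ?_
        exact Finset.single_le_sum (f := fun i => ‖ρ x i‖) (fun i _ => norm_nonneg _)
          (Finset.mem_univ i)
    _ ≤ ∑ i, eLpNorm (fun x => ‖ρ x i‖) γ μ := eLpNorm_sum_le (fun i _ => hm i) hγ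
    _ = _ := Finset.sum_congr rfl fun i _ => eLpNorm_norm _

/-- The densities are bounded in the smallest of the Lebesgue spaces. -/
lemma exists_eLpNorm_le {K : Set R3} (hK : IsCompact K) {γ : Fin M → ℝ≥0∞} {γ₀ C : ℝ≥0∞}
    (hγ₀ : 1 ≤ γ₀) (hγ : ∀ i, γ₀ ≤ γ i) (hC : C ≠ ⊤) :
    ∃ C' : ℝ≥0∞, C' ≠ ⊤ ∧ ∀ ρ : R3 → Fin M → ℝ, StronglyMeasurable ρ → (∀ x ∉ K, ρ x = 0) →
      (∀ i, eLpNorm (fun x => ρ x i) (γ i) ≤ C) →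
      eLpNorm ρ γ₀ ≤ C' ∧ ∀ i, eLpNorm (fun x => ρ x i) γ₀ ≤ C' := by
  have hKv : volume K ≠ ⊤ := hK.measure_lt_top.ne
  set D : Fin M → ℝ≥0∞ := fun i =>
    C * volume K ^ (1 / γ₀.toReal - 1 / (γ i).toReal) with hD
  have hDt : ∀ i, D i ≠ ⊤ := by
    intro i
    refine ENNReal.mul_ne_top hC (ENNReal.rpow_ne_top_of_nonneg ?_ hKv)
    rcases eq_or_ne (γ i) ⊤ with h | h
    · simp [h]
    · have h0 : γ₀ ≠ ⊤ := ne_top_of_le_ne_top h (hγ i)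
      have h1 : 0 < γ₀.toReal := ENNReal.toReal_pos (by rintro rfl; simp at hγ₀) h0
      exact sub_nonneg.2 (one_div_le_one_div_of_le h1 (ENNReal.toReal_mono h (hγ i)))
  refine ⟨∑ i, D i, (ENNReal.sum_lt_top.2 fun i _ => (hDt i).lt_top).ne, fun ρ hρ h0 hle => ?_⟩
  have hi : ∀ i, eLpNorm (fun x => ρ x i) γ₀ ≤ D i := by
    intro i
    have hm : StronglyMeasurable fun x => ρ x i :=
      ((measurable_pi_apply i).comp hρ.measurable).stronglyMeasurable
    have hs : Function.support (fun x => ρ x i) ⊆ K := by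
      intro x hx
      by_contra h
      exact hx (by simp [h0 x h])
    have h1 := eLpNorm_le_eLpNorm_mul_rpow_measure_univ (μ := volume.restrict K) (hγ i)
      hm.aestronglyMeasurable
    rw [eLpNorm_restrict_eq_of_support_subset hs, eLpNorm_restrict_eq_of_support_subset hs,
      Measure.restrict_apply_univ] at h1
    exact h1.trans (mul_le_mul_left (hle i) _)
  refine ⟨(eLpNorm_le_sum_eLpNorm hγ₀ hρ).trans (Finset.sum_le_sum fun i _ => hi i), fun i => ?_⟩
  exact (hi i).trans (Finset.single_le_sum (f := D) (fun _ _ => zero_le) (Finset.mem_univ i))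

end

section

variable {M : ℕ}

namespace MovingDomain

variable {T : ℝ} {A : ℝ → Set R3} {K B : Set R3} {ε₀ : ℝ}

lemma notMem_of_notMem (m : MovingDomain T A K B ε₀) {s : ℝ} {x : R3} (hx : x ∉ K) :
    s ∉ Ioo 0 T ∨ x ∉ A s := by
  by_cases hs : s ∈ Ioo 0 T
  · exact Or.inr fun h => hx (m.subset s (Ioo_subset_Icc_self hs) h)
  · exact Or.inl hs

end MovingDomain

namespace TransportData

variable {T : ℝ} {A : ℝ → Set R3} {K B : Set R3} {ε₀ : ℝ} {γ : Fin M → ℝ≥0∞} {γ₀ p C : ℝ≥0∞}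
  {R : ℝ → R3 → Fin M → ℝ} {U : ℝ → R3 → R3} {DU : ℝ → R3 → R3 →L[ℝ] R3}

lemma density_slice (d : TransportData T A K B γ γ₀ p C R U DU) (s : ℝ) :
    StronglyMeasurable (R s) :=
  d.density_meas.comp_measurable measurable_prodMk_left

lemma velocity_slice (d : TransportData T A K B γ γ₀ p C R U DU) (s : ℝ) :
    StronglyMeasurable (U s) :=
  d.velocity_meas.comp_measurable measurable_prodMk_left

lemma grad_slice (d : TransportData T A K B γ γ₀ p C R U DU) (s : ℝ) :
    StronglyMeasurable (DU s) :=
  d.grad_meas.comp_measurable measurable_prodMk_left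

lemma one_le (d : TransportData T A K B γ γ₀ p C R U DU) : 1 ≤ γ₀ :=
  le_trans (by norm_num) d.two_le

/-- The densities are bounded in `L^{γ'}` for all `γ' ≤ γ₀`, uniformly in time. -/
lemma exists_bound (m : MovingDomain T A K B ε₀) (d : TransportData T A K B γ γ₀ p C R U DU)
    {γ' : ℝ≥0∞} (h1 : 1 ≤ γ') (h2 : γ' ≤ γ₀) :
    ∃ C' : ℝ≥0∞, C' ≠ ⊤ ∧ ∀ᵐ s ∂(volume.restrict (Ioo 0 T)), eLpNorm (R s) γ' ≤ C' ∧
      ∀ i, eLpNorm (fun x => R s x i) γ' ≤ C' := by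
  obtain ⟨C', hC', h⟩ := exists_eLpNorm_le m.isCompact h1 (fun i => h2.trans (d.le_exponent i))
    d.bound_ne_top
  refine ⟨C', hC', d.density_le.mono fun s hs => ?_⟩
  exact h (R s) (d.density_slice s) (fun x hx => d.density_zero s x (m.notMem_of_notMem hx)) hs

lemma measurable_lintegral_mul (d : TransportData T A K B γ γ₀ p C R U DU) :
    Measurable fun s => ∫⁻ y, ‖R s y‖ₑ * ‖U s y‖ₑ :=
  (d.density_meas.enorm.mul d.velocity_meas.enorm).lintegral_prod_right'

lemma lintegral_mul_lt_top (m : MovingDomain T A K B ε₀) [γ₀.HolderConjugate p]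
    (d : TransportData T A K B γ γ₀ p C R U DU) :
    ∫⁻ s in Ioo 0 T, ∫⁻ y, ‖R s y‖ₑ * ‖U s y‖ₑ < ⊤ := by
  obtain ⟨C', hC', h⟩ := d.exists_bound m d.one_le le_rfl
  have hle : ∀ᵐ s ∂(volume.restrict (Ioo 0 T)), ∫⁻ y, ‖R s y‖ₑ * ‖U s y‖ₑ ≤
      C' * (eLpNorm (U s) p + eLpNorm (DU s) p) := by
    filter_upwards [h] with s hs
    have h1 : ∫⁻ y, ‖R s y‖ₑ * ‖U s y‖ₑ ≤ eLpNorm (R s) γ₀ * eLpNorm (U s) p :=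
      lintegral_enorm_mul_enorm_le (d.density_slice s).aestronglyMeasurable
        (d.velocity_slice s).aestronglyMeasurable
    exact h1.trans (mul_le_mul' hs.1 le_self_add)
  refine (lintegral_mono_ae hle).trans_lt ?_
  rw [lintegral_const_mul' _ _ hC']
  exact ENNReal.mul_lt_top hC'.lt_top d.lintegral_lt_top

lemma ae_lintegral_mul_lt_top (m : MovingDomain T A K B ε₀) [γ₀.HolderConjugate p]
    (d : TransportData T A K B γ γ₀ p C R U DU) :
    ∀ᵐ s ∂(volume.restrict (Ioo 0 T)), ∫⁻ y, ‖R s y‖ₑ * ‖U s y‖ₑ < ⊤ :=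
  ae_lt_top d.measurable_lintegral_mul (d.lintegral_mul_lt_top m).ne

/-- The flux has a bound that is uniform in space and integrable in time. -/
lemma exists_flux_bound (m : MovingDomain T A K B ε₀) [γ₀.HolderConjugate p]
    (d : TransportData T A K B γ γ₀ p C R U DU) {ε : ℝ} (hε : 0 < ε) :
    ∃ g : ℝ → ℝ, IntegrableOn g (Ioo 0 T) ∧ (∀ s, 0 ≤ g s) ∧
      ∀ᵐ s ∂(volume.restrict (Ioo 0 T)), ∀ x, ‖flux ε (U s) (R s) x‖ ≤ g s := by
  obtain ⟨C, hC⟩ := exists_bound_fderiv_mollKernel hε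
  refine ⟨fun s => (ENNReal.ofReal C * ∫⁻ y, ‖R s y‖ₑ * ‖U s y‖ₑ).toReal, ?_,
    fun s => ENNReal.toReal_nonneg, ?_⟩
  · refine integrable_toReal_of_lintegral_ne_top
      (d.measurable_lintegral_mul.const_mul _).aemeasurable ?_
    rw [lintegral_const_mul _ d.measurable_lintegral_mul]
    exact (ENNReal.mul_lt_top (by simp) (d.lintegral_mul_lt_top m)).ne
  · filter_upwards [d.ae_lintegral_mul_lt_top m] with s hs x
    have h := enorm_flux_le hC (d.velocity_slice s) (d.density_slice s) x
    rw [← toReal_enorm]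
    exact ENNReal.toReal_mono (ENNReal.mul_lt_top (by simp) hs).ne h

lemma integrableOn_flux (m : MovingDomain T A K B ε₀) [γ₀.HolderConjugate p]
    (d : TransportData T A K B γ γ₀ p C R U DU) {ε : ℝ} (hε : 0 < ε) (x : R3) :
    IntegrableOn (fun s => flux ε (U s) (R s) x) (Ioo 0 T) := by
  obtain ⟨g, hg, -, h⟩ := d.exists_flux_bound m hε
  refine Integrable.mono' hg ?_ (h.mono fun s hs => hs x)
  exact ((stronglyMeasurable_flux_prod ε d.density_meas d.velocity_meas).comp_measurable
    measurable_prodMk_right).aestronglyMeasurable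

/-- Mollified densities are uniformly bounded. -/
lemma exists_moll_bound (m : MovingDomain T A K B ε₀)
    (d : TransportData T A K B γ γ₀ p C R U DU) {ε : ℝ} (hε : 0 < ε) :
    ∃ D : ℝ, ∀ᵐ s ∂(volume.restrict (Ioo 0 T)), Integrable (R s) ∧ ∀ x, ‖moll ε (R s) x‖ ≤ D := by
  obtain ⟨C', hC', h⟩ := d.exists_bound m le_rfl d.one_le
  obtain ⟨k, hk⟩ := exists_bound_mollKernel hε
  refine ⟨(ENNReal.ofReal k * C').toReal, h.mono fun s hs => ?_⟩
  refine ⟨memLp_one_iff_integrable.1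
    ⟨(d.density_slice s).aestronglyMeasurable, hs.1.trans_lt hC'.lt_top⟩, fun x => ?_⟩
  rw [← toReal_enorm]
  refine ENNReal.toReal_mono (ENNReal.mul_ne_top (by simp) hC') ?_
  refine (enorm_integral_le_lintegral_enorm _).trans ?_
  calc ∫⁻ y, ‖mollKernel ε (x - y) • R s y‖ₑ ≤ ∫⁻ y, ENNReal.ofReal k * ‖R s y‖ₑ := by
        refine lintegral_mono fun y => ?_
        rw [enorm_smul]
        gcongr
        rw [← ofReal_norm]
        exact ENNReal.ofReal_le_ofReal (hk _)
    _ = ENNReal.ofReal k * eLpNorm (R s) 1 := by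
        rw [lintegral_const_mul _ (d.density_slice s).enorm, eLpNorm_one_eq_lintegral_enorm]
    _ ≤ _ := by gcongr; exact hs.1

/-- The mollified continuity equation in weak form, at a point `x`: the test function is the
product of a function of time and of the kernel centred at `x`. -/
lemma integral_deriv_mul_moll (m : MovingDomain T A K B ε₀) [γ₀.HolderConjugate p]
    (d : TransportData T A K B γ γ₀ p C R U DU) {ε : ℝ} (hε : 0 < ε) (x : R3) (i : Fin M)
    {ψ : ℝ → ℝ} (hψ : ContDiff ℝ ∞ ψ) (hψs : HasCompactSupport ψ) (hψt : tsupport ψ ⊆ Ioo 0 T) :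
    ∫ s in Ioo 0 T, (deriv ψ s * moll ε (R s) x i + ψ s * -flux ε (U s) (R s) x i) = 0 := by
  set ϕ : ℝ × R3 → ℝ := fun z => ψ z.1 * mollKernel ε (x - z.2) with hϕ
  have hϕc : ContDiff ℝ ∞ ϕ := (hψ.comp contDiff_fst).mul
    ((mollKernel_contDiff ε).comp (contDiff_const.sub contDiff_snd))
  have hsub : Function.support ϕ ⊆ tsupport ψ ×ˢ Metric.closedBall x ε := by
    intro z hz
    rw [Function.mem_support] at hz
    refine ⟨subset_tsupport _ (left_ne_zero_of_mul hz), ?_⟩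
    rw [mem_closedBall_iff_norm']
    by_contra hlt
    exact right_ne_zero_of_mul hz (mollKernel_eq_zero hε (not_le.1 hlt).le)
  have hcomp : IsCompact (tsupport ψ ×ˢ Metric.closedBall x ε) :=
    hψs.isCompact.prod (isCompact_closedBall x ε)
  have hϕt : tsupport ϕ ⊆ Ioo (0 : ℝ) T ×ˢ univ :=
    (closure_minimal hsub hcomp.isClosed).trans (prod_mono hψt (subset_univ _))
  have h := d.continuity i ϕ hϕc (HasCompactSupport.of_support_subset_isCompact hcomp hsub) hϕt
  refine Eq.trans (integral_congr_ae ?_) h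
  obtain ⟨D, hD⟩ := d.exists_moll_bound m hε
  filter_upwards [hD, d.ae_lintegral_mul_lt_top m] with s hs hs'
  have hfd : ∀ y, HasFDerivAt ϕ (ψ s • ((fderiv ℝ (mollKernel ε) (x - y)).comp
      (-ContinuousLinearMap.snd ℝ ℝ R3)) + mollKernel ε (x - y) •
      (deriv ψ s • ContinuousLinearMap.fst ℝ ℝ R3)) (s, y) := by
    intro y
    have e1 : HasFDerivAt (fun z : ℝ × R3 => ψ z.1) (deriv ψ s • ContinuousLinearMap.fst ℝ ℝ R3)
        (s, y) :=
      HasDerivAt.comp_hasFDerivAt (f := fun z : ℝ × R3 => z.1) (s, y)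
        ((hψ.differentiable (by simp)) s).hasDerivAt hasFDerivAt_fst
    have e2 : HasFDerivAt (fun z : ℝ × R3 => x - z.2) (-ContinuousLinearMap.snd ℝ ℝ R3) (s, y) :=
      hasFDerivAt_snd.const_sub x
    have e3 : HasFDerivAt (fun z : ℝ × R3 => mollKernel ε (x - z.2))
        ((fderiv ℝ (mollKernel ε) (x - y)).comp (-ContinuousLinearMap.snd ℝ ℝ R3)) (s, y) :=
      HasFDerivAt.comp (g := mollKernel ε) (f := fun z : ℝ × R3 => x - z.2) (s, y)
        (mollKernel_differentiable ε (x - y)).hasFDerivAt e2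
    exact e1.mul e3
  -- the sign comes from the derivative of `y ↦ k_ε(x - y)`
  have htr : ∀ y, transport U ϕ s y =
      deriv ψ s * mollKernel ε (x - y) - ψ s * fderiv ℝ (mollKernel ε) (x - y) (U s y) := by
    intro y
    rw [transport, (hfd y).fderiv]
    simp
    ring
  have hli := hs.1.locallyIntegrable
  have i1 := integrable_mollKernel_smul hε hli x
  have i2 := integrable_flux_integrand hε (d.velocity_slice s) (d.density_slice s) hs' x
  have p1 := (ContinuousLinearMap.proj (R := ℝ) (φ := fun _ : Fin M => ℝ) i).integral_comp_comm i1
  have p2 := (ContinuousLinearMap.proj (R := ℝ) (φ := fun _ : Fin M => ℝ) i).integral_comp_comm i2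
  have j1 := (ContinuousLinearMap.proj (R := ℝ) (φ := fun _ : Fin M => ℝ) i).integrable_comp i1
  have j2 := (ContinuousLinearMap.proj (R := ℝ) (φ := fun _ : Fin M => ℝ) i).integrable_comp i2
  simp only [ContinuousLinearMap.proj_apply, Pi.smul_apply, smul_eq_mul] at p1 p2 j1 j2
  rw [moll, flux, ← p1, ← p2, mul_neg, ← sub_eq_add_neg, ← integral_const_mul,
    ← integral_const_mul, ← integral_sub (j1.const_mul _) (j2.const_mul _)]
  refine integral_congr_ae (Eventually.of_forall fun y => ?_)
  simp only [htr]
  ring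

end TransportData

end

section

variable {M : ℕ}

lemma moll_apply {ε : ℝ} (hε : 0 < ε) {ρ : R3 → Fin M → ℝ} (hρ : LocallyIntegrable ρ) (x : R3)
    (i : Fin M) : moll ε ρ x i = ∫ y, mollKernel ε (x - y) * ρ y i := by
  have h := (ContinuousLinearMap.proj (R := ℝ) (φ := fun _ : Fin M => ℝ) i).integral_comp_comm
    (integrable_mollKernel_smul hε hρ x)
  simp only [ContinuousLinearMap.proj_apply, Pi.smul_apply, smul_eq_mul] at h
  rw [moll, ← h]

/-! ### Closed convex subsets of `L²` -/

lemma isClosed_setOf_eLpNorm_le (γ C : ℝ≥0∞) (V : Set R3) :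
    IsClosed {f : Lp ℝ 2 (volume : Measure R3) | eLpNorm f γ (volume.restrict V) ≤ C} := by
  refine IsSeqClosed.isClosed fun f g hf hfg => ?_
  obtain ⟨φ, -, hφ⟩ := (tendstoInMeasure_of_tendsto_Lp hfg).exists_seq_tendsto_ae
  refine (Lp.eLpNorm_lim_le_liminf_eLpNorm (fun n => (Lp.aestronglyMeasurable (f (φ n))).restrict)
    g (ae_restrict_of_ae hφ)).trans ?_
  refine (liminf_le_liminf (Eventually.of_forall fun n => hf (φ n))).trans ?_
  simp

lemma convex_setOf_eLpNorm_le {γ : ℝ≥0∞} (hγ : 1 ≤ γ) (C : ℝ≥0∞) (V : Set R3) :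
    Convex ℝ {f : Lp ℝ 2 (volume : Measure R3) | eLpNorm f γ (volume.restrict V) ≤ C} := by
  intro f hf g hg a b ha hb hab
  have e : (↑(a • f + b • g) : R3 → ℝ) =ᵐ[volume.restrict V] a • ⇑f + b • ⇑g := by
    refine ae_restrict_of_ae ?_
    filter_upwards [Lp.coeFn_add (a • f) (b • g), Lp.coeFn_smul a f, Lp.coeFn_smul b g]
      with x h1 h2 h3
    rw [h1, Pi.add_apply, Pi.add_apply, h2, h3]
  rw [mem_ofPred_eq, eLpNorm_congr_ae e]
  have mf := (Lp.aestronglyMeasurable f).restrict (s := V)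
  have mg := (Lp.aestronglyMeasurable g).restrict (s := V)
  refine (eLpNorm_add_le (mf.const_smul a) (mg.const_smul b) hγ).trans ?_
  rw [eLpNorm_const_smul, eLpNorm_const_smul]
  calc ‖a‖ₑ * eLpNorm f γ (volume.restrict V) + ‖b‖ₑ * eLpNorm g γ (volume.restrict V)
      ≤ ‖a‖ₑ * C + ‖b‖ₑ * C := add_le_add (mul_le_mul_right hf _) (mul_le_mul_right hg _)
    _ = C := by
        rw [← add_mul, Real.enorm_of_nonneg ha, Real.enorm_of_nonneg hb,
          ← ENNReal.ofReal_add ha hb, hab, ENNReal.ofReal_one, one_mul]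

namespace TransportData

variable {T : ℝ} {A : ℝ → Set R3} {K B : Set R3} {ε₀ : ℝ} {γ : Fin M → ℝ≥0∞} {γ₀ p C : ℝ≥0∞}
  {R : ℝ → R3 → Fin M → ℝ} {U : ℝ → R3 → R3} {DU : ℝ → R3 → R3 →L[ℝ] R3}

/-- The time integrals of the mollified fluxes are continuous in space. -/
lemma continuous_integral_flux (m : MovingDomain T A K B ε₀) [γ₀.HolderConjugate p]
    (d : TransportData T A K B γ γ₀ p C R U DU) {ε : ℝ} (hε : 0 < ε) {s : ℝ} (hs : s ∈ Icc 0 T) :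
    Continuous fun x => ∫ τ in (0 : ℝ)..s, flux ε (U τ) (R τ) x := by
  obtain ⟨g, hg, -, hgb⟩ := d.exists_flux_bound m hε
  have hle : ∀ {P : ℝ → Prop}, (∀ᵐ τ ∂(volume.restrict (Ioo 0 T)), P τ) →
      ∀ᵐ τ ∂(volume.restrict (Ioc 0 s)), P τ := by
    intro P hP
    rw [restrict_Ioo_eq_restrict_Ioc] at hP
    exact ae_restrict_of_ae_restrict_of_subset (Ioc_subset_Ioc_right hs.2) hP
  have hg' : IntegrableOn g (Ioc 0 s) := by
    rw [integrableOn_Ioc_iff_integrableOn_Ioo]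
    exact hg.mono_set (Ioo_subset_Ioo_right hs.2)
  simp only [intervalIntegral.integral_of_le hs.1]
  refine continuous_of_dominated (bound := g) (fun x => ?_) (fun x => ?_) hg' ?_
  · exact ((stronglyMeasurable_flux_prod ε d.density_meas d.velocity_meas).comp_measurable
      measurable_prodMk_right).aestronglyMeasurable
  · exact (hle hgb).mono fun τ hτ => hτ x
  · exact (hle (d.ae_lintegral_mul_lt_top m)).mono fun τ hτ =>
      continuous_flux hε (d.velocity_slice τ) (d.density_slice τ) hτ

/-- The mollified densities are primitives of the fluxes, at almost every time and everywhere in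
space. -/
lemma exists_moll_eq_primitive (m : MovingDomain T A K B ε₀) [γ₀.HolderConjugate p]
    (d : TransportData T A K B γ γ₀ p C R U DU) {ε : ℝ} (hε : 0 < ε) :
    ∃ c : R3 → Fin M → ℝ, ∀ᵐ s ∂(volume.restrict (Ioo 0 T)), ∀ x,
      moll ε (R s) x = c x - ∫ τ in (0 : ℝ)..s, flux ε (U τ) (R τ) x := by
  obtain ⟨D, hD⟩ := d.exists_moll_bound m hε
  have hpt : ∀ x, ∃ c : Fin M → ℝ, ∀ᵐ s ∂(volume.restrict (Ioo 0 T)),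
      moll ε (R s) x = c - ∫ τ in (0 : ℝ)..s, flux ε (U τ) (R τ) x := by
    intro x
    have hfl := d.integrableOn_flux m hε x
    have hi : ∀ i, ∃ c : ℝ, ∀ᵐ s ∂(volume.restrict (Ioo 0 T)), moll ε (R s) x i =
        c + ∫ τ in (0 : ℝ)..s, -flux ε (U τ) (R τ) x i := by
      intro i
      refine ae_eq_primitive_of_weak_deriv m.pos ?_ ?_ fun ψ h1 h2 h3 =>
        d.integral_deriv_mul_moll m hε x i h1 h2 h3
      · refine Integrable.mono' (integrable_const D) ?_
          (hD.mono fun s hs => (norm_le_pi_norm _ i).trans (hs.2 x))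
        exact ((measurable_pi_apply i).comp
          ((stronglyMeasurable_moll_prod ε d.density_meas).comp_measurable
            measurable_prodMk_right).measurable).aestronglyMeasurable
      · exact (hfl.eval i).neg
    choose c hc using hi
    refine ⟨c, ?_⟩
    filter_upwards [ae_all_iff.2 hc, ae_restrict_mem measurableSet_Ioo] with s hs hsT
    funext i
    have hI : IntervalIntegrable (fun τ => flux ε (U τ) (R τ) x) volume 0 s := by
      rw [intervalIntegrable_iff_integrableOn_Ioo_of_le hsT.1.le]
      exact hfl.mono_set (Ioo_subset_Ioo_right hsT.2.le)
    have h1 := (ContinuousLinearMap.proj (R := ℝ)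
      (φ := fun _ : Fin M => ℝ) i).intervalIntegral_comp_comm hI
    simp only [ContinuousLinearMap.proj_apply] at h1
    rw [hs i, intervalIntegral.integral_neg, Pi.sub_apply, ← h1, sub_eq_add_neg]
  choose c hc using hpt
  -- the equation holds on a countable dense set of points, and extends by continuity
  have hgood : ∀ᵐ s ∂(volume.restrict (Ioo 0 T)), s ∈ Ioo 0 T ∧ Continuous (moll ε (R s)) ∧
      ∀ n, moll ε (R s) (TopologicalSpace.denseSeq R3 n) = c (TopologicalSpace.denseSeq R3 n) -
        ∫ τ in (0 : ℝ)..s, flux ε (U τ) (R τ) (TopologicalSpace.denseSeq R3 n) := by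
    filter_upwards [hD, ae_all_iff.2 fun n => hc (TopologicalSpace.denseSeq R3 n),
      ae_restrict_mem measurableSet_Ioo] with s h1 h2 h3
    exact ⟨h3, (moll_contDiff hε h1.1.locallyIntegrable).continuous, h2⟩
  -- the constant of integration is continuous in space, as it can be read off at a good time
  have hne : (ae (volume.restrict (Ioo 0 T))).NeBot := by
    rw [ae_neBot, Ne, Measure.restrict_eq_zero, Real.volume_Ioo]
    simpa using m.pos
  obtain ⟨s₀, hs₀, hs₀c, hs₀e⟩ := hgood.exists
  refine ⟨fun x => moll ε (R s₀) x + ∫ τ in (0 : ℝ)..s₀, flux ε (U τ) (R τ) x,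
    hgood.mono fun s hs => ?_⟩
  have h0 := d.continuous_integral_flux m hε (Ioo_subset_Icc_self hs₀)
  have h1 := d.continuous_integral_flux m hε (Ioo_subset_Icc_self hs.1)
  refine fun x => congrFun ((TopologicalSpace.denseRange_denseSeq R3).equalizer hs.2.1
    ((hs₀c.add h0).sub h1) (funext fun n => ?_)) x
  simp only [Function.comp_apply, Pi.sub_apply, Pi.add_apply]
  rw [hs.2.2 n, hs₀e n]
  abel

end TransportData

end

section

variable {M : ℕ}

/-! ### The representative at every time -/

lemma memLp_two_mollKernel {ε : ℝ} (hε : 0 < ε) (x : R3) :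
    MemLp (fun y => mollKernel ε (x - y)) 2 (volume : Measure R3) := by
  refine Continuous.memLp_of_hasCompactSupport
    ((mollKernel_continuous ε).comp (continuous_const.sub continuous_id)) ?_
  exact (hasCompactSupport_mollKernel hε).comp_homeomorph (Homeomorph.subLeft x)

lemma convex_Ici_zero_lp : Convex ℝ (Ici (0 : Lp ℝ 2 (volume : Measure R3))) := by
  intro f hf g hg a b ha hb _
  rw [mem_Ici, ← Lp.coeFn_nonneg] at hf hg ⊢
  filter_upwards [Lp.coeFn_add (a • f) (b • g), Lp.coeFn_smul a f, Lp.coeFn_smul b g, hf, hg]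
    with x h1 h2 h3 h4 h5
  rw [h1, Pi.add_apply, h2, h3]
  exact add_nonneg (mul_nonneg ha h4) (mul_nonneg hb h5)

/-- If the mollifications of a family of densities converge pointwise along a filter, while the
densities stay in a bounded part of `L^γ` and vanish locally on the complement of a set `A`, then
the limits are the mollifications of a density with the same bounds that vanishes outside of
`A`. -/
lemma exists_density_of_tendsto_moll {F : Filter ℝ} [F.NeBot] {K A : Set R3} (hK : IsCompact K)
    (hAK : A ⊆ K) (hA : MeasurableSet A)
    {γ : Fin M → ℝ≥0∞} (hγ : ∀ i, 2 ≤ γ i) {C : ℝ≥0∞} (hC : C ≠ ⊤) {R : ℝ → R3 → Fin M → ℝ}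
    (hR : ∀ s, StronglyMeasurable (R s)) (hR0 : ∀ s x, R s x ∈ orthant M)
    (hRK : ∀ s, ∀ x ∉ K, R s x = 0)
    (hRC : ∀ᶠ s in F, ∀ i, eLpNorm (fun x => R s x i) (γ i) ≤ C)
    (hext : ∀ᵐ x : R3, x ∉ A → ∃ V ∈ 𝓝 x, ∀ᶠ s in F, ∀ y ∈ V, R s y = 0)
    {ε : ℕ → ℝ} (hε : ∀ n, 0 < ε n) {P : ℕ → R3 → Fin M → ℝ}
    (hP : ∀ n x, Tendsto (fun s => moll (ε n) (R s) x) F (𝓝 (P n x))) :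
    ∃ ρ : R3 → Fin M → ℝ, StronglyMeasurable ρ ∧ (∀ x, ρ x ∈ orthant M) ∧ (∀ x ∉ A, ρ x = 0) ∧
      (∀ i, eLpNorm (fun x => ρ x i) (γ i) ≤ C) ∧ ∀ n x, moll (ε n) ρ x = P n x := by
  obtain ⟨C', hC', hb⟩ := exists_eLpNorm_le hK (γ := γ) one_le_two hγ hC
  have hRi : ∀ s i, StronglyMeasurable fun x => R s x i := fun s i =>
    ((measurable_pi_apply i).comp (hR s).measurable).stronglyMeasurable
  have hmem : ∀ᶠ s in F, ∀ i, MemLp (fun x => R s x i) 2 ∧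
      eLpNorm (fun x => R s x i) 2 ≤ C' := by
    filter_upwards [hRC] with s hs i
    have h := (hb (R s) (hR s) (hRK s) hs).2 i
    exact ⟨⟨(hRi s i).aestronglyMeasurable, h.trans_lt hC'.lt_top⟩, h⟩
  classical
  set f : Fin M → ℝ → Lp ℝ 2 (volume : Measure R3) := fun i s =>
    if h : MemLp (fun x => R s x i) 2 then h.toLp else 0 with hf
  have hfe : ∀ᶠ s in F, ∀ i, ⇑(f i s) =ᵐ[volume] fun x => R s x i := by
    filter_upwards [hmem] with s hs i
    simp only [hf, dif_pos (hs i).1]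
    exact MemLp.coeFn_toLp _
  have hfb : ∀ i, ∀ᶠ s in F, ‖f i s‖ ≤ C'.toReal := by
    intro i
    filter_upwards [hmem, hfe] with s hs hs'
    rw [Lp.norm_def, eLpNorm_congr_ae (hs' i)]
    exact ENNReal.toReal_mono hC' (hs i).2
  choose W hW using fun i => exists_weak_limit (hfb i)
  -- the four properties of the weak limits
  have hW0 : ∀ i, ∀ᵐ x, 0 ≤ W i x := by
    intro i
    have h := hW i (Ici 0) isClosed_Ici convex_Ici_zero_lp (by
      filter_upwards [hfe] with s hs
      rw [mem_Ici, ← Lp.coeFn_nonneg]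
      filter_upwards [hs i] with x hx
      rw [hx]
      exact hR0 s x i)
    exact (Lp.coeFn_nonneg _).2 h
  have hWC : ∀ i, eLpNorm (W i) (γ i) ≤ C := by
    intro i
    have h := hW i _ (isClosed_setOf_eLpNorm_le (γ i) C univ)
      (convex_setOf_eLpNorm_le (le_trans one_le_two (hγ i)) C univ) (by
      filter_upwards [hfe, hRC] with s hs hs'
      rw [Measure.restrict_univ, eLpNorm_congr_ae (hs i)]
      exact hs' i)
    rwa [mem_ofPred_eq, Measure.restrict_univ] at h
  -- locally off `A` the functions are eventually in the closed convex set of those vanishing there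
  have hWA : ∀ i, ∀ᵐ x, x ∉ A → W i x = 0 := by
    intro i
    have hloc : ∀ x : R3, (∃ V ∈ 𝓝 x, ∀ᶠ s in F, ∀ y ∈ V, R s y = 0) →
        ∃ V ∈ 𝓝 x, ∀ᵐ y, y ∈ V → W i y = 0 := by
      rintro x ⟨V, hV, hev⟩
      refine ⟨interior V, interior_mem_nhds.2 hV, ?_⟩
      have h := hW i _ (isClosed_setOf_eLpNorm_le 1 0 (interior V))
        (convex_setOf_eLpNorm_le le_rfl 0 (interior V)) (by
        filter_upwards [hfe, hev] with s hs hs'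
        rw [eLpNorm_congr_ae (ae_restrict_of_ae (hs i)), nonpos_iff_eq_zero,
          eLpNorm_eq_zero_iff (hRi s i).aestronglyMeasurable one_ne_zero]
        filter_upwards [ae_restrict_mem isOpen_interior.measurableSet] with y hy
        rw [hs' y (interior_subset hy)]
        rfl)
      rw [mem_ofPred_eq, nonpos_iff_eq_zero, eLpNorm_eq_zero_iff
        (Lp.aestronglyMeasurable _).restrict one_ne_zero] at h
      exact (ae_restrict_iff' isOpen_interior.measurableSet).1 h
    set E : Set R3 := {x | (∃ V ∈ 𝓝 x, ∀ᶠ s in F, ∀ y ∈ V, R s y = 0) ∧ W i x ≠ 0} with hE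
    have hE0 : volume E = 0 := by
      refine measure_null_of_locally_null E fun x hx => ?_
      obtain ⟨V, hV, hVe⟩ := hloc x hx.1
      refine ⟨V ∩ E, inter_mem (mem_nhdsWithin_of_mem_nhds hV) self_mem_nhdsWithin, ?_⟩
      refine measure_mono_null (fun y hy => ?_) (ae_iff.1 hVe)
      exact fun h => hy.2.2 (h hy.1)
    filter_upwards [hext, measure_eq_zero_iff_ae_notMem.1 hE0] with x hx hxE hxA
    by_contra hne
    exact hxE ⟨hx hxA, hne⟩
  -- pairings with the mollifying kernel pass to the weak limit
  have hWm : ∀ i n x, ∫ y, mollKernel (ε n) (x - y) * W i y = P n x i := by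
    intro i n x
    set κ := (memLp_two_mollKernel (hε n) x).toLp _ with hκ
    have hin : ∀ g : Lp ℝ 2 (volume : Measure R3),
        inner ℝ κ g = ∫ y, mollKernel (ε n) (x - y) * g y := by
      intro g
      rw [L2.inner_def]
      refine integral_congr_ae ?_
      filter_upwards [(memLp_two_mollKernel (hε n) x).coeFn_toLp] with y hy
      rw [hκ, hy]
      simp [mul_comm]
    rw [← hin]
    refine eq_of_forall_dist_le fun δ hδ => ?_
    have h := hW i ((innerSL ℝ κ) ⁻¹' Metric.closedBall (P n x i) δ)
      (Metric.isClosed_closedBall.preimage (innerSL ℝ κ).continuous)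
      ((convex_closedBall (P n x i) δ).linear_preimage (innerSL ℝ κ).toLinearMap) (by
      have hev := (tendsto_pi_nhds.1 (hP n x) i).eventually (Metric.closedBall_mem_nhds _ hδ)
      filter_upwards [hev, hfe, hmem] with s hs hs' hs''
      rw [mem_preimage, innerSL_apply_apply, hin]
      have hint : LocallyIntegrable (R s) := by
        refine (Integrable.of_eval fun j => ?_).locallyIntegrable
        exact integrable_of_memLp_of_isCompact one_le_two hK
          (fun y hy => by rw [hRK s y hy]; rfl) (hs'' j).1
      rw [moll_apply (hε n) hint] at hs
      rw [Metric.mem_closedBall]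
      refine (congrArg (fun a => dist a (P n x i)) ?_).trans_le hs
      refine integral_congr_ae ?_
      filter_upwards [hs' i] with y hy
      rw [hy])
    exact h
  refine ⟨fun x i => A.indicator (fun x => max 0 (W i x)) x, ?_, ?_, ?_, ?_, ?_⟩
  · refine (measurable_pi_lambda _ fun i => ?_).stronglyMeasurable
    exact (measurable_const.max (Lp.stronglyMeasurable (W i)).measurable).indicator hA
  · exact fun x i => indicator_nonneg (fun y _ => le_max_left _ _) x
  · intro x hx
    funext i
    simp [hx]
  all_goals
    have hae : ∀ i, (fun x => A.indicator (fun x => max 0 (W i x)) x) =ᵐ[volume] W i := by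
      intro i
      filter_upwards [hW0 i, hWA i] with x h1 h2
      by_cases hx : x ∈ A
      · rw [indicator_of_mem hx, max_eq_right h1]
      · rw [indicator_of_notMem hx, h2 hx]
  · intro i
    rw [eLpNorm_congr_ae (hae i)]
    exact hWC i
  · intro n x
    funext i
    have hint : LocallyIntegrable fun x i => A.indicator (fun x => max 0 (W i x)) x := by
      refine (Integrable.of_eval fun j => ?_).locallyIntegrable
      refine integrable_of_memLp_of_isCompact one_le_two hK (fun y hy => ?_)
        ((memLp_congr_ae (hae j)).2 (Lp.memLp (W j)))
      exact indicator_of_notMem (fun h => hy (hAK h)) _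
    rw [moll_apply (hε n) hint, ← hWm i n x]
    refine integral_congr_ae ?_
    filter_upwards [hae i] with y hy
    rw [hy]

end

section

variable {M : ℕ}

namespace TransportData

variable {T : ℝ} {A : ℝ → Set R3} {K B : Set R3} {ε₀ : ℝ} {γ : Fin M → ℝ≥0∞} {γ₀ p C : ℝ≥0∞}
  {R : ℝ → R3 → Fin M → ℝ} {U : ℝ → R3 → R3} {DU : ℝ → R3 → R3 →L[ℝ] R3}

/-- The densities have a representative that is defined at every time of the closed interval and
whose mollifications are primitives of the fluxes. At an exceptional time `t` it is a weak limit of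
the densities at good times; as the mollifications converge, it does not depend on the choice of the
limit point. -/
lemma exists_representative (m : MovingDomain T A K B ε₀) [γ₀.HolderConjugate p]
    (d : TransportData T A K B γ γ₀ p C R U DU) {ε : ℕ → ℝ} (hε : ∀ n, 0 < ε n) :
    ∃ (c : ℕ → R3 → Fin M → ℝ) (r : ℝ → R3 → Fin M → ℝ),
      (∀ᵐ s ∂(volume.restrict (Ioo 0 T)), r s = R s) ∧
      ∀ t ∈ Icc 0 T, StronglyMeasurable (r t) ∧ (∀ x, r t x ∈ orthant M) ∧
        (∀ x ∉ A t, r t x = 0) ∧ (∀ i, eLpNorm (fun x => r t x i) (γ i) ≤ C) ∧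
        ∀ n x, moll (ε n) (r t) x = c n x - ∫ τ in (0 : ℝ)..t, flux (ε n) (U τ) (R τ) x := by
  choose c hc using fun n => d.exists_moll_eq_primitive m (hε n)
  -- the times at which the given densities already have all the required properties
  set G : Set ℝ := {s | s ∈ Ioo 0 T ∧ (∀ i, eLpNorm (fun x => R s x i) (γ i) ≤ C) ∧
    ∀ n x, moll (ε n) (R s) x = c n x - ∫ τ in (0 : ℝ)..s, flux (ε n) (U τ) (R τ) x} with hG
  have hGae : ∀ᵐ s ∂(volume.restrict (Ioo 0 T)), s ∈ G := by
    filter_upwards [ae_restrict_mem measurableSet_Ioo, d.density_le, ae_all_iff.2 hc]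
      with s h1 h2 h3
    exact ⟨h1, h2, h3⟩
  have hGsub : G ⊆ Icc 0 T := fun s hs => Ioo_subset_Icc_self hs.1
  -- a set of full measure is dense
  have hGcl : Icc 0 T ⊆ closure G := by
    rw [← closure_Ioo m.pos.ne]
    refine closure_minimal (fun s hs => ?_) isClosed_closure
    rw [mem_closure_iff]
    intro V hV hsV
    by_contra hne
    rw [not_nonempty_iff_eq_empty] at hne
    have hpos : 0 < volume (V ∩ Ioo 0 T) := (hV.inter isOpen_Ioo).measure_pos _ ⟨s, hsV, hs⟩
    have h0 : volume (V ∩ Ioo 0 T) = 0 := by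
      rw [ae_restrict_iff' measurableSet_Ioo] at hGae
      refine measure_mono_null (fun τ hτ => ?_) (ae_iff.1 hGae)
      intro h
      have : τ ∈ V ∩ G := ⟨hτ.1, h hτ.2⟩
      rw [hne] at this
      exact this
    exact hpos.ne' h0
  have key : ∀ t, ∃ ρ : R3 → Fin M → ℝ, (t ∈ G → ρ = R t) ∧ (t ∈ Icc 0 T →
      StronglyMeasurable ρ ∧ (∀ x, ρ x ∈ orthant M) ∧
        (∀ x ∉ A t, ρ x = 0) ∧ (∀ i, eLpNorm (fun x => ρ x i) (γ i) ≤ C) ∧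
        ∀ n x, moll (ε n) ρ x = c n x - ∫ τ in (0 : ℝ)..t, flux (ε n) (U τ) (R τ) x) := by
    intro t
    -- at good times the given densities are kept, to ensure `r s = R s` for almost every `s`
    by_cases htG : t ∈ G
    · exact ⟨R t, fun _ => rfl, fun _ => ⟨d.density_slice t, d.density_mem t,
        fun x hx => d.density_zero t x (Or.inr hx), htG.2.1, htG.2.2⟩⟩
    by_cases ht : t ∈ Icc 0 T
    swap
    · exact ⟨0, fun h => absurd h htG, fun h => absurd h ht⟩
    have hne : (𝓝[G] t).NeBot := mem_closure_iff_nhdsWithin_neBot.1 (hGcl ht)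
    obtain ⟨ρ, hρ⟩ := exists_density_of_tendsto_moll (F := 𝓝[G] t) m.isCompact (m.subset t ht)
      (m.measurableSet t ht) (fun i => d.two_le.trans (d.le_exponent i)) d.bound_ne_top
      d.density_slice d.density_mem
      (fun s x hx => d.density_zero s x (m.notMem_of_notMem hx))
      (eventually_mem_nhdsWithin.mono fun s hs => hs.2.1)
      ((m.exterior t ht).mono fun x hx hxA => by
        have h := hx hxA
        rw [nhdsWithin_prod_eq, nhdsWithin_univ, eventually_prod_iff] at h
        obtain ⟨pa, hpa, pb, hpb, hp⟩ := h
        refine ⟨{y | pb y}, hpb, ?_⟩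
        filter_upwards [nhdsWithin_mono t hGsub hpa] with s hs y hy
        exact d.density_zero s y (Or.inr (hp hs hy)))
      hε (P := fun n x => c n x - ∫ τ in (0 : ℝ)..t, flux (ε n) (U τ) (R τ) x) (by
        intro n x
        have hcont : ContinuousOn (fun s => ∫ τ in (0 : ℝ)..s, flux (ε n) (U τ) (R τ) x)
            (Icc 0 T) := by
          rw [← uIcc_of_le m.pos.le]
          refine intervalIntegral.continuousOn_primitive_interval ?_
          rw [uIcc_of_le m.pos.le, integrableOn_Icc_iff_integrableOn_Ioo]
          exact d.integrableOn_flux m (hε n) x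
        have h1 : Tendsto (fun s => c n x - ∫ τ in (0 : ℝ)..s, flux (ε n) (U τ) (R τ) x)
            (𝓝[G] t) (𝓝 (c n x - ∫ τ in (0 : ℝ)..t, flux (ε n) (U τ) (R τ) x)) :=
          ((hcont t ht).mono hGsub).tendsto.const_sub _
        refine h1.congr' ?_
        filter_upwards [self_mem_nhdsWithin] with s hs
        exact (hs.2.2 n x).symm)
    exact ⟨ρ, fun h => absurd h htG, fun _ => hρ⟩
  choose r hr using key
  exact ⟨c, r, hGae.mono fun s hs => (hr s).1 hs, fun t ht => (hr t).2 ht⟩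

end TransportData

/-! ### The chain rule for the mollified densities -/

lemma AbsolutelyContinuousOnInterval.of_dist_le {X Y : Type*} [PseudoMetricSpace X]
    [PseudoMetricSpace Y] {f : ℝ → X} {g : ℝ → Y} {a b C : ℝ}
    (hg : AbsolutelyContinuousOnInterval g a b)
    (h : ∀ s ∈ uIcc a b, ∀ t ∈ uIcc a b, dist (f s) (f t) ≤ C * dist (g s) (g t)) :
    AbsolutelyContinuousOnInterval f a b := by
  have h1 := Tendsto.const_mul C hg
  rw [mul_zero] at h1
  refine squeeze_zero' (Eventually.of_forall fun E =>
    Finset.sum_nonneg fun _ _ => dist_nonneg) ?_ h1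
  refine eventually_inf_principal.2 (Eventually.of_forall fun E hE => ?_)
  rw [Finset.mul_sum]
  exact Finset.sum_le_sum fun i hi => h _ (hE.1 i hi).1 _ (hE.1 i hi).2

namespace IsRenormalizer

variable {𝓑 : (Fin M → ℝ) → ℝ}

/-- The fundamental theorem of calculus for the product of a renormalized primitive with a `C¹`
function. -/
lemma integral_eq_sub (h : IsRenormalizer 𝓑) {T : ℝ} (hT : 0 < T) {k : ℝ → Fin M → ℝ}
    (hk : IntegrableOn k (Ioo 0 T)) {c : Fin M → ℝ} {μ : ℝ → Fin M → ℝ}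
    (hμ : ∀ s ∈ Icc 0 T, μ s = c - ∫ τ in (0 : ℝ)..s, k τ) (hμ0 : ∀ s ∈ Icc 0 T, μ s ∈ orthant M)
    {b b' : ℝ → ℝ} (hb : AbsolutelyContinuousOnInterval b 0 T)
    (hb' : ∀ s ∈ Ioo 0 T, HasDerivAt b (b' s) s) {t : ℝ} (ht : t ∈ Icc 0 T) :
    ∫ s in (0 : ℝ)..t, (𝓑 (μ s) * b' s - b s * fderivWithin ℝ 𝓑 (orthant M) (μ s) (k s)) =
      𝓑 (μ t) * b t - 𝓑 (μ 0) * b 0 := by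
  obtain ⟨L, hL0, -, hL⟩ := h.exists_bound
  have hkI : IntervalIntegrable k volume 0 T := by
    rwa [intervalIntegrable_iff_integrableOn_Ioo_of_le hT.le]
  have hsub : ∀ {s}, s ∈ Icc 0 T → IntervalIntegrable k volume 0 s := fun hs =>
    hkI.mono_set (by rw [uIcc_of_le hs.1, uIcc_of_le hT.le]; exact Icc_subset_Icc_right hs.2)
  -- `𝓑` is Lipschitz on the orthant, so the composition inherits absolute continuity
  have hac : AbsolutelyContinuousOnInterval (fun s => 𝓑 (μ s)) 0 T := by
    refine AbsolutelyContinuousOnInterval.of_dist_le (C := L)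
      (hkI.norm.absolutelyContinuousOnInterval_intervalIntegral left_mem_uIcc) ?_
    rw [uIcc_of_le hT.le]
    intro s hs s' hs'
    rw [dist_eq_norm, dist_eq_norm]
    refine (hL _ (hμ0 s hs) _ (hμ0 s' hs')).trans (mul_le_mul_of_nonneg_left ?_ hL0)
    rw [hμ s hs, hμ s' hs', sub_sub_sub_cancel_left,
      intervalIntegral.integral_interval_sub_left (hsub hs') (hsub hs),
      intervalIntegral.integral_interval_sub_left (hsub hs).norm (hsub hs').norm]
    rw [intervalIntegral.integral_symm s' s, norm_neg]
    exact intervalIntegral.norm_integral_le_abs_integral_norm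
  have hprod : AbsolutelyContinuousOnInterval ((fun s => 𝓑 (μ s)) * b) 0 t :=
    (hac.mul hb).mono (by rw [uIcc_of_le ht.1, uIcc_of_le hT.le]; exact Icc_subset_Icc_right ht.2)
  rw [← Pi.mul_apply (fun s => 𝓑 (μ s)) b t, ← Pi.mul_apply (fun s => 𝓑 (μ s)) b 0,
    ← hprod.integral_deriv_eq_sub]
  refine intervalIntegral.integral_congr_ae ?_
  have hTne : ∀ᵐ s : ℝ, s ≠ T := by simp [ae_iff]
  filter_upwards [hkI.ae_hasDerivAt_integral, hTne] with s hs hsT hst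
  rw [uIoc_of_le ht.1] at hst
  have hs0 : s ∈ Ioo 0 T := ⟨hst.1, lt_of_le_of_ne (hst.2.trans ht.2) hsT⟩
  have hs1 : s ∈ Icc 0 T := Ioo_subset_Icc_self hs0
  have hnh : Icc 0 T ∈ 𝓝 s := Icc_mem_nhds hs0.1 hs0.2
  have d1 : HasDerivAt μ (-k s) s := by
    have := (hs (by rwa [uIcc_of_le hT.le]) 0 left_mem_uIcc).const_sub c
    refine this.congr_of_eventuallyEq ?_
    filter_upwards [hnh] with τ hτ using hμ τ hτ
  have d2 : HasDerivAt (fun s => 𝓑 (μ s)) (fderivWithin ℝ 𝓑 (orthant M) (μ s) (-k s)) s :=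
    ((h.hasFDerivWithinAt (hμ0 s hs1)).comp_hasDerivWithinAt s d1.hasDerivWithinAt
      (fun τ hτ => hμ0 τ hτ)).hasDerivAt hnh
  rw [(d2.mul (hb' s hs0)).deriv, map_neg]
  ring

end IsRenormalizer

end

noncomputable section

variable {M : ℕ}

/-! ### Test functions up to the boundary of the time interval -/

section TestFunction

variable {T : ℝ} {ϕ : ℝ × R3 → ℝ}

lemma contDiffAt_of_contDiffOn_Icc (hϕ : ContDiffOn ℝ ∞ ϕ (Icc (0 : ℝ) T ×ˢ univ)) {s : ℝ}
    (hs : s ∈ Ioo 0 T) (x : R3) : ContDiffAt ℝ ∞ ϕ (s, x) :=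
  hϕ.contDiffAt (prod_mem_nhds (Icc_mem_nhds hs.1 hs.2) univ_mem)

lemma contDiff_slice_of_contDiffOn_Icc (hϕ : ContDiffOn ℝ ∞ ϕ (Icc (0 : ℝ) T ×ˢ univ)) {s : ℝ}
    (hs : s ∈ Icc 0 T) : ContDiff ℝ ∞ fun x => ϕ (s, x) :=
  hϕ.comp_contDiff (contDiff_const.prodMk contDiff_id) fun _ => ⟨hs, mem_univ _⟩

lemma fderiv_slice_of_contDiffOn_Icc (hϕ : ContDiffOn ℝ ∞ ϕ (Icc (0 : ℝ) T ×ˢ univ)) {s : ℝ}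
    (hs : s ∈ Ioo 0 T) (x : R3) : fderiv ℝ (fun x => ϕ (s, x)) x =
      (fderiv ℝ ϕ (s, x)).comp (ContinuousLinearMap.inr ℝ ℝ R3) := by
  have h1 := ((contDiffAt_of_contDiffOn_Icc hϕ hs x).differentiableAt (by simp)).hasFDerivAt
  exact (h1.comp x (hasFDerivAt_prodMk_right s x)).fderiv

lemma hasDerivAt_time_of_contDiffOn_Icc (hϕ : ContDiffOn ℝ ∞ ϕ (Icc (0 : ℝ) T ×ˢ univ)) {s : ℝ}
    (hs : s ∈ Ioo 0 T) (x : R3) :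
    HasDerivAt (fun s => ϕ (s, x)) (fderiv ℝ ϕ (s, x) (1, 0)) s := by
  have h1 := ((contDiffAt_of_contDiffOn_Icc hϕ hs x).differentiableAt (by simp)).hasFDerivAt
  exact h1.comp_hasDerivAt s ((hasDerivAt_id s).prodMk (hasDerivAt_const s x))

lemma absolutelyContinuousOnInterval_time_of_contDiffOn_Icc (hT : 0 < T)
    (hϕ : ContDiffOn ℝ ∞ ϕ (Icc (0 : ℝ) T ×ˢ univ)) (x : R3) :
    AbsolutelyContinuousOnInterval (fun s => ϕ (s, x)) 0 T := by
  have h : ContDiffOn ℝ 1 (fun s => ϕ (s, x)) (uIcc 0 T) := by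
    refine (hϕ.of_le (by simp)).comp (contDiff_id.prodMk contDiff_const).contDiffOn fun s hs => ?_
    rw [uIcc_of_le hT.le] at hs
    exact ⟨hs, mem_univ _⟩
  exact h.absolutelyContinuousOnInterval

/-- A test function and its derivatives are bounded on compact sets, uniformly up to the endpoints
of the time interval. -/
lemma exists_bound_of_contDiffOn_Icc (hT : 0 < T)
    (hϕ : ContDiffOn ℝ ∞ ϕ (Icc (0 : ℝ) T ×ˢ univ)) {N : Set R3} (hN : IsCompact N) :
    ∃ Z : ℝ, 0 ≤ Z ∧ (∀ s ∈ Icc 0 T, ∀ x ∈ N, ‖ϕ (s, x)‖ ≤ Z) ∧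
      ∀ s ∈ Ioo 0 T, ∀ x ∈ N, ‖fderiv ℝ ϕ (s, x)‖ ≤ Z := by
  have hcomp : IsCompact (Icc (0 : ℝ) T ×ˢ N) := isCompact_Icc.prod hN
  have hsub : Icc (0 : ℝ) T ×ˢ N ⊆ Icc (0 : ℝ) T ×ˢ univ := prod_mono_right (subset_univ _)
  obtain ⟨Z₁, h1⟩ := hcomp.exists_bound_of_continuousOn (hϕ.continuousOn.mono hsub)
  have hu : UniqueDiffOn ℝ (Icc (0 : ℝ) T ×ˢ (univ : Set R3)) :=
    (uniqueDiffOn_Icc hT).prod uniqueDiffOn_univ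
  obtain ⟨Z₂, h2⟩ := hcomp.exists_bound_of_continuousOn
    ((hϕ.continuousOn_fderivWithin hu (by simp)).mono hsub)
  refine ⟨max 0 (max Z₁ Z₂), le_max_left _ _, fun s hs x hx => ?_, fun s hs x hx => ?_⟩
  · exact (h1 _ ⟨hs, hx⟩).trans ((le_max_left _ _).trans (le_max_right _ _))
  · have h3 := h2 (s, x) ⟨Ioo_subset_Icc_self hs, hx⟩
    rw [fderivWithin_of_mem_nhds (prod_mem_nhds (Icc_mem_nhds hs.1 hs.2) univ_mem)] at h3
    exact h3.trans ((le_max_right _ _).trans (le_max_right _ _))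

end TestFunction

/-- A renormalizing function and a test function, with bounds for both of them, the ones for the
test function on `[0,T] × N`. -/
structure RenormTest (𝓑 : (Fin M → ℝ) → ℝ) (Cb T : ℝ) (N : Set R3) (ϕ : ℝ × R3 → ℝ) (Z : ℝ) :
    Prop where
  renorm : IsRenormalizer 𝓑
  Cb_nonneg : 0 ≤ Cb
  grad_le : ∀ ρ ∈ orthant M, ‖fderivWithin ℝ 𝓑 (orthant M) ρ‖ ≤ Cb
  lip : ∀ ρ ∈ orthant M, ∀ σ ∈ orthant M, ‖𝓑 ρ - 𝓑 σ‖ ≤ Cb * ‖ρ - σ‖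
  contDiffOn : ContDiffOn ℝ ∞ ϕ (Icc (0 : ℝ) T ×ˢ univ)
  Z_nonneg : 0 ≤ Z
  test_le : ∀ s ∈ Icc 0 T, ∀ x ∈ N, ‖ϕ (s, x)‖ ≤ Z
  fderiv_le : ∀ s ∈ Ioo 0 T, ∀ x ∈ N, ‖fderiv ℝ ϕ (s, x)‖ ≤ Z

lemma RenormTest.fderiv_time_le {𝓑 : (Fin M → ℝ) → ℝ} {Cb T : ℝ} {N : Set R3} {ϕ : ℝ × R3 → ℝ}
    {Z : ℝ} (b : RenormTest 𝓑 Cb T N ϕ Z) {s : ℝ} (hs : s ∈ Ioo 0 T) {x : R3} (hx : x ∈ N) :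
    ‖fderiv ℝ ϕ (s, x) (1, 0)‖ ≤ Z := by
  refine (ContinuousLinearMap.le_opNorm _ _).trans ?_
  have h : ‖((1 : ℝ), (0 : R3))‖ = 1 := by simp [Prod.norm_def]
  rw [h, mul_one]
  exact b.fderiv_le s hs x hx

lemma RenormTest.norm_renorm_le {𝓑 : (Fin M → ℝ) → ℝ} {Cb T : ℝ} {N : Set R3} {ϕ : ℝ × R3 → ℝ}
    {Z : ℝ} (b : RenormTest 𝓑 Cb T N ϕ Z) {σ : Fin M → ℝ} (hσ : σ ∈ orthant M) :
    ‖𝓑 σ‖ ≤ Cb * ‖σ‖ := by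
  simpa [b.renorm.map_zero] using b.lip σ hσ 0 zero_mem_orthant

lemma exists_renormTest {𝓑 : (Fin M → ℝ) → ℝ} (h : IsRenormalizer 𝓑) {T : ℝ} (hT : 0 < T)
    {ϕ : ℝ × R3 → ℝ} (hϕ : ContDiffOn ℝ ∞ ϕ (Icc (0 : ℝ) T ×ˢ univ)) {N : Set R3}
    (hN : IsCompact N) : ∃ Cb Z : ℝ, RenormTest 𝓑 Cb T N ϕ Z := by
  obtain ⟨Cb, h1, h2, h3⟩ := h.exists_bound
  obtain ⟨Z, h4, h5, h6⟩ := exists_bound_of_contDiffOn_Icc hT hϕ hN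
  exact ⟨Cb, Z, h, h1, h2, h3, hϕ, h4, h5, h6⟩

lemma MovingDomain.add_mem_cthickening {K : Set R3} {ε₀ : ℝ} {y h : R3} (hy : y ∈ K)
    (hh : ‖h‖ ≤ ε₀) : y + h ∈ Metric.cthickening ε₀ K :=
  Metric.mem_cthickening_of_dist_le _ y _ _ hy (by simpa [dist_eq_norm] using hh)

namespace TransportData

variable {T : ℝ} {A : ℝ → Set R3} {K B : Set R3} {ε₀ : ℝ} {γ : Fin M → ℝ≥0∞} {γ₀ p C : ℝ≥0∞}
  {R : ℝ → R3 → Fin M → ℝ} {U : ℝ → R3 → R3} {DU : ℝ → R3 → R3 →L[ℝ] R3}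
  {𝓑 : (Fin M → ℝ) → ℝ} {Cb Z : ℝ} {ϕ : ℝ × R3 → ℝ}

/-- At almost every time, the densities and the test function satisfy the hypotheses of the
renormalization at a fixed time. -/
lemma ae_fixedTimeData (m : MovingDomain T A K B ε₀) (d : TransportData T A K B γ γ₀ p C R U DU)
    (b : RenormTest 𝓑 Cb T (Metric.cthickening ε₀ K) ϕ Z) :
    ∀ᵐ s ∂(volume.restrict (Ioo 0 T)), FixedTimeData 𝓑 Cb K (Metric.cthickening ε₀ K) ε₀
      (fun x => ϕ (s, x)) Z (R s) γ₀ := by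
  obtain ⟨C', hC', h⟩ := d.exists_bound m d.one_le le_rfl
  filter_upwards [h, ae_restrict_mem measurableSet_Ioo] with s hs hsT
  refine ⟨b.renorm, b.Cb_nonneg, b.grad_le, b.lip, m.isCompact,
    Metric.isClosed_cthickening.measurableSet,
    fun y hy h hh => MovingDomain.add_mem_cthickening hy hh,
    (contDiff_slice_of_contDiffOn_Icc b.contDiffOn (Ioo_subset_Icc_self hsT)).of_le (by simp),
    fun x hx => b.test_le s (Ioo_subset_Icc_self hsT) x hx, fun x hx => ?_, b.Z_nonneg, d.one_le,
    d.density_slice s, d.density_mem s,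
    fun x hx => d.density_zero s x (m.notMem_of_notMem hx),
    ⟨(d.density_slice s).aestronglyMeasurable, hs.1.trans_lt hC'.lt_top⟩⟩
  rw [fderiv_slice_of_contDiffOn_Icc b.contDiffOn hsT]
  refine (ContinuousLinearMap.opNorm_comp_le _ _).trans ?_
  calc _ ≤ Z * 1 := mul_le_mul (b.fderiv_le s hsT x hx)
        (ContinuousLinearMap.norm_inr_le_one ℝ ℝ R3) (norm_nonneg _) b.Z_nonneg
    _ = Z := mul_one Z

lemma ae_sobolevVelocity (m : MovingDomain T A K B ε₀) (d : TransportData T A K B γ γ₀ p C R U DU) :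
    ∀ᵐ s ∂(volume.restrict (Ioo 0 T)),
      SobolevVelocity B (Metric.cthickening ε₀ K) ε₀ p (U s) (DU s) := by
  filter_upwards [d.weakGradient, d.memLp] with s h1 h2
  refine ⟨m.isBounded, m.radius_pos, fun x hx => ?_, d.one_le_velocity, d.ne_top, h1,
    d.velocity_zero s, d.grad_zero s, d.velocity_slice s, d.grad_slice s, h2.1, h2.2⟩
  rw [m.isCompact.cthickening_eq_biUnion_closedBall m.radius_pos.le, mem_iUnion₂] at hx
  obtain ⟨y, hy, hxy⟩ := hx
  refine (Metric.closedBall_subset_closedBall' ?_).trans (m.closedBall_subset y hy)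
  rw [two_mul]
  exact add_le_add_right (Metric.mem_closedBall.1 hxy) _

/-- The space-time integrand of the mollified renormalized equation. -/
def mollIntegrand (𝓑 : (Fin M → ℝ) → ℝ) (ϕ : ℝ × R3 → ℝ) (R : ℝ → R3 → Fin M → ℝ)
    (U : ℝ → R3 → R3) (ε : ℝ) (z : ℝ × R3) : ℝ :=
  𝓑 (moll ε (R z.1) z.2) * fderiv ℝ ϕ z (1, 0) -
    ϕ z * fderivWithin ℝ 𝓑 (orthant M) (moll ε (R z.1) z.2) (flux ε (U z.1) (R z.1) z.2)

/-- The mollified integrand is integrable: at a fixed scale it has compact support in space and is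
bounded there by an integrable function of time. -/
lemma integrable_mollIntegrand (m : MovingDomain T A K B ε₀) [γ₀.HolderConjugate p]
    (d : TransportData T A K B γ γ₀ p C R U DU)
    (b : RenormTest 𝓑 Cb T (Metric.cthickening ε₀ K) ϕ Z) {ε : ℝ} (hε : 0 < ε) (hε' : ε ≤ ε₀) :
    Integrable (mollIntegrand 𝓑 ϕ R U ε) ((volume.restrict (Ioo 0 T)).prod volume) := by
  obtain ⟨D, hD⟩ := d.exists_moll_bound m hε
  obtain ⟨g, hg, hg0, hgb⟩ := d.exists_flux_bound m hε
  have hNc : IsCompact (Metric.cthickening ε₀ K) := m.isCompact.cthickening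
  have hNm : MeasurableSet (Metric.cthickening ε₀ K) := Metric.isClosed_cthickening.measurableSet
  have hdom : Integrable (fun z : ℝ × R3 => (Cb * D * Z + Z * (Cb * g z.1)) *
      (Metric.cthickening ε₀ K).indicator (fun _ => (1 : ℝ)) z.2)
      ((volume.restrict (Ioo 0 T)).prod volume) := by
    have i1 : Integrable (fun s => Cb * D * Z + Z * (Cb * g s)) (volume.restrict (Ioo 0 T)) :=
      (integrable_const _).add ((hg.const_mul Cb).const_mul Z)
    have i2 : Integrable ((Metric.cthickening ε₀ K).indicator fun _ => (1 : ℝ)) :=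
      (integrable_indicator_iff hNm).2 (integrableOn_const hNc.measure_lt_top.ne)
    exact i1.mul_prod i2
  have hrest : (volume.restrict (Ioo 0 T)).prod (volume : Measure R3) =
      (volume : Measure (ℝ × R3)).restrict (Ioo 0 T ×ˢ univ) := by
    rw [Measure.volume_eq_prod, ← Measure.prod_restrict, Measure.restrict_univ]
  have hmm := stronglyMeasurable_moll_prod ε d.density_meas
  have hm0 : ∀ z : ℝ × R3, moll ε (R z.1) z.2 ∈ orthant M := fun z =>
    moll_mem_orthant hε (d.density_mem z.1) z.2
  have hopen : IsOpen (Ioo (0 : ℝ) T ×ˢ (univ : Set R3)) := isOpen_Ioo.prod isOpen_univ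
  have hsub : Ioo (0 : ℝ) T ×ˢ (univ : Set R3) ⊆ Icc 0 T ×ˢ univ :=
    prod_mono_left Ioo_subset_Icc_self
  have a1 : AEStronglyMeasurable (fun z => fderiv ℝ ϕ z (1, 0))
      ((volume.restrict (Ioo 0 T)).prod volume) := by
    rw [hrest]
    exact (((b.contDiffOn.mono hsub).continuousOn_fderiv_of_isOpen hopen (by simp)).clm_apply
      continuousOn_const).aestronglyMeasurable hopen.measurableSet
  have a2 : AEStronglyMeasurable ϕ ((volume.restrict (Ioo 0 T)).prod volume) := by
    rw [hrest]
    exact (b.contDiffOn.continuousOn.mono hsub).aestronglyMeasurable hopen.measurableSet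
  have a3 := isBoundedBilinearMap_apply.continuous.comp_stronglyMeasurable
    ((b.renorm.stronglyMeasurable_fderivWithin_comp hmm hm0).prodMk
      (stronglyMeasurable_flux_prod ε d.density_meas d.velocity_meas))
  refine hdom.mono' (((b.renorm.stronglyMeasurable_comp hmm hm0).aestronglyMeasurable.mul a1).sub
    (a2.mul a3.aestronglyMeasurable)) ?_
  have hall : ∀ᵐ s ∂(volume.restrict (Ioo 0 T)), s ∈ Ioo 0 T ∧ (∀ x, ‖moll ε (R s) x‖ ≤ D) ∧
      (∀ x, ‖flux ε (U s) (R s) x‖ ≤ g s) ∧ FixedTimeData 𝓑 Cb K (Metric.cthickening ε₀ K) ε₀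
      (fun x => ϕ (s, x)) Z (R s) γ₀ := by
    filter_upwards [ae_restrict_mem measurableSet_Ioo, hD, hgb, d.ae_fixedTimeData m b]
      with s h1 h2 h3 h4
    exact ⟨h1, h2.2, h3, h4⟩
  filter_upwards [Measure.quasiMeasurePreserving_fst.ae hall] with z hz
  obtain ⟨hs, hD', hg', f⟩ := hz
  rw [mollIntegrand]
  by_cases hx : z.2 ∈ Metric.cthickening ε₀ K
  · rw [indicator_of_mem hx, mul_one]
    have hZ := b.Z_nonneg
    have hC := b.Cb_nonneg
    refine (norm_sub_le _ _).trans (add_le_add ?_ ?_)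
    · rw [norm_mul]
      exact mul_le_mul ((b.norm_renorm_le (hm0 z)).trans
        (mul_le_mul_of_nonneg_left (hD' z.2) hC)) (b.fderiv_time_le hs hx) (norm_nonneg _)
        (mul_nonneg hC ((norm_nonneg _).trans (hD' z.2)))
    · rw [norm_mul]
      refine mul_le_mul (b.test_le z.1 (Ioo_subset_Icc_self hs) z.2 hx) ?_ (norm_nonneg _) hZ
      exact (ContinuousLinearMap.le_opNorm _ _).trans
        (mul_le_mul (b.grad_le _ (hm0 z)) (hg' z.2) (norm_nonneg _) hC)
  · rw [f.moll_eq_zero hε hε' hx, f.flux_eq_zero hε hε' hx, b.renorm.map_zero]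
    simp [indicator_of_notMem hx]

/-- The renormalized equation for the mollified densities, in time-integrated form. -/
lemma integral_mollIntegrand (m : MovingDomain T A K B ε₀) [γ₀.HolderConjugate p]
    (d : TransportData T A K B γ γ₀ p C R U DU)
    (b : RenormTest 𝓑 Cb T (Metric.cthickening ε₀ K) ϕ Z) {ε : ℝ} (hε : 0 < ε) (hε' : ε ≤ ε₀)
    {c : R3 → Fin M → ℝ} {r : ℝ → R3 → Fin M → ℝ}
    (hrR : ∀ᵐ s ∂(volume.restrict (Ioo 0 T)), r s = R s)
    (hr0 : ∀ t ∈ Icc 0 T, ∀ x, r t x ∈ orthant M) (hrK : ∀ t ∈ Icc 0 T, ∀ x ∉ K, r t x = 0)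
    (hri : ∀ t ∈ Icc 0 T, Integrable (r t))
    (hr : ∀ t ∈ Icc 0 T, ∀ x,
      moll ε (r t) x = c x - ∫ τ in (0 : ℝ)..t, flux ε (U τ) (R τ) x) {t : ℝ} (ht : t ∈ Icc 0 T) :
    ∫ s in Ioo 0 t, ∫ x, mollIntegrand 𝓑 ϕ R U ε (s, x) =
      (∫ x, 𝓑 (moll ε (r t) x) * ϕ (t, x)) - ∫ x, 𝓑 (moll ε (r 0) x) * ϕ (0, x) := by
  have h0 : (0 : ℝ) ∈ Icc 0 T := left_mem_Icc.2 m.pos.le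
  have hsubt : Ioo 0 t ⊆ Ioo 0 T := Ioo_subset_Ioo_right ht.2
  have hint : ∀ t ∈ Icc 0 T, Integrable fun x => 𝓑 (moll ε (r t) x) * ϕ (t, x) := by
    intro t ht
    have hc : Continuous fun x => 𝓑 (moll ε (r t) x) :=
      b.renorm.contDiffOn.continuousOn.comp_continuous
        (moll_contDiff hε (hri t ht).locallyIntegrable).continuous
        (moll_mem_orthant hε (hr0 t ht))
    refine (hc.mul (contDiff_slice_of_contDiffOn_Icc b.contDiffOn
      ht).continuous).integrable_of_hasCompactSupport ?_
    exact ((hasCompactSupport_moll hε m.isCompact (hrK t ht)).comp_left b.renorm.map_zero).mul_right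
  -- the fundamental theorem of calculus at a fixed point in space
  have hpt : ∀ x, ∫ s in Ioo 0 t, mollIntegrand 𝓑 ϕ R U ε (s, x) =
      𝓑 (moll ε (r t) x) * ϕ (t, x) - 𝓑 (moll ε (r 0) x) * ϕ (0, x) := by
    intro x
    rw [← b.renorm.integral_eq_sub m.pos (d.integrableOn_flux m hε x) (c := c x)
      (μ := fun s => moll ε (r s) x) (fun s hs => hr s hs x)
      (fun s hs => moll_mem_orthant hε (hr0 s hs) x)
      (absolutelyContinuousOnInterval_time_of_contDiffOn_Icc m.pos b.contDiffOn x)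
      (fun s hs => hasDerivAt_time_of_contDiffOn_Icc b.contDiffOn hs x) ht,
      intervalIntegral.integral_of_le ht.1, integral_Ioc_eq_integral_Ioo]
    refine integral_congr_ae ?_
    filter_upwards [ae_restrict_of_ae_restrict_of_subset hsubt hrR] with s hs
    simp only [mollIntegrand, hs]
  have hF : Integrable (mollIntegrand 𝓑 ϕ R U ε) ((volume.restrict (Ioo 0 t)).prod volume) := by
    refine (d.integrable_mollIntegrand m b hε hε').mono_measure ?_
    exact Measure.prod_mono (Measure.restrict_mono hsubt le_rfl) le_rfl
  rw [← integral_sub (hint t ht) (hint 0 h0), ← integral_congr_ae (Eventually.of_forall hpt)]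
  exact integral_integral_swap hF

end TransportData

end

section

variable {M : ℕ}

namespace TransportData

variable {T : ℝ} {A : ℝ → Set R3} {K B : Set R3} {ε₀ : ℝ} {γ : Fin M → ℝ≥0∞} {γ₀ p C : ℝ≥0∞}
  {R : ℝ → R3 → Fin M → ℝ} {U : ℝ → R3 → R3} {DU : ℝ → R3 → R3 →L[ℝ] R3}
  {𝓑 : (Fin M → ℝ) → ℝ} {Cb Z : ℝ} {ϕ : ℝ × R3 → ℝ}

/-! ### Integrability of the limit -/

lemma measurable_eLpNorm_slice {F : Type*} [NormedAddCommGroup F] {w : ℝ → R3 → F}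
    (hw : StronglyMeasurable fun z : ℝ × R3 => w z.1 z.2) {p : ℝ≥0∞} (h1 : 1 ≤ p) (hp : p ≠ ⊤) :
    Measurable fun s => eLpNorm (w s) p (volume : Measure R3) := by
  have h0 : p ≠ 0 := (one_pos.trans_le h1).ne'
  simp only [eLpNorm_eq_lintegral_rpow_enorm_toReal h0 hp]
  exact ((hw.enorm.pow_const p.toReal).lintegral_prod_right').pow_const _

/-- The product of the densities with a function in `L¹(0,T; L^p)` is integrable in space-time. -/
lemma integrable_norm_mul_norm (m : MovingDomain T A K B ε₀) [γ₀.HolderConjugate p]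
    (d : TransportData T A K B γ γ₀ p C R U DU) {F : Type*} [NormedAddCommGroup F]
    {w : ℝ → R3 → F} (hw : StronglyMeasurable fun z : ℝ × R3 => w z.1 z.2)
    (hlt : ∫⁻ s in Ioo 0 T, eLpNorm (w s) p < ⊤) :
    Integrable (fun z : ℝ × R3 => ‖R z.1 z.2‖ * ‖w z.1 z.2‖)
      ((volume.restrict (Ioo 0 T)).prod volume) := by
  obtain ⟨C', hC', h⟩ := d.exists_bound m d.one_le le_rfl
  have hm : StronglyMeasurable fun z : ℝ × R3 => ‖R z.1 z.2‖ * ‖w z.1 z.2‖ :=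
    d.density_meas.norm.mul hw.norm
  refine ⟨hm.aestronglyMeasurable, ?_⟩
  rw [hasFiniteIntegral_iff_enorm, lintegral_prod _ hm.enorm.aemeasurable]
  have hle : ∀ᵐ s ∂(volume.restrict (Ioo 0 T)),
      ∫⁻ y, ‖‖R s y‖ * ‖w s y‖‖ₑ ≤ C' * eLpNorm (w s) p := by
    filter_upwards [h] with s hs
    have h1 : ∫⁻ y, ‖R s y‖ₑ * ‖w s y‖ₑ ≤ eLpNorm (R s) γ₀ * eLpNorm (w s) p :=
      lintegral_enorm_mul_enorm_le (d.density_slice s).aestronglyMeasurable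
        (hw.comp_measurable measurable_prodMk_left).aestronglyMeasurable
    simp only [enorm_mul, enorm_norm]
    exact h1.trans (mul_le_mul' hs.1 le_rfl)
  refine (lintegral_mono_ae hle).trans_lt ?_
  rw [lintegral_const_mul' _ _ hC']
  exact ENNReal.mul_lt_top hC'.lt_top hlt

lemma integrable_density (m : MovingDomain T A K B ε₀)
    (d : TransportData T A K B γ γ₀ p C R U DU) :
    Integrable (fun z : ℝ × R3 => R z.1 z.2) ((volume.restrict (Ioo 0 T)).prod volume) := by
  obtain ⟨C', hC', h⟩ := d.exists_bound m le_rfl d.one_le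
  refine ⟨d.density_meas.aestronglyMeasurable, ?_⟩
  rw [hasFiniteIntegral_iff_enorm, lintegral_prod _ d.density_meas.enorm.aemeasurable]
  have hle : ∀ᵐ s ∂(volume.restrict (Ioo 0 T)), ∫⁻ y, ‖R s y‖ₑ ≤ C' := by
    filter_upwards [h] with s hs
    rw [← eLpNorm_one_eq_lintegral_enorm]
    exact hs.1
  refine (lintegral_mono_ae hle).trans_lt ?_
  rw [lintegral_const, Measure.restrict_apply_univ]
  exact ENNReal.mul_lt_top hC'.lt_top measure_Ioo_lt_top

lemma lintegral_eLpNorm_velocity_lt_top (d : TransportData T A K B γ γ₀ p C R U DU) :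
    ∫⁻ s in Ioo 0 T, eLpNorm (U s) p < ⊤ :=
  (lintegral_mono fun _ => le_self_add).trans_lt d.lintegral_lt_top

lemma lintegral_eLpNorm_grad_lt_top (d : TransportData T A K B γ γ₀ p C R U DU) :
    ∫⁻ s in Ioo 0 T, eLpNorm (DU s) p < ⊤ :=
  (lintegral_mono fun _ => le_add_self).trans_lt d.lintegral_lt_top

/-- The renormalized integrand is dominated by `|R| (1 + |U| + |DU|)`. -/
lemma integrable_renormIntegrand (m : MovingDomain T A K B ε₀) [γ₀.HolderConjugate p]
    (d : TransportData T A K B γ γ₀ p C R U DU)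
    (b : RenormTest 𝓑 Cb T (Metric.cthickening ε₀ K) ϕ Z) :
    Integrable (fun z : ℝ × R3 => renormIntegrand 𝓑 R U DU ϕ z.1 z.2)
      ((volume.restrict (Ioo 0 T)).prod volume) := by
  have i1 := (d.integrable_density m).norm
  have i2 := d.integrable_norm_mul_norm m d.velocity_meas d.lintegral_eLpNorm_velocity_lt_top
  have i3 := d.integrable_norm_mul_norm m d.grad_meas d.lintegral_eLpNorm_grad_lt_top
  have hrest : (volume.restrict (Ioo 0 T)).prod (volume : Measure R3) =
      (volume : Measure (ℝ × R3)).restrict (Ioo 0 T ×ˢ univ) := by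
    rw [Measure.volume_eq_prod, ← Measure.prod_restrict, Measure.restrict_univ]
  have hopen : IsOpen (Ioo (0 : ℝ) T ×ˢ (univ : Set R3)) := isOpen_Ioo.prod isOpen_univ
  have hsub : Ioo (0 : ℝ) T ×ˢ (univ : Set R3) ⊆ Icc 0 T ×ˢ univ :=
    prod_mono_left Ioo_subset_Icc_self
  have a1 : AEStronglyMeasurable (fderiv ℝ ϕ) ((volume.restrict (Ioo 0 T)).prod volume) := by
    rw [hrest]
    exact ((b.contDiffOn.mono hsub).continuousOn_fderiv_of_isOpen hopen
      (by simp)).aestronglyMeasurable hopen.measurableSet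
  have a2 : AEStronglyMeasurable ϕ ((volume.restrict (Ioo 0 T)).prod volume) := by
    rw [hrest]
    exact (b.contDiffOn.continuousOn.mono hsub).aestronglyMeasurable hopen.measurableSet
  have happ : Continuous fun q : (ℝ × R3 →L[ℝ] ℝ) × (ℝ × R3) => q.1 q.2 :=
    isBoundedBilinearMap_apply.continuous
  have a3 : AEStronglyMeasurable (fun z : ℝ × R3 => transport U ϕ z.1 z.2)
      ((volume.restrict (Ioo 0 T)).prod volume) :=
    (happ.comp_aestronglyMeasurable (a1.prodMk aestronglyMeasurable_const)).add
      (happ.comp_aestronglyMeasurable (a1.prodMk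
        (stronglyMeasurable_const.prodMk d.velocity_meas).aestronglyMeasurable))
  have hm0 : ∀ z : ℝ × R3, R z.1 z.2 ∈ orthant M := fun z => d.density_mem z.1 z.2
  have s1 := b.renorm.stronglyMeasurable_comp d.density_meas hm0
  have s2 := isBoundedBilinearMap_apply.continuous.comp_stronglyMeasurable
    ((b.renorm.stronglyMeasurable_fderivWithin_comp d.density_meas hm0).prodMk d.density_meas)
  have s3 := continuous_divOf.comp_stronglyMeasurable d.grad_meas
  have hZ := b.Z_nonneg
  have hC := b.Cb_nonneg
  refine (((i1.add i2).add (i3.const_mul 6)).const_mul (Cb * Z)).mono'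
    ((s1.aestronglyMeasurable.mul a3).sub
      (((s2.sub s1).mul s3).aestronglyMeasurable.mul a2)) ?_
  have hall : ∀ᵐ s ∂(volume.restrict (Ioo 0 T)), s ∈ Ioo 0 T := ae_restrict_mem measurableSet_Ioo
  filter_upwards [Measure.quasiMeasurePreserving_fst.ae hall] with z hs
  by_cases hx : z.2 ∈ Metric.cthickening ε₀ K
  · have e1 : ‖𝓑 (R z.1 z.2)‖ ≤ Cb * ‖R z.1 z.2‖ := b.norm_renorm_le (hm0 z)
    have e2 : ‖transport U ϕ z.1 z.2‖ ≤ Z * (1 + ‖U z.1 z.2‖) := by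
      rw [transport, mul_add, mul_one]
      refine (norm_add_le _ _).trans (add_le_add (b.fderiv_time_le hs hx) ?_)
      refine (ContinuousLinearMap.le_opNorm _ _).trans ?_
      have h : ‖((0 : ℝ), U z.1 z.2)‖ = ‖U z.1 z.2‖ := by simp [Prod.norm_def]
      rw [h]
      exact mul_le_mul_of_nonneg_right (b.fderiv_le _ hs _ hx) (norm_nonneg _)
    have e3 : ‖fderivWithin ℝ 𝓑 (orthant M) (R z.1 z.2) (R z.1 z.2) - 𝓑 (R z.1 z.2)‖ ≤
        2 * (Cb * ‖R z.1 z.2‖) := by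
      rw [two_mul]
      refine (norm_sub_le _ _).trans (add_le_add ?_ e1)
      exact (ContinuousLinearMap.le_opNorm _ _).trans
        (mul_le_mul_of_nonneg_right (b.grad_le _ (hm0 z)) (norm_nonneg _))
    have e4 := norm_divOf_le (DU z.1 z.2)
    have e5 := b.test_le z.1 (Ioo_subset_Icc_self hs) z.2 hx
    rw [renormIntegrand]
    refine (norm_sub_le _ _).trans ?_
    rw [norm_mul, norm_mul, norm_mul]
    calc _ ≤ (Cb * ‖R z.1 z.2‖) * (Z * (1 + ‖U z.1 z.2‖)) +
          (2 * (Cb * ‖R z.1 z.2‖)) * (3 * ‖DU z.1 z.2‖) * Z := by gcongr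
      _ = _ := by
        simp only [Pi.add_apply]
        ring
  · have h0 : R z.1 z.2 = 0 := by
      refine d.density_zero _ _ (m.notMem_of_notMem fun h => hx ?_)
      simpa using MovingDomain.add_mem_cthickening (h := 0) h (by simpa using m.radius_pos.le)
    rw [renormIntegrand, h0, b.renorm.map_zero]
    simp [h0]

/-! ### Passage to the limit -/

/-- The renormalized equation on `[0,t]`: the limit of the equations for the mollified
densities. -/
lemma integral_renormIntegrand (m : MovingDomain T A K B ε₀) [γ₀.HolderConjugate p]
    (d : TransportData T A K B γ γ₀ p C R U DU)
    (b : RenormTest 𝓑 Cb T (Metric.cthickening ε₀ K) ϕ Z) {ε : ℕ → ℝ} (hε : ∀ n, 0 < ε n)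
    (hε' : ∀ n, ε n ≤ ε₀) (hε0 : Tendsto ε atTop (𝓝 0))
    {c : ℕ → R3 → Fin M → ℝ} {r : ℝ → R3 → Fin M → ℝ}
    (hrR : ∀ᵐ s ∂(volume.restrict (Ioo 0 T)), r s = R s)
    (hr : ∀ t ∈ Icc 0 T, StronglyMeasurable (r t) ∧ (∀ x, r t x ∈ orthant M) ∧
        (∀ x ∉ A t, r t x = 0) ∧ (∀ i, eLpNorm (fun x => r t x i) (γ i) ≤ C) ∧
        ∀ n x, moll (ε n) (r t) x = c n x - ∫ τ in (0 : ℝ)..t, flux (ε n) (U τ) (R τ) x)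
    {t : ℝ} (ht : t ∈ Icc 0 T) :
    ∫ s in Ioo 0 t, ∫ x, renormIntegrand 𝓑 R U DU ϕ s x =
      (∫ x, 𝓑 (r t x) * ϕ (t, x)) - ∫ x, 𝓑 (r 0 x) * ϕ (0, x) := by
  have h0 : (0 : ℝ) ∈ Icc 0 T := left_mem_Icc.2 m.pos.le
  have hsubt : Ioo 0 t ⊆ Ioo 0 T := Ioo_subset_Ioo_right ht.2
  have hεt : Tendsto ε atTop (𝓝[>] 0) :=
    tendsto_nhdsWithin_iff.2 ⟨hε0, Eventually.of_forall hε⟩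
  obtain ⟨C', hC', hb⟩ := exists_eLpNorm_le m.isCompact d.one_le d.le_exponent d.bound_ne_top
  have hrK : ∀ t ∈ Icc 0 T, ∀ x ∉ K, r t x = 0 := fun t ht x hx =>
    (hr t ht).2.2.1 x fun h => hx (m.subset t ht h)
  -- the data of the endpoints, for which no test function is needed
  have hfix : ∀ t ∈ Icc 0 T, FixedTimeData 𝓑 Cb K (Metric.cthickening ε₀ K) ε₀
      (fun _ => 0) 0 (r t) γ₀ := by
    intro t ht
    obtain ⟨g1, g2, -, g4, -⟩ := hr t ht
    exact ⟨b.renorm, b.Cb_nonneg, b.grad_le, b.lip, m.isCompact,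
      Metric.isClosed_cthickening.measurableSet,
      fun y hy h hh => MovingDomain.add_mem_cthickening hy hh, contDiff_const, by simp, by simp,
      le_rfl, d.one_le, g1, g2, hrK t ht,
      ⟨g1.aestronglyMeasurable, (hb (r t) g1 (hrK t ht) g4).1.trans_lt hC'.lt_top⟩⟩
  have hend : ∀ t ∈ Icc 0 T, Tendsto (fun n => ∫ x, 𝓑 (moll (ε n) (r t) x) * ϕ (t, x)) atTop
      (𝓝 (∫ x, 𝓑 (r t x) * ϕ (t, x))) := fun t ht =>
    ((hfix t ht).tendsto_integral_renorm_moll_mul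
      (contDiff_slice_of_contDiffOn_Icc b.contDiffOn ht).continuous.stronglyMeasurable
      m.radius_pos (fun x hx => b.test_le t ht x hx)).comp hεt
  have hR := (hend t ht).sub (hend 0 h0)
  have heq : ∀ n, (∫ x, 𝓑 (moll (ε n) (r t) x) * ϕ (t, x)) -
      ∫ x, 𝓑 (moll (ε n) (r 0) x) * ϕ (0, x) =
      ∫ s in Ioo 0 t, ∫ x, mollIntegrand 𝓑 ϕ R U (ε n) (s, x) := fun n =>
    (d.integral_mollIntegrand m b (hε n) (hε' n) hrR (fun t ht => (hr t ht).2.1) hrK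
      (fun t ht => (hfix t ht).integrable) (fun t ht x => (hr t ht).2.2.2.2 n x) ht).symm
  simp only [heq] at hR
  refine tendsto_nhds_unique ?_ hR
  obtain ⟨Λ, hΛtop, hΛ⟩ := exists_lintegral_fderiv_mollKernel_le
  obtain ⟨C₁, hC₁, hb₁⟩ := d.exists_bound m le_rfl d.one_le
  obtain ⟨C₂, hC₂, hb₂⟩ := d.exists_bound m d.one_le le_rfl
  -- an integrable majorant in time, uniform in the scale
  set E : ℝ → ℝ≥0∞ := fun s => ENNReal.ofReal (Cb * Z) * C₁ +
    ENNReal.ofReal (Z * Cb) * (3 + Λ) * C₂ * (eLpNorm (U s) p + eLpNorm (DU s) p) with hE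
  have hcst : ENNReal.ofReal (Z * Cb) * (3 + Λ) * C₂ ≠ ⊤ :=
    ENNReal.mul_ne_top (ENNReal.mul_ne_top (by simp) (by simp [hΛtop])) hC₂
  have hmeas : Measurable fun s => eLpNorm (U s) p + eLpNorm (DU s) p :=
    (measurable_eLpNorm_slice d.velocity_meas d.one_le_velocity d.ne_top).add
      (measurable_eLpNorm_slice d.grad_meas d.one_le_velocity d.ne_top)
  have hEm : Measurable E := measurable_const.add (hmeas.const_mul _)
  have hEfin : ∫⁻ s in Ioo 0 T, E s ≠ ⊤ := by
    rw [hE, lintegral_add_left measurable_const, lintegral_const, Measure.restrict_apply_univ,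
      lintegral_const_mul _ hmeas]
    exact ENNReal.add_ne_top.2 ⟨ENNReal.mul_ne_top (ENNReal.mul_ne_top (by simp) hC₁)
      measure_Ioo_lt_top.ne, ENNReal.mul_ne_top hcst d.lintegral_lt_top.ne⟩
  have hEi : IntegrableOn (fun s => (E s).toReal) (Ioo 0 t) :=
    IntegrableOn.mono_set (integrable_toReal_of_lintegral_ne_top hEm.aemeasurable hEfin) hsubt
  -- the mollified integrands at almost every fixed time
  have hslice : ∀ᵐ s ∂(volume.restrict (Ioo 0 T)),
      (∀ n, ‖∫ x, mollIntegrand 𝓑 ϕ R U (ε n) (s, x)‖ ≤ (E s).toReal) ∧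
      Tendsto (fun n => ∫ x, mollIntegrand 𝓑 ϕ R U (ε n) (s, x)) atTop
        (𝓝 (∫ x, renormIntegrand 𝓑 R U DU ϕ s x)) := by
    filter_upwards [d.ae_fixedTimeData m b, d.ae_sobolevVelocity m, hb₁, hb₂,
      ae_lt_top hEm hEfin, ae_restrict_mem measurableSet_Ioo, d.ae_lintegral_mul_lt_top m]
      with s f V k1 k2 hEs hsT hRU
    have hdt : Continuous fun x => fderiv ℝ ϕ (s, x) (1, 0) := by
      have h1 := (b.contDiffOn.mono
        (prod_mono_left Ioo_subset_Icc_self)).continuousOn_fderiv_of_isOpen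
        (isOpen_Ioo.prod isOpen_univ) (by simp)
      exact (h1.comp_continuous (Continuous.prodMk_right s)
        fun x => ⟨hsT, mem_univ _⟩).clm_apply continuous_const
    have hdtN : ∀ x ∈ Metric.cthickening ε₀ K, ‖fderiv ℝ ϕ (s, x) (1, 0)‖ ≤ Z := fun x hx =>
      b.fderiv_time_le hsT hx
    have hsplit : ∀ n, ∫ x, mollIntegrand 𝓑 ϕ R U (ε n) (s, x) =
        (∫ x, 𝓑 (moll (ε n) (R s) x) * fderiv ℝ ϕ (s, x) (1, 0)) -
          fluxPairing 𝓑 (fun x => ϕ (s, x)) (R s) (ε n) (U s) := by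
      intro n
      have j1 : Integrable fun x => 𝓑 (moll (ε n) (R s) x) * fderiv ℝ ϕ (s, x) (1, 0) := by
        refine ((f.contDiff_renorm_moll (hε n)).continuous.mul
          hdt).integrable_of_hasCompactSupport ?_
        exact ((hasCompactSupport_moll (hε n) m.isCompact f.density_zero).comp_left
          b.renorm.map_zero).mul_right
      have j2 := f.integrable_fluxPairing (hε n) (hε' n) (d.velocity_slice s) hRU
      exact integral_sub j1 j2
    refine ⟨fun n => ?_, ?_⟩
    · rw [hsplit n, ← toReal_enorm]
      refine ENNReal.toReal_mono hEs.ne ((enorm_sub_le).trans (add_le_add ?_ ?_))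
      · refine (enorm_integral_le_lintegral_enorm _).trans ?_
        calc ∫⁻ x, ‖𝓑 (moll (ε n) (R s) x) * fderiv ℝ ϕ (s, x) (1, 0)‖ₑ
            ≤ ∫⁻ x, ENNReal.ofReal (Cb * Z) * (‖moll (ε n) (R s) x‖ₑ * 1) := by
              refine lintegral_mono fun x => ?_
              by_cases hx : x ∈ Metric.cthickening ε₀ K
              · rw [mul_one, ← ofReal_norm, ← ofReal_norm,
                  ← ENNReal.ofReal_mul (mul_nonneg b.Cb_nonneg b.Z_nonneg), norm_mul]
                refine ENNReal.ofReal_le_ofReal ?_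
                calc _ ≤ (Cb * ‖moll (ε n) (R s) x‖) * Z :=
                      mul_le_mul (b.norm_renorm_le (f.moll_mem (hε n) x)) (hdtN x hx)
                        (norm_nonneg _) (mul_nonneg b.Cb_nonneg (norm_nonneg _))
                  _ = _ := by ring
              · rw [f.moll_eq_zero (hε n) (hε' n) hx, b.renorm.map_zero]
                simp
          _ = ENNReal.ofReal (Cb * Z) * ∫⁻ x, ‖moll (ε n) (R s) x‖ₑ * 1 :=
              lintegral_const_mul' _ _ (by simp)
          _ ≤ ENNReal.ofReal (Cb * Z) * C₁ := by
              gcongr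
              refine lintegral_enorm_moll_mul_le (hε n) (d.density_slice s) measurable_const
                fun h _ => ?_
              simp only [mul_one]
              rw [← eLpNorm_one_eq_lintegral_enorm]
              exact k1.1
      · refine (f.enorm_fluxPairing_le_of_sobolev V (hε n) (hε' n) (hΛ _ (hε n)) hΛtop).trans ?_
        gcongr
        · exact k2.1
        · exact Measure.restrict_le_self
        · exact Measure.restrict_le_self
    · simp only [hsplit]
      have l1 := (f.tendsto_integral_renorm_moll_mul hdt.stronglyMeasurable m.radius_pos
        hdtN).comp hεt
      have l2 := (f.tendsto_fluxPairing m.radius_pos V).comp hεt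
      have l3 := l1.sub l2
      have hgR := f.lintegral_mul_lt_top_of_memLp m.radius_pos V.grad_meas V.grad_memLp
      obtain ⟨i1, i2, -, -⟩ := f.integrable_renormPairing m.radius_pos V.meas V.grad_meas hRU hgR
      have i0 : Integrable fun x => 𝓑 (R s x) * fderiv ℝ ϕ (s, x) (1, 0) := by
        refine (f.integrable.norm.const_mul (Cb * Z)).mono'
          ((f.renorm.stronglyMeasurable_comp f.density_meas f.density_mem).mul
            hdt.stronglyMeasurable).aestronglyMeasurable
          (Eventually.of_forall fun x => ?_)
        by_cases hx : x ∈ Metric.cthickening ε₀ K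
        · rw [norm_mul]
          calc _ ≤ (Cb * ‖R s x‖) * Z :=
                mul_le_mul (b.norm_renorm_le (f.density_mem x)) (hdtN x hx)
                  (norm_nonneg _) (mul_nonneg b.Cb_nonneg (norm_nonneg _))
            _ = _ := by ring
        · rw [f.density_eq_zero hx (y := x) (by simpa using m.radius_pos.le), b.renorm.map_zero]
          simp
      have hval : ∫ x, renormIntegrand 𝓑 R U DU ϕ s x =
          (∫ x, 𝓑 (R s x) * fderiv ℝ ϕ (s, x) (1, 0)) -
            -renormPairing 𝓑 (fun x => ϕ (s, x)) (R s) (U s) (DU s) := by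
        have i3 : Integrable fun x => 𝓑 (R s x) * fderiv ℝ (fun x => ϕ (s, x)) x (U s x) -
            (fderivWithin ℝ 𝓑 (orthant M) (R s x) (R s x) - 𝓑 (R s x)) * divOf (DU s x) *
              ϕ (s, x) := i1.sub i2
        rw [sub_neg_eq_add, renormPairing, ← integral_add i0 i3]
        refine integral_congr_ae (Eventually.of_forall fun x => ?_)
        simp only [renormIntegrand, transport, fderiv_slice_of_contDiffOn_Icc b.contDiffOn hsT,
          ContinuousLinearMap.comp_apply, ContinuousLinearMap.inr_apply]
        ring
      rw [hval]
      exact l3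
  refine tendsto_integral_of_dominated_convergence (fun s => (E s).toReal) (fun n => ?_) hEi
    (fun n => ?_) ?_
  · exact (((d.integrable_mollIntegrand m b (hε n) (hε' n)).integral_prod_left).mono_measure
      (Measure.restrict_mono hsubt le_rfl)).aestronglyMeasurable
  · exact (ae_restrict_of_ae_restrict_of_subset hsubt hslice).mono fun s hs => hs.1 n
  · exact (ae_restrict_of_ae_restrict_of_subset hsubt hslice).mono fun s hs => hs.2

end TransportData

end

section

variable {M : ℕ}

/-! ### Jointly measurable versions -/

/-- Almost everywhere in space-time implies almost everywhere in space at almost every time. -/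
lemma ae_slice_of_ae_spaceTime {T : ℝ} {A : ℝ → Set R3} (hA : MeasurableSet (spaceTime T A))
    (hAs : ∀ s ∈ Ioo 0 T, MeasurableSet (A s)) {P : ℝ × R3 → Prop}
    (h : ∀ᵐ z ∂((volume : Measure (ℝ × R3)).restrict (spaceTime T A)), P z) :
    ∀ᵐ s ∂(volume.restrict (Ioo 0 T)), ∀ᵐ x ∂(volume.restrict (A s)), P (s, x) := by
  rw [ae_restrict_iff' hA, Measure.volume_eq_prod] at h
  rw [ae_restrict_iff' measurableSet_Ioo]
  filter_upwards [Measure.ae_ae_of_ae_prod h] with s hs hsT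
  rw [ae_restrict_iff' (hAs s hsT)]
  filter_upwards [hs] with x hx hxA
  exact hx ⟨hsT, hxA⟩

lemma ae_spaceTime_of_ae {T : ℝ} {A : ℝ → Set R3} {P : ℝ → Prop}
    (h : ∀ᵐ s ∂(volume.restrict (Ioo 0 T)), P s) :
    ∀ᵐ z ∂((volume : Measure (ℝ × R3)).restrict (spaceTime T A)), P z.1 := by
  have h1 : ∀ᵐ z ∂((volume.restrict (Ioo 0 T)).prod (volume : Measure R3)), P z.1 :=
    Measure.quasiMeasurePreserving_fst.ae h
  have hrest : (volume.restrict (Ioo 0 T)).prod (volume : Measure R3) =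
      (volume : Measure (ℝ × R3)).restrict (Ioo 0 T ×ˢ univ) := by
    rw [Measure.volume_eq_prod, ← Measure.prod_restrict, Measure.restrict_univ]
  rw [hrest] at h1
  have hsub : spaceTime T A ⊆ Ioo 0 T ×ˢ univ := fun z hz => ⟨hz.1, mem_univ _⟩
  exact ae_restrict_of_ae_restrict_of_subset hsub h1

/-- A jointly measurable version of a function on a space-time domain, extended by zero. -/
lemma exists_measurable_version {F : Type*} [NormedAddCommGroup F] {T : ℝ} {A : ℝ → Set R3}
    (hA : MeasurableSet (spaceTime T A)) {v : ℝ → R3 → F}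
    (hv : AEStronglyMeasurable (fun z : ℝ × R3 => v z.1 z.2) (volume.restrict (spaceTime T A))) :
    ∃ V : ℝ → R3 → F, (StronglyMeasurable fun z : ℝ × R3 => V z.1 z.2) ∧
      (∀ s x, s ∉ Ioo 0 T ∨ x ∉ A s → V s x = 0) ∧
      ∀ᵐ z ∂((volume : Measure (ℝ × R3)).restrict (spaceTime T A)), V z.1 z.2 = v z.1 z.2 := by
  refine ⟨fun s x => (spaceTime T A).indicator (hv.mk _) (s, x),
    hv.stronglyMeasurable_mk.indicator hA, fun s x h => ?_, ?_⟩
  · refine indicator_of_notMem (fun h' => ?_) _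
    rcases h with h | h
    · exact h h'.1
    · exact h h'.2
  · filter_upwards [hv.ae_eq_mk, ae_restrict_mem hA] with z hz hzA
    rw [hz]
    exact indicator_of_mem hzA _

/-- Weak gradients do not depend on the representatives. -/
lemma HasWeakGradient.congr_ae {B : Set R3} {v w : R3 → R3}
    {g h : R3 → R3 →L[ℝ] R3} (H : HasWeakGradient B v g) (hv : v =ᵐ[volume.restrict B] w)
    (hg : g =ᵐ[volume.restrict B] h) : HasWeakGradient B w h := by
  have hloc : ∀ {F : Type} [NormedAddCommGroup F] {f k : R3 → F},
      LocallyIntegrableOn f B → f =ᵐ[volume.restrict B] k → LocallyIntegrableOn k B := by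
    intro F _ f k hf hfk x hx
    obtain ⟨s, hs, hfs⟩ := hf x hx
    refine ⟨s ∩ B, inter_mem hs self_mem_nhdsWithin, ?_⟩
    exact (hfs.mono_set inter_subset_left).congr_fun_ae
      (ae_restrict_of_ae_restrict_of_subset inter_subset_right hfk)
  refine ⟨hloc H.locallyIntegrableOn hv, hloc H.locallyIntegrableOn_grad hg,
    fun ψ h1 h2 h3 e => ?_⟩
  have e1 : ∫ x in B, (fderiv ℝ ψ x e) • w x = ∫ x in B, (fderiv ℝ ψ x e) • v x := by
    refine integral_congr_ae ?_
    filter_upwards [hv] with x hx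
    rw [hx]
  have e2 : ∫ x in B, ψ x • h x e = ∫ x in B, ψ x • g x e := by
    refine integral_congr_ae ?_
    filter_upwards [hg] with x hx
    rw [hx]
  rw [e1, e2]
  exact H.integral_eq ψ h1 h2 h3 e

lemma eLpNorm_eq_of_ae_eq_restrict {F : Type*} [NormedAddCommGroup F] {B : Set R3} {v w : R3 → F}
    (h : v =ᵐ[volume.restrict B] w) (h0 : ∀ x ∉ B, v x = 0) (p : ℝ≥0∞) :
    eLpNorm v p = eLpNorm w p (volume.restrict B) := by
  rw [← eLpNorm_congr_ae h, eLpNorm_restrict_eq_of_support_subset]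
  intro x hx
  by_contra hxB
  exact hx (h0 x hxB)

/-- Functions in `L²(0,T; L^q(B))` on a bounded set `B` are in `L¹(0,T; L^p(B))` for `p ≤ q`. -/
lemma MemLpLq.integrable_version {F : Type*} [NormedAddCommGroup F] {T : ℝ} {B : Set R3}
    (hBv : volume B ≠ ⊤) {p q : ℝ≥0∞} (hpq : p ≤ q) (h1 : 1 ≤ p)
    (hq : q ≠ ⊤)
    {v V : ℝ → R3 → F} (hv : MemLpLq T (fun _ => B) 2 q v)
    (hV : StronglyMeasurable fun z : ℝ × R3 => V z.1 z.2)
    (hV0 : ∀ s, ∀ x ∉ B, V s x = 0)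
    (hVv : ∀ᵐ s ∂(volume.restrict (Ioo 0 T)), V s =ᵐ[volume.restrict B] v s) :
    (∀ᵐ s ∂(volume.restrict (Ioo 0 T)), MemLp (V s) p) ∧
      ∫⁻ s in Ioo 0 T, eLpNorm (V s) p < ⊤ := by
  have hp : p ≠ ⊤ := ne_top_of_le_ne_top hq hpq
  have hp0 : 0 < p.toReal := ENNReal.toReal_pos (one_pos.trans_le h1).ne' hp
  have hVs : ∀ s, StronglyMeasurable (V s) := fun s => hV.comp_measurable measurable_prodMk_left
  set a : ℝ≥0∞ := volume B ^ (1 / p.toReal - 1 / q.toReal) with ha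
  have hat : a ≠ ⊤ := ENNReal.rpow_ne_top_of_nonneg
    (sub_nonneg.2 (one_div_le_one_div_of_le hp0 (ENNReal.toReal_mono hq hpq))) hBv
  have hle : ∀ s, eLpNorm (V s) p ≤ eLpNorm (V s) q * a := by
    intro s
    have hs : Function.support (V s) ⊆ B := fun x hx => by
      by_contra hxB
      exact hx (hV0 s x hxB)
    have h := eLpNorm_le_eLpNorm_mul_rpow_measure_univ (μ := volume.restrict B) hpq
      (hVs s).aestronglyMeasurable
    rwa [eLpNorm_restrict_eq_of_support_subset hs, eLpNorm_restrict_eq_of_support_subset hs,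
      Measure.restrict_apply_univ] at h
  have heq : ∀ᵐ s ∂(volume.restrict (Ioo 0 T)),
      eLpNorm (V s) q = eLpNorm (v s) q (volume.restrict B) :=
    hVv.mono fun s hs => eLpNorm_eq_of_ae_eq_restrict hs (hV0 s) q
  refine ⟨?_, ?_⟩
  · filter_upwards [hv.memLp, heq] with s h2 h3
    have h4 : eLpNorm (V s) q < ⊤ := h3.trans_lt h2.2
    have h5 : eLpNorm (V s) q * a < ⊤ := ENNReal.mul_lt_top h4 hat.lt_top
    exact ⟨(hVs s).aestronglyMeasurable, (hle s).trans_lt h5⟩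
  · have hm : Measurable fun s => eLpNorm (V s) q :=
      TransportData.measurable_eLpNorm_slice hV (h1.trans hpq) hq
    have h2 : eLpNorm (fun s => eLpNorm (V s) q) 2 (volume.restrict (Ioo 0 T)) < ⊤ := by
      rw [eLpNorm_congr_ae heq]
      exact hv.norm_lt_top
    have ham : AEStronglyMeasurable (fun s => eLpNorm (V s) q) (volume.restrict (Ioo 0 T)) :=
      hm.aestronglyMeasurable
    have h3 := eLpNorm_le_eLpNorm_mul_rpow_measure_univ (one_le_two (α := ℝ≥0∞)) ham
    rw [eLpNorm_one_eq_lintegral_enorm] at h3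
    simp only [enorm_eq_self] at h3
    have h4 : (volume.restrict (Ioo 0 T)) univ ^
        (1 / (1 : ℝ≥0∞).toReal - 1 / (2 : ℝ≥0∞).toReal) < ⊤ := by
      refine ENNReal.rpow_lt_top_of_nonneg (by norm_num) ?_
      rw [Measure.restrict_apply_univ]
      exact measure_Ioo_lt_top.ne
    have h5 : ∫⁻ s in Ioo 0 T, eLpNorm (V s) q < ⊤ := h3.trans_lt (ENNReal.mul_lt_top h2 h4)
    refine (lintegral_mono hle).trans_lt ?_
    rw [lintegral_mul_const _ hm]
    exact ENNReal.mul_lt_top h5 hat.lt_top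

/-- The exponent conjugate to the integrability of the densities is an admissible integrability of
the velocity. -/
lemma conjExponent_le_of_hypotheses {γ₀ q : ℝ≥0∞} (hγ : 2 ≤ γ₀)
    (hq : 2 < γ₀ → 1 ≤ q ∧ q < 2 ∧ 1 / γ₀ + 1 / q ≤ 1) (hq2 : γ₀ = 2 → q = 2) :
    γ₀.HolderConjugate γ₀.conjExponent ∧ γ₀.conjExponent ≤ q ∧ q ≠ ⊤ := by
  have hc : γ₀.HolderConjugate γ₀.conjExponent :=
    ENNReal.HolderConjugate.conjExponent (one_le_two.trans hγ)
  have hinv := ENNReal.HolderConjugate.inv_add_inv_eq_one γ₀ γ₀.conjExponent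
  have hfin : γ₀⁻¹ ≠ ⊤ := ENNReal.inv_ne_top.2 (two_pos.trans_le hγ).ne'
  have hle : ∀ {a : ℝ≥0∞}, γ₀⁻¹ + a⁻¹ ≤ 1 → γ₀.conjExponent ≤ a := by
    intro a h
    rw [← hinv] at h
    exact ENNReal.inv_le_inv.1 ((ENNReal.add_le_add_iff_left hfin).1 h)
  rcases eq_or_lt_of_le hγ with h | h
  · rw [hq2 h.symm]
    refine ⟨hc, hle ?_, by simp⟩
    rw [← h, ENNReal.inv_two_add_inv_two]
  · obtain ⟨-, h2, h3⟩ := hq h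
    rw [one_div, one_div] at h3
    exact ⟨hc, hle h3, h2.ne_top⟩

/-- The data of the transport problem after the choice of jointly measurable versions. -/
lemma exists_transportData {T : ℝ} {A : ℝ → Set R3} {K B : Set R3} {ε₀ : ℝ}
    (m : MovingDomain T A K B ε₀) (hKB : K ⊆ B) {γ : Fin M → ℝ≥0∞} {γ₀ p q : ℝ≥0∞} (hγ₀ : 2 ≤ γ₀)
    (hγ : ∀ i, γ₀ ≤ γ i) [γ₀.HolderConjugate p] (hpq : p ≤ q) (hq : q ≠ ⊤)
    {r : ℝ → R3 → Fin M → ℝ} (hr : ∀ i, MemLpLq T A ⊤ (γ i) (fun t x => r t x i))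
    (hr0 : ∀ᵐ z ∂((volume : Measure (ℝ × R3)).restrict (spaceTime T A)), ∀ i, 0 ≤ r z.1 z.2 i)
    {u : ℝ → R3 → R3} {Du : ℝ → R3 → R3 →L[ℝ] R3} (hu : MemLpW1 T B 2 q u Du)
    (hcont : ∀ i, IsWeakContinuitySol T A u (fun t x => r t x i)) :
    ∃ (C : ℝ≥0∞) (R : ℝ → R3 → Fin M → ℝ) (U : ℝ → R3 → R3) (DU : ℝ → R3 → R3 →L[ℝ] R3),
      TransportData T A K B γ γ₀ p C R U DU ∧
      (∀ᵐ z ∂((volume : Measure (ℝ × R3)).restrict (spaceTime T A)), R z.1 z.2 = r z.1 z.2) ∧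
      ∀ᵐ z ∂((volume : Measure (ℝ × R3)).restrict (spaceTime T fun _ => B)),
        U z.1 z.2 = u z.1 z.2 ∧ DU z.1 z.2 = Du z.1 z.2 := by
  have hBm := m.isOpen.measurableSet
  have hBv : volume B ≠ ⊤ := m.isBounded.measure_lt_top.ne
  have hBs : MeasurableSet (spaceTime T fun _ => B) := measurableSet_Ioo.prod hBm
  have hA : ∀ s ∈ Ioo 0 T, MeasurableSet (A s) := fun s hs =>
    m.measurableSet s (Ioo_subset_Icc_self hs)
  have hp1 : 1 ≤ p := ENNReal.HolderConjugate.one_le p γ₀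
  obtain ⟨U, hU, hU0, hUu⟩ := exists_measurable_version hBs
    hu.memLpLq.integrableOn.aestronglyMeasurable
  obtain ⟨DU, hDU, hDU0, hDUu⟩ := exists_measurable_version hBs
    hu.memLpLq_grad.integrableOn.aestronglyMeasurable
  choose R' hR' hR'0 hR'r using fun i => exists_measurable_version
    (v := fun s x => r s x i) m.measurableSet_spaceTime (hr i).integrableOn.aestronglyMeasurable
  -- the maximum makes the densities nonnegative everywhere
  set R : ℝ → R3 → Fin M → ℝ := fun s x i => max 0 (R' i s x) with hR
  have hRr : ∀ᵐ z ∂((volume : Measure (ℝ × R3)).restrict (spaceTime T A)),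
      R z.1 z.2 = r z.1 z.2 := by
    filter_upwards [hr0, ae_all_iff.2 hR'r] with z h1 h2
    funext i
    simp only [hR, h2 i]
    exact max_eq_right (h1 i)
  have hR0 : ∀ s x, s ∉ Ioo 0 T ∨ x ∉ A s → R s x = 0 := by
    intro s x h
    funext i
    simp [hR, hR'0 i s x h]
  have hRs := ae_slice_of_ae_spaceTime m.measurableSet_spaceTime hA hRr
  have hUs := ae_slice_of_ae_spaceTime hBs (fun _ _ => hBm) hUu
  have hDUs := ae_slice_of_ae_spaceTime hBs (fun _ _ => hBm) hDUu
  have hUB : ∀ s, ∀ x ∉ B, U s x = 0 := fun s x hx => hU0 s x (Or.inr hx)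
  have hDUB : ∀ s, ∀ x ∉ B, DU s x = 0 := fun s x hx => hDU0 s x (Or.inr hx)
  obtain ⟨u1, u2⟩ := hu.memLpLq.integrable_version hBv hpq hp1 hq hU hUB hUs
  obtain ⟨g1, g2⟩ := hu.memLpLq_grad.integrable_version hBv hpq hp1 hq hDU hDUB hDUs
  set C : Fin M → ℝ≥0∞ := fun i => eLpNorm (fun t => eLpNorm (fun x => r t x i) (γ i)
    (volume.restrict (A t))) ⊤ (volume.restrict (Ioo 0 T)) with hC
  refine ⟨∑ i, C i, R, U, DU, ⟨?_, fun s x i => le_max_left _ _, hR0, ?_, ?_, hγ₀, hp1,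
    ne_top_of_le_ne_top hq hpq, hγ, hU, hDU, hUB, hDUB, ?_, u1.and g1, ?_, ?_⟩, hRr, hUu.and hDUu⟩
  · exact (measurable_pi_lambda _ fun i =>
      measurable_const.max (hR' i).measurable).stronglyMeasurable
  · have hb : ∀ i, ∀ᵐ s ∂(volume.restrict (Ioo 0 T)),
        eLpNorm (fun x => r s x i) (γ i) (volume.restrict (A s)) ≤ C i := fun i => by
      simp only [hC, eLpNorm_exponent_top]
      exact ae_le_eLpNormEssSup
    filter_upwards [ae_all_iff.2 hb, hRs] with s h1 h2 i
    have h3 : (fun x => R s x i) =ᵐ[volume.restrict (A s)] fun x => r s x i := by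
      filter_upwards [h2] with x hx
      rw [hx]
    rw [eLpNorm_eq_of_ae_eq_restrict h3 (fun x hx => by rw [hR0 s x (Or.inr hx)]; rfl)]
    exact (h1 i).trans (Finset.single_le_sum (f := C) (fun _ _ => zero_le) (Finset.mem_univ i))
  · exact (ENNReal.sum_lt_top.2 fun i _ => (hr i).norm_lt_top).ne
  · filter_upwards [hu.weakGradient, hUs, hDUs] with s h1 h2 h3
    exact h1.congr_ae (EventuallyEq.symm h2) (EventuallyEq.symm h3)
  · rw [lintegral_add_left (TransportData.measurable_eLpNorm_slice hU hp1
      (ne_top_of_le_ne_top hq hpq))]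
    exact ENNReal.add_lt_top.2 ⟨u2, g2⟩
  · intro i ϕ h1 h2 h3
    refine Eq.trans ?_ (hcont i ϕ h1 h2 h3)
    rw [intervalIntegral.integral_of_le m.pos.le, integral_Ioc_eq_integral_Ioo]
    refine integral_congr_ae ?_
    filter_upwards [hRs, hUs, ae_restrict_mem measurableSet_Ioo] with s e1 e2 hsT
    rw [← setIntegral_eq_integral_of_forall_compl_eq_zero (s := A s)
      (fun x hx => by rw [hR0 s x (Or.inr hx)]; simp)]
    refine integral_congr_ae ?_
    filter_upwards [e1, ae_restrict_of_ae_restrict_of_subset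
      ((m.subset s (Ioo_subset_Icc_self hsT)).trans hKB) e2] with x k1 k2
    simp only [transport] at k1 k2 ⊢
    rw [k1, k2]

/-- Existence of the renormalized representative, for a general moving domain. The exponent `p` of
the velocity is conjugate to the exponent `γ₀` of the densities, which makes products of densities
with the velocity and with its gradient integrable. -/
theorem exists_renormalized_representative {T : ℝ} {A : ℝ → Set R3} {K B : Set R3} {ε₀ : ℝ}
    (m : MovingDomain T A K B ε₀) (hKB : K ⊆ B) {γ : Fin M → ℝ≥0∞} {γ₀ p q : ℝ≥0∞} (hγ₀ : 2 ≤ γ₀)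
    (hγ : ∀ i, γ₀ ≤ γ i) [γ₀.HolderConjugate p] (hpq : p ≤ q) (hq : q ≠ ⊤)
    {r : ℝ → R3 → Fin M → ℝ} (hr : ∀ i, MemLpLq T A ⊤ (γ i) (fun t x => r t x i))
    (hr0 : ∀ᵐ z ∂((volume : Measure (ℝ × R3)).restrict (spaceTime T A)), ∀ i, 0 ≤ r z.1 z.2 i)
    {u : ℝ → R3 → R3} {Du : ℝ → R3 → R3 →L[ℝ] R3} (hu : MemLpW1 T B 2 q u Du)
    (hcont : ∀ i, IsWeakContinuitySol T A u (fun t x => r t x i)) :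
    ∃ r' : ℝ → R3 → Fin M → ℝ,
      (∀ᵐ z ∂((volume : Measure (ℝ × R3)).restrict (spaceTime T A)),
        r' z.1 z.2 = r z.1 z.2) ∧
      (∀ t ∈ Icc (0 : ℝ) T,
        (∀ i, MemLp (fun x => r' t x i) (γ i) (volume.restrict (A t))) ∧
        ∀ᵐ x ∂((volume : Measure R3).restrict (A t)), ∀ i, 0 ≤ r' t x i) ∧
      ∀ 𝓑 : (Fin M → ℝ) → ℝ, IsRenormalizer 𝓑 → IsRenormalizedSol T A u Du 𝓑 r' := by
  obtain ⟨C, R, U, DU, d, hRr, hUu⟩ :=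
    exists_transportData m hKB hγ₀ hγ (p := p) hpq hq hr hr0 hu hcont
  have hpos := m.radius_pos
  set ε : ℕ → ℝ := fun n => ε₀ * (1 / ((n : ℝ) + 1)) with hε
  have hε0 : ∀ n, 0 < ε n := fun n => by positivity
  have hε1 : ∀ n, ε n ≤ ε₀ := fun n => by
    have h1 : 1 / ((n : ℝ) + 1) ≤ 1 := by
      rw [div_le_one (by positivity)]
      linarith [Nat.cast_nonneg (α := ℝ) n]
    calc ε n ≤ ε₀ * 1 := mul_le_mul_of_nonneg_left h1 hpos.le
      _ = ε₀ := mul_one _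
  have hεt : Tendsto ε atTop (𝓝 0) := by
    have h := (tendsto_one_div_add_atTop_nhds_zero_nat (𝕜 := ℝ)).const_mul ε₀
    rwa [mul_zero] at h
  obtain ⟨c, r', hr'R, hr'⟩ := d.exists_representative m hε0
  have hBm := m.isOpen.measurableSet
  have hBs : MeasurableSet (spaceTime T fun _ => B) := measurableSet_Ioo.prod hBm
  have hA : ∀ s ∈ Ioo 0 T, MeasurableSet (A s) := fun s hs =>
    m.measurableSet s (Ioo_subset_Icc_self hs)
  have hAB : ∀ s ∈ Icc 0 T, A s ⊆ B := fun s hs => (m.subset s hs).trans hKB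
  have hz := ae_spaceTime_of_ae (A := A) hr'R
  have hUu' : ∀ᵐ z ∂((volume : Measure (ℝ × R3)).restrict (spaceTime T A)),
      U z.1 z.2 = u z.1 z.2 ∧ DU z.1 z.2 = Du z.1 z.2 := by
    have hsub : spaceTime T A ⊆ spaceTime T fun _ => B := fun z hz =>
      ⟨hz.1, hAB z.1 (Ioo_subset_Icc_self hz.1) hz.2⟩
    exact ae_restrict_of_ae_restrict_of_subset hsub hUu
  refine ⟨r', ?_, fun t ht => ?_, fun 𝓑 h𝓑 ϕ hϕ => ?_⟩
  · filter_upwards [hz, hRr] with z h1 h2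
    rw [h1, h2]
  · obtain ⟨k1, k2, -, k4, -⟩ := hr' t ht
    refine ⟨fun i => ⟨?_, ?_⟩, Eventually.of_forall k2⟩
    · exact ((measurable_pi_apply i).comp k1.measurable).aestronglyMeasurable
    · exact ((eLpNorm_restrict_le _ _ _ _).trans (k4 i)).trans_lt d.bound_ne_top.lt_top
  obtain ⟨Cb, Z, b⟩ := exists_renormTest h𝓑 m.pos hϕ
    (m.isCompact.cthickening (r := ε₀))
  -- the integrands agree almost everywhere
  have hpt : ∀ s x, r' s x = R s x → U s x = u s x ∧ DU s x = Du s x →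
      renormIntegrand 𝓑 R U DU ϕ s x = renormIntegrand 𝓑 r' u Du ϕ s x := by
    intro s x h1 h2
    simp only [renormIntegrand, transport, h1, h2.1, h2.2]
  have hzero : ∀ s, ∀ x ∉ A s, renormIntegrand 𝓑 R U DU ϕ s x = 0 := by
    intro s x hx
    rw [renormIntegrand, d.density_zero s x (Or.inr hx), h𝓑.map_zero]
    simp
  refine ⟨?_, fun t ht => ⟨?_, ?_⟩⟩
  · have h1 := d.integrable_renormIntegrand m b
    rw [← Measure.restrict_univ (μ := (volume : Measure R3)), Measure.prod_restrict,
      ← Measure.volume_eq_prod] at h1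
    have h2 : IntegrableOn (fun z : ℝ × R3 => renormIntegrand 𝓑 R U DU ϕ z.1 z.2)
        (spaceTime T A) := IntegrableOn.mono_set h1 fun z hz => ⟨hz.1, mem_univ _⟩
    refine h2.congr_fun_ae ?_
    filter_upwards [hz, hUu'] with z k1 k2
    exact hpt _ _ (congrFun k1 _) k2
  · obtain ⟨k1, k2, k3, k4, -⟩ := hr' t ht
    have hK : ∀ x ∉ K, r' t x = 0 := fun x hx => k3 x fun h => hx (m.subset t ht h)
    obtain ⟨C', hC', hb⟩ := exists_eLpNorm_le m.isCompact le_rfl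
      (fun i => d.one_le.trans (hγ i)) d.bound_ne_top
    have hi : Integrable (r' t) := memLp_one_iff_integrable.1
      ⟨k1.aestronglyMeasurable, (hb _ k1 hK k4).1.trans_lt hC'.lt_top⟩
    refine Integrable.integrableOn ((hi.norm.const_mul (Cb * Z)).mono'
      ((h𝓑.stronglyMeasurable_comp k1 k2).mul (contDiff_slice_of_contDiffOn_Icc hϕ
        ht).continuous.stronglyMeasurable).aestronglyMeasurable (Eventually.of_forall fun x => ?_))
    by_cases hx : x ∈ K
    · have hxN : x ∈ Metric.cthickening ε₀ K := by
        simpa using MovingDomain.add_mem_cthickening (h := 0) hx (by simpa using hpos.le)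
      rw [norm_mul]
      calc _ ≤ (Cb * ‖r' t x‖) * Z := mul_le_mul (b.norm_renorm_le (k2 x)) (b.test_le t ht x hxN)
            (norm_nonneg _) (mul_nonneg b.Cb_nonneg (norm_nonneg _))
        _ = _ := by ring
    · rw [hK x hx, h𝓑.map_zero]
      simp
  · have h1 := d.integral_renormIntegrand m b hε0 hε1 hεt hr'R hr' ht
    have h3 : ∀ t ∈ Icc 0 T, ∫ x in A t, 𝓑 (r' t x) * ϕ (t, x) = ∫ x, 𝓑 (r' t x) * ϕ (t, x) := by
      intro t ht
      refine setIntegral_eq_integral_of_forall_compl_eq_zero fun x hx => ?_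
      rw [(hr' t ht).2.2.1 x hx, h𝓑.map_zero, zero_mul]
    rw [h3 t ht, h3 0 (left_mem_Icc.2 m.pos.le), ← h1, intervalIntegral.integral_of_le ht.1,
      integral_Ioc_eq_integral_Ioo]
    refine integral_congr_ae ?_
    have hsub : Ioo 0 t ⊆ Ioo 0 T := Ioo_subset_Ioo_right ht.2
    filter_upwards [ae_restrict_of_ae_restrict_of_subset hsub hr'R,
      ae_restrict_of_ae_restrict_of_subset hsub
        (ae_slice_of_ae_spaceTime m.measurableSet_spaceTime hA hUu')] with s e1 e2
    rw [← setIntegral_eq_integral_of_forall_compl_eq_zero (s := A s) (hzero s)]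
    refine integral_congr_ae ?_
    filter_upwards [e2] with x k2
    exact (hpt s x (congrFun e1 x) k2).symm

end

/-! ### The cut-off function -/

namespace CutoffData

variable {a b : ℝ} (c : CutoffData a b)

lemma ramp_eq (x : ℝ) :
    c.ramp x = max 0 (min 1 (min ((x - c.m₂) / -c.m₁) ((c.M₂ - x) / c.M₁))) := by
  have h1 := c.m₂_lt
  have h2 := c.m₁_lt
  have h3 := c.m_neg
  have h4 := c.M_pos
  have h5 := c.M_lt
  have h6 := c.M₁_lt
  have hm : 0 < -c.m₁ := by linarith
  have hM : 0 < c.M₁ := by linarith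
  have e1 : 1 - (x - c.m₂ + c.m₁) / c.m₁ = (x - c.m₂) / -c.m₁ := by
    have : c.m₁ ≠ 0 := by linarith
    field_simp
    ring
  have e2 : 1 - (x - c.M₂ + c.M₁) / c.M₁ = (c.M₂ - x) / c.M₁ := by
    field_simp
    ring
  rw [ramp, e1, e2]
  split_ifs with i1 i2 i3 i4
  · refine (max_eq_left ?_).symm
    refine (min_le_right _ _).trans ((min_le_left _ _).trans ?_)
    exact div_nonpos_of_nonpos_of_nonneg (by linarith) hm.le
  · have k1 : (x - c.m₂) / -c.m₁ ≤ 1 := by rw [div_le_one hm]; linarith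
    have k2 : 1 ≤ (c.M₂ - x) / c.M₁ := by rw [one_le_div hM]; linarith
    rw [min_eq_left (k1.trans k2), min_eq_right k1, max_eq_right]
    exact div_nonneg (by linarith) hm.le
  · have k1 : 1 ≤ (x - c.m₂) / -c.m₁ := by rw [one_le_div hm]; linarith
    have k2 : 1 ≤ (c.M₂ - x) / c.M₁ := by rw [one_le_div hM]; linarith
    rw [min_eq_left (le_min k1 k2), max_eq_right zero_le_one]
  · have k1 : 1 ≤ (x - c.m₂) / -c.m₁ := by rw [one_le_div hm]; linarith
    have k2 : (c.M₂ - x) / c.M₁ ≤ 1 := by rw [div_le_one hM]; linarith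
    rw [min_eq_right (k2.trans k1), min_eq_right k2, max_eq_right]
    exact div_nonneg (by linarith) hM.le
  · refine (max_eq_left ?_).symm
    refine (min_le_right _ _).trans ((min_le_right _ _).trans ?_)
    exact div_nonpos_of_nonpos_of_nonneg (by linarith) hM.le

lemma continuous_ramp : Continuous c.ramp := by
  have : c.ramp = fun x => max 0 (min 1 (min ((x - c.m₂) / -c.m₁) ((c.M₂ - x) / c.M₁))) :=
    funext c.ramp_eq
  rw [this]
  fun_prop

/-- The slopes of the ramp are at most `1 / |m₁|`. -/
lemma ramp_le_add {x y : ℝ} (h : x ≤ y) : c.ramp y ≤ c.ramp x + (y - x) / -c.m₁ := by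
  have hm : 0 < -c.m₁ := by linarith [c.m₁_lt, c.m_neg]
  have hM : 0 < c.M₁ := by linarith [c.M_lt, c.M_pos]
  have hd : 0 ≤ (y - x) / -c.m₁ := div_nonneg (by linarith) hm.le
  rw [ramp_eq, ramp_eq, max_add, min_add, min_add]
  refine max_le_max (by linarith) (min_le_min (by linarith) (min_le_min ?_ ?_))
  · rw [← add_div]
    exact div_le_div_of_nonneg_right (by linarith) hm.le
  · have : (c.M₂ - y) / c.M₁ ≤ (c.M₂ - x) / c.M₁ :=
      div_le_div_of_nonneg_right (by linarith) hM.le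
    linarith

/-- The slopes of the ramp are at least `-1 / M₁`. -/
lemma le_ramp_add {x y : ℝ} (h : x ≤ y) : c.ramp x ≤ c.ramp y + (y - x) / c.M₁ := by
  have hm : 0 < -c.m₁ := by linarith [c.m₁_lt, c.m_neg]
  have hM : 0 < c.M₁ := by linarith [c.M_lt, c.M_pos]
  have hd : 0 ≤ (y - x) / c.M₁ := div_nonneg (by linarith) hM.le
  rw [ramp_eq, ramp_eq, max_add, min_add, min_add]
  refine max_le_max (by linarith) (min_le_min (by linarith) (min_le_min ?_ ?_))
  · have : (x - c.m₂) / -c.m₁ ≤ (y - c.m₂) / -c.m₁ :=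
      div_le_div_of_nonneg_right (by linarith) hm.le
    linarith
  · rw [← add_div]
    exact div_le_div_of_nonneg_right (by linarith) hM.le

lemma ker_eq_zero {x : ℝ} (h : x ∉ Ioo (-c.α) c.α) : c.ker x = 0 :=
  image_eq_zero_of_notMem_tsupport fun h' => h (c.ker_tsupport h')

lemma hasCompactSupport_ker : HasCompactSupport c.ker :=
  HasCompactSupport.of_support_subset_isCompact (isCompact_Icc (a := -c.α) (b := c.α))
    fun x hx => by
    by_contra h
    exact hx (c.ker_eq_zero fun h' => h (Ioo_subset_Icc_self h'))

lemma integrable_ker : Integrable c.ker :=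
  c.ker_contDiff.continuous.integrable_of_hasCompactSupport c.hasCompactSupport_ker

lemma integrable_ramp_mul_ker (x : ℝ) : Integrable fun y => c.ramp (x - y) * c.ker y :=
  ((c.continuous_ramp.comp (continuous_const.sub continuous_id)).mul
    c.ker_contDiff.continuous).integrable_of_hasCompactSupport c.hasCompactSupport_ker.mul_left

lemma cutoff_le_add {x y : ℝ} (h : x ≤ y) : c.cutoff y ≤ c.cutoff x + (y - x) / -c.m₁ := by
  have e : c.cutoff x + (y - x) / -c.m₁ =
      ∫ w, (c.ramp (x - w) * c.ker w + (y - x) / -c.m₁ * c.ker w) := by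
    rw [integral_add (c.integrable_ramp_mul_ker x) (c.integrable_ker.const_mul _),
      integral_const_mul, c.ker_integral, mul_one, cutoff]
  rw [e]
  refine integral_mono (c.integrable_ramp_mul_ker y) ((c.integrable_ramp_mul_ker x).add
    (c.integrable_ker.const_mul _)) fun w => ?_
  have h1 := c.ramp_le_add (x := x - w) (y := y - w) (by linarith)
  rw [sub_sub_sub_cancel_right] at h1
  rw [← add_mul]
  exact mul_le_mul_of_nonneg_right h1 (c.ker_nonneg w)

lemma le_cutoff_add {x y : ℝ} (h : x ≤ y) : c.cutoff x ≤ c.cutoff y + (y - x) / c.M₁ := by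
  have e : c.cutoff y + (y - x) / c.M₁ =
      ∫ w, (c.ramp (y - w) * c.ker w + (y - x) / c.M₁ * c.ker w) := by
    rw [integral_add (c.integrable_ramp_mul_ker y) (c.integrable_ker.const_mul _),
      integral_const_mul, c.ker_integral, mul_one, cutoff]
  rw [e]
  refine integral_mono (c.integrable_ramp_mul_ker x) ((c.integrable_ramp_mul_ker y).add
    (c.integrable_ker.const_mul _)) fun w => ?_
  have h1 := c.le_ramp_add (x := x - w) (y := y - w) (by linarith)
  rw [sub_sub_sub_cancel_right] at h1
  rw [← add_mul]
  exact mul_le_mul_of_nonneg_right h1 (c.ker_nonneg w)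

lemma cutoff_zero : c.cutoff 0 = 1 := by
  rw [cutoff, ← c.ker_integral]
  refine integral_congr_ae (Eventually.of_forall fun y => ?_)
  by_cases hy : y ∈ Ioo (-c.α) c.α
  · have h1 := c.m₂_lt
    have h2 := c.m₁_lt
    have h3 := c.m_neg
    have h4 := c.M_pos
    have h5 := c.M_lt
    have h6 := c.M₁_lt
    have h7 := c.α_lt
    have h8 := min_le_left (c.m₁ - c.m₂) (c.M₂ - c.M₁)
    have h9 := min_le_right (c.m₁ - c.m₂) (c.M₂ - c.M₁)
    have hm : 0 < -c.m₁ := by linarith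
    have hM : 0 < c.M₁ := by linarith
    have k1 : 1 ≤ (0 - y - c.m₂) / -c.m₁ := by rw [one_le_div hm]; linarith [hy.1, hy.2]
    have k2 : 1 ≤ (c.M₂ - (0 - y)) / c.M₁ := by rw [one_le_div hM]; linarith [hy.1, hy.2]
    simp only [ramp_eq]
    rw [min_eq_left (le_min k1 k2), max_eq_right zero_le_one, one_mul]
  · simp [c.ker_eq_zero hy]

lemma cutoff_eq_zero {x : ℝ} (hx : x ≤ c.m₂ - c.α) : c.cutoff x = 0 := by
  rw [cutoff]
  refine integral_eq_zero_of_ae (Eventually.of_forall fun y => ?_)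
  by_cases hy : y ∈ Ioo (-c.α) c.α
  · have : c.ramp (x - y) = 0 := by
      rw [ramp, if_pos]
      linarith [hy.1]
    simp [this]
  · simp [c.ker_eq_zero hy]

/-- The normal displacement `z ↦ z + f(z) e` is strictly increasing if `m ≤ e ≤ M`: the slopes of
the cut-off function lie between `-1 / M₁` and `1 / |m₁|`. -/
lemma strictMono_displacement {e : ℝ} (he : e ∈ Icc c.m c.M) :
    StrictMono fun z => z + c.cutoff z * e := by
  intro x y hxy
  have hm : 0 < -c.m₁ := by linarith [c.m₁_lt, c.m_neg]
  have hM : 0 < c.M₁ := by linarith [c.M_lt, c.M_pos]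
  have h1 := c.cutoff_le_add hxy.le
  have h2 := c.le_cutoff_add hxy.le
  have hd : 0 < y - x := by linarith
  suffices (c.cutoff x - c.cutoff y) * e < y - x by
    simp only
    linarith
  rcases le_or_gt 0 e with h0 | h0
  · calc (c.cutoff x - c.cutoff y) * e ≤ (y - x) / c.M₁ * e :=
          mul_le_mul_of_nonneg_right (by linarith) h0
      _ = (y - x) * (e / c.M₁) := by ring
      _ < (y - x) * 1 := by
          refine mul_lt_mul_of_pos_left ?_ hd
          rw [div_lt_one hM]
          linarith [he.2, c.M_lt]
      _ = y - x := mul_one _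
  · calc (c.cutoff x - c.cutoff y) * e = (c.cutoff y - c.cutoff x) * -e := by ring
      _ ≤ (y - x) / -c.m₁ * -e := mul_le_mul_of_nonneg_right (by linarith) (by linarith)
      _ = (y - x) * (-e / -c.m₁) := by ring
      _ < (y - x) * 1 := by
          refine mul_lt_mul_of_pos_left ?_ hd
          rw [div_lt_one hm]
          linarith [he.1, c.m₁_lt]
      _ = y - x := mul_one _

lemma continuous_cutoff : Continuous c.cutoff := by
  have hm : 0 < -c.m₁ := by linarith [c.m₁_lt, c.m_neg]
  have hM : 0 < c.M₁ := by linarith [c.M_lt, c.M_pos]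
  set L : ℝ := 1 / -c.m₁ + 1 / c.M₁ with hL
  have key : ∀ x y, x ≤ y → |c.cutoff x - c.cutoff y| ≤ L * |x - y| := by
    intro x y hxy
    have h1 := c.cutoff_le_add hxy
    have h2 := c.le_cutoff_add hxy
    have h3 : 0 ≤ (y - x) / -c.m₁ := div_nonneg (by linarith) hm.le
    have h4 : 0 ≤ (y - x) / c.M₁ := div_nonneg (by linarith) hM.le
    have h5 : L * |x - y| = (y - x) / -c.m₁ + (y - x) / c.M₁ := by
      rw [abs_sub_comm, abs_of_nonneg (by linarith : 0 ≤ y - x), hL]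
      ring
    rw [h5, abs_le]
    constructor <;> linarith
  have hL0 : 0 ≤ L := by positivity
  refine (LipschitzWith.of_dist_le_mul (K := ⟨L, hL0⟩) fun x y => ?_).continuous
  rw [Real.dist_eq, Real.dist_eq]
  rcases le_total x y with h | h
  · exact key x y h
  · rw [abs_sub_comm, abs_sub_comm x y]
    exact key y x h

/-- The normal displacement maps `(a, 0)` onto `(a, e)`. -/
lemma image_displacement (ha : a < 0) {e : ℝ} (he : e ∈ Icc c.m c.M) :
    (fun z => z + c.cutoff z * e) '' Ioo a 0 = Ioo a e := by
  have hmono := c.strictMono_displacement he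
  have hcont : Continuous fun z => z + c.cutoff z * e :=
    continuous_id.add (c.continuous_cutoff.mul continuous_const)
  have h0 : c.cutoff 0 = 1 := c.cutoff_zero
  have h1 : c.cutoff a = 0 := c.cutoff_eq_zero c.lt_left.le
  refine Subset.antisymm ?_ ?_
  · rintro _ ⟨z, hz, rfl⟩
    have k1 := hmono hz.1
    have k2 := hmono hz.2
    simp only [h0, h1, zero_mul, add_zero, one_mul, zero_add] at k1 k2
    exact ⟨k1, k2⟩
  · have h := intermediate_value_Ioo ha.le hcont.continuousOn
    simpa only [h0, h1, zero_mul, add_zero, one_mul, zero_add] using h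

end CutoffData

noncomputable section

/-! ### Normal coordinates -/

/-- The closed fundamental cell of the torus. -/
def closedCell : Set R2 := {y | ∀ i, y i ∈ Icc (0 : ℝ) 1}

lemma isCompact_closedCell : IsCompact closedCell := by
  have h : closedCell = (EuclideanSpace.equiv (Fin 2) ℝ).toHomeomorph ⁻¹'
      (univ.pi fun _ => Icc (0 : ℝ) 1) := by
    ext y
    simp [closedCell, Pi.le_def, forall_and]
  rw [h]
  exact ((EuclideanSpace.equiv (Fin 2) ℝ).toHomeomorph.isCompact_preimage).2
    (isCompact_univ_pi fun _ => isCompact_Icc)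

lemma exists_mem_closedCell (y : R2) : ∃ w ∈ closedCell, TorusEq y w := by
  refine ⟨WithLp.toLp 2 fun i => Int.fract (y i), fun i => ?_, fun i => ⟨⌊y i⌋, ?_⟩⟩
  · exact ⟨Int.fract_nonneg _, (Int.fract_lt_one _).le⟩
  · exact Int.self_sub_fract (y i)

lemma TorusPeriodic.fderiv {f : R2 → R3} (hf : TorusPeriodic f) :
    TorusPeriodic (_root_.fderiv ℝ f) := by
  intro x y hxy
  have h : f = fun w => f (w + (x - y)) := by
    funext w
    refine (hf _ _ fun i => ?_).symm
    obtain ⟨n, hn⟩ := hxy i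
    exact ⟨n, by simp [← hn]⟩
  have h2 := fderiv_comp_add_right (𝕜 := ℝ) (f := f) (x := y) (x - y)
  rw [← h] at h2
  rw [h2]
  simp

lemma contDiff_cross3 {v w : R2 → R3} {n : ℕ∞ω} (hv : ContDiff ℝ n v) (hw : ContDiff ℝ n w) :
    ContDiff ℝ n fun y => cross3 (v y) (w y) := by
  rw [contDiff_euclidean] at hv hw ⊢
  intro i
  have h0 := hv 0
  have h1 := hv 1
  have h2 := hv 2
  have k0 := hw 0
  have k1 := hw 1
  have k2 := hw 2
  fin_cases i <;> simp [cross3, crossProduct] <;> fun_prop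

namespace ReferenceDomain

variable (D : ReferenceDomain)

lemma contDiff_normalVector : ContDiff ℝ 1 (normalVector D.φ) := by
  have h : ContDiff ℝ 1 (fderiv ℝ D.φ) := D.contDiff.fderiv_right (by norm_num)
  exact contDiff_cross3 (h.clm_apply contDiff_const) (h.clm_apply contDiff_const)

lemma contDiff_ν : ContDiff ℝ 1 D.ν := by
  have h := D.contDiff_normalVector
  exact ((h.norm ℝ D.immersion).inv fun y => norm_ne_zero_iff.2 (D.immersion y)).smul h

lemma periodic_ν : TorusPeriodic D.ν := by
  intro x y hxy
  have h := D.periodic.fderiv x y hxy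
  simp only [ν, unitNormal, normalVector, h]

/-- The normal coordinates as a map: `(y, z) ↦ φ(y) + z ν(y)`. -/
def tubeMap (w : R2 × ℝ) : R3 := D.φ w.1 + w.2 • D.ν w.1

lemma contDiff_tubeMap : ContDiff ℝ 1 D.tubeMap :=
  ((D.contDiff.of_le (by norm_num)).comp contDiff_fst).add
    (contDiff_snd.smul (D.contDiff_ν.comp contDiff_fst))

lemma tubeMap_congr {x y : R2} (h : TorusEq x y) (z : ℝ) : D.tubeMap (x, z) = D.tubeMap (y, z) := by
  simp only [tubeMap, D.periodic x y h, D.periodic_ν x y h]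

lemma tube_eq_image (I : Set ℝ) : D.tube I = D.tubeMap '' (univ ×ˢ I) := by
  ext x
  constructor
  · rintro ⟨y, z, hz, rfl⟩
    exact ⟨(y, z), ⟨mem_univ _, hz⟩, rfl⟩
  · rintro ⟨⟨y, z⟩, ⟨-, hz⟩, rfl⟩
    exact ⟨y, z, hz, rfl⟩

lemma tube_eq_image_closedCell (I : Set ℝ) : D.tube I = D.tubeMap '' (closedCell ×ˢ I) := by
  rw [tube_eq_image]
  refine Subset.antisymm ?_ (image_mono (prod_mono_left (subset_univ _)))
  rintro _ ⟨⟨y, z⟩, ⟨-, hz⟩, rfl⟩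
  obtain ⟨w, hw, hyw⟩ := exists_mem_closedCell y
  exact ⟨(w, z), ⟨hw, hz⟩, (D.tubeMap_congr hyw z).symm⟩

lemma isCompact_tube_Icc (z₁ z₂ : ℝ) : IsCompact (D.tube (Icc z₁ z₂)) := by
  rw [tube_eq_image_closedCell]
  exact (isCompact_closedCell.prod isCompact_Icc).image D.contDiff_tubeMap.continuous

lemma tubeMap_mem_tube {y : R2} {z : ℝ} {I : Set ℝ} (hz : z ∈ I) : D.tubeMap (y, z) ∈ D.tube I :=
  ⟨y, z, hz, rfl⟩

lemma tubeMap_notMem {y : R2} {z : ℝ} (h0 : 0 ≤ z) (hb : z < D.b) : D.tubeMap (y, z) ∉ D.Ω := by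
  rcases h0.eq_or_lt with rfl | h
  · intro hmem
    have h1 : D.φ y ∈ frontier D.Ω := by rw [D.frontier_eq]; exact mem_range_self y
    rw [D.isOpen.frontier_eq] at h1
    exact h1.2 (by simpa [tubeMap] using hmem)
  · exact D.outer y z ⟨h, hb⟩

lemma tubeMap_mem {y : R2} {z : ℝ} (ha : D.a < z) (h0 : z < 0) : D.tubeMap (y, z) ∈ D.Ω :=
  D.inner y z ⟨ha, h0⟩

lemma tubeCoord_tubeMap {y : R2} {z : ℝ} (hz : z ∈ Ioo D.a D.b) :
    TorusEq (D.tubeCoord (D.tubeMap (y, z))).1 y ∧ (D.tubeCoord (D.tubeMap (y, z))).2 = z := by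
  have h : ∃ p : R2 × ℝ, p.2 ∈ Ioo D.a D.b ∧ D.tubeMap (y, z) = D.φ p.1 + p.2 • D.ν p.1 :=
    ⟨(y, z), hz, rfl⟩
  have hs := h.choose_spec
  have heq : D.tubeCoord (D.tubeMap (y, z)) = h.choose := by
    rw [tubeCoord, dif_pos h]
  rw [heq]
  exact D.tube_injective _ _ _ hs.1 z hz hs.2.symm

variable {D} (c : CutoffData D.a D.b)

lemma flow_tubeMap {η : ℝ → R2 → ℝ} {t : ℝ} (hη : TorusPeriodic (η t)) {y : R2} {z : ℝ}
    (hz : z ∈ Ioo D.a D.b) :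
    D.flow c η t (D.tubeMap (y, z)) = D.tubeMap (y, z + c.cutoff z * η t y) := by
  obtain ⟨h1, h2⟩ := D.tubeCoord_tubeMap (y := y) hz
  rw [flow, if_pos (D.tubeMap_mem_tube hz), h2, hη _ _ h1, D.periodic_ν _ _ h1]
  simp only [tubeMap]
  rw [add_smul, add_assoc]

/-- The moving domain consists of the part of the reference domain outside of the tubular
neighbourhood and of the points whose signed distance is below the displacement. In particular, it
only depends on the displacement and not on the choice of the cut-off function. -/
lemma moving_eq {η : ℝ → R2 → ℝ} {t : ℝ} (hη : TorusPeriodic (η t))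
    (hb : ∀ y, η t y ∈ Icc c.m c.M) :
    D.moving c η t = D.Ω \ D.tube (Ioo D.a D.b) ∪
      D.tubeMap '' {w | D.a < w.2 ∧ w.2 < η t w.1} := by
  have hdecomp : ∀ x ∈ D.Ω, x ∈ D.tube (Ioo D.a D.b) →
      ∃ y, ∃ z ∈ Ioo D.a 0, x = D.tubeMap (y, z) := by
    rintro _ hx ⟨y, z, hz, rfl⟩
    refine ⟨y, z, ⟨hz.1, ?_⟩, rfl⟩
    by_contra h
    exact D.tubeMap_notMem (not_lt.1 h) hz.2 hx
  have hab : ∀ {z : ℝ}, z ∈ Ioo D.a 0 → z ∈ Ioo D.a D.b := fun hz => ⟨hz.1, hz.2.trans D.b_pos⟩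
  refine Subset.antisymm ?_ ?_
  · rintro _ ⟨x, hx, rfl⟩
    by_cases hxt : x ∈ D.tube (Ioo D.a D.b)
    · obtain ⟨y, z, hz, rfl⟩ := hdecomp x hx hxt
      right
      rw [flow_tubeMap c hη (hab hz)]
      have h : z + c.cutoff z * η t y ∈ Ioo D.a (η t y) := by
        rw [← c.image_displacement D.a_neg (hb y)]
        exact ⟨z, hz, rfl⟩
      exact ⟨(y, z + c.cutoff z * η t y), h, rfl⟩
    · left
      rw [flow, if_neg hxt]
      exact ⟨hx, hxt⟩
  · rintro _ (⟨hx, hxt⟩ | ⟨⟨y, z⟩, hz, rfl⟩)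
    · exact ⟨_, hx, by rw [flow, if_neg hxt]⟩
    · have h : z ∈ Ioo D.a (η t y) := hz
      rw [← c.image_displacement D.a_neg (hb y)] at h
      obtain ⟨w, hw, hwz⟩ := h
      refine ⟨D.tubeMap (y, w), D.tubeMap_mem hw.1 hw.2, ?_⟩
      rw [flow_tubeMap c hη (hab hw)]
      exact congrArg (fun q => D.tubeMap (y, q)) hwz

end ReferenceDomain

end

noncomputable section

/-! ### The moving domain -/

/-- Open sets have measurable images under continuous maps, since they are `σ`-compact. -/
lemma measurableSet_image_of_isOpen {X Y : Type*} [MetricSpace X] [ProperSpace X] [MetricSpace Y]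
    [MeasurableSpace Y] [BorelSpace Y] {f : X → Y} (hf : Continuous f) {s : Set X}
    (hs : IsOpen s) : MeasurableSet (f '' s) := by
  obtain ⟨F, hFc, -, hF, -⟩ := hs.exists_iUnion_isClosed
  have h : IsSigmaCompact s := by
    rw [← hF]
    exact isSigmaCompact_iUnion F fun n =>
      IsSigmaCompact.of_isClosed_subset isSigmaCompact_univ (hFc n) (subset_univ _)
  obtain ⟨K, hK, hKs⟩ := h.image hf
  rw [← hKs]
  exact MeasurableSet.iUnion fun n => (hK n).isClosed.measurableSet

/-- The image of a graph under a differentiable map from a product to the space is a null set. -/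
lemma volume_image_graph {f : R2 × ℝ → R3} (hf : Differentiable ℝ f) {h : R2 → ℝ}
    (hh : Continuous h) : volume (f '' {w | w.2 = h w.1}) = 0 := by
  have hclosed : IsClosed {w : R2 × ℝ | w.2 = h w.1} :=
    isClosed_eq continuous_snd (hh.comp continuous_fst)
  have hgraph : (volume : Measure (R2 × ℝ)) {w | w.2 = h w.1} = 0 := by
    rw [Measure.volume_eq_prod, Measure.measure_prod_null hclosed.measurableSet]
    refine Eventually.of_forall fun y => ?_
    have : Prod.mk y ⁻¹' {w : R2 × ℝ | w.2 = h w.1} = {h y} := by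
      ext z
      simp
    change volume (Prod.mk y ⁻¹' _) = 0
    rw [this, Real.volume_singleton]
  -- identify the product with the space, to apply the result for self-maps of the space
  let L : (R2 × ℝ) ≃L[ℝ] R3 := ContinuousLinearEquiv.ofFinrankEq (by simp)
  have hL : volume (L '' {w | w.2 = h w.1}) = 0 := by
    have h1 : (volume : Measure R3) ≪ Measure.map L (volume : Measure (R2 × ℝ)) := by
      have : (volume : Measure (R2 × ℝ)).IsAddHaarMeasure :=
        inferInstanceAs ((volume : Measure R2).prod (volume : Measure ℝ)).IsAddHaarMeasure
      have := L.isAddHaarMeasure_map (volume : Measure (R2 × ℝ))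
      exact Measure.absolutelyContinuous_isAddHaarMeasure _ _
    refine h1 ?_
    have hm : MeasurableSet (L '' {w | w.2 = h w.1}) :=
      (L.toHomeomorph.isClosed_image.2 hclosed).measurableSet
    rw [Measure.map_apply L.continuous.measurable hm, L.injective.preimage_image]
    exact hgraph
  have heq : f '' {w | w.2 = h w.1} = (f ∘ L.symm) '' (L '' {w | w.2 = h w.1}) := by
    rw [← image_comp]
    refine image_congr fun w _ => ?_
    simp
  rw [heq]
  exact addHaar_image_eq_zero_of_differentiableOn_of_addHaar_eq_zero volume
    (hf.comp L.symm.differentiable).differentiableOn hL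

namespace ReferenceDomain

variable {D : ReferenceDomain} {c : CutoffData D.a D.b} {S : Set R3} {T : ℝ} {η : ℝ → R2 → ℝ}

/-- The largest region that is reached by the moving domain. -/
def envelope (D : ReferenceDomain) (c : CutoffData D.a D.b) : Set R3 :=
  D.Ω ∪ D.tube (Icc c.m c.M)

lemma zero_mem_Icc_displacement (c : CutoffData D.a D.b) : (0 : ℝ) ∈ Icc c.m c.M :=
  ⟨c.m_neg.le, c.M_pos.le⟩

lemma closure_subset_envelope (c : CutoffData D.a D.b) : closure D.Ω ⊆ D.envelope c := by
  rw [closure_eq_self_union_frontier, D.frontier_eq]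
  refine union_subset_union_right _ ?_
  rintro _ ⟨y, rfl⟩
  exact ⟨y, 0, zero_mem_Icc_displacement c, by simp⟩

lemma isCompact_envelope (c : CutoffData D.a D.b) : IsCompact (D.envelope c) := by
  have h : D.envelope c = closure D.Ω ∪ D.tube (Icc c.m c.M) :=
    Subset.antisymm (union_subset_union_left _ subset_closure)
      (union_subset (closure_subset_envelope c) subset_union_right)
  rw [h]
  exact D.isBounded.isCompact_closure.union (D.isCompact_tube_Icc _ _)

lemma isBounded_union (hS : D.IsTubularNhd c.m c.M S) : Bornology.IsBounded (D.Ω ∪ S) := by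
  refine D.isBounded.union ((D.isCompact_tube_Icc D.a D.b).isBounded.subset
    (hS.subset_tube.trans ?_))
  rintro x ⟨y, z, hz, rfl⟩
  exact ⟨y, z, Ioo_subset_Icc_self hz, rfl⟩

lemma moving_subset_envelope {t : ℝ} (hη : TorusPeriodic (η t))
    (hb : ∀ y, η t y ∈ Icc c.m c.M) : D.moving c η t ⊆ D.envelope c := by
  rw [moving_eq c hη hb]
  rintro _ (hx | ⟨⟨y, z⟩, hz, rfl⟩)
  · exact Or.inl hx.1
  · rcases lt_or_ge z 0 with h | h
    · exact Or.inl (D.tubeMap_mem hz.1 h)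
    · refine Or.inr (D.tubeMap_mem_tube ⟨c.m_neg.le.trans h, ?_⟩)
      exact (le_of_lt hz.2).trans (hb y).2

lemma measurableSet_tube_Ioo (D : ReferenceDomain) (z₁ z₂ : ℝ) :
    MeasurableSet (D.tube (Ioo z₁ z₂)) := by
  rw [tube_eq_image]
  exact measurableSet_image_of_isOpen D.contDiff_tubeMap.continuous (isOpen_univ.prod isOpen_Ioo)

/-- The moving domain satisfies the hypotheses of the transport theory. Its space-time
boundary consists of the graph of the displacement, which is a null set at each time. -/
lemma movingDomain (hS : D.IsTubularNhd c.m c.M S) (hT : 0 < T)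
    (hper : ∀ t ∈ Icc (0 : ℝ) T, TorusPeriodic (η t))
    (hcont : ContinuousOn (fun z : ℝ × R2 => η z.1 z.2) (Icc (0 : ℝ) T ×ˢ univ))
    (hb : ∀ t ∈ Icc (0 : ℝ) T, ∀ y, η t y ∈ Icc c.m c.M) :
    ∃ ε₀, MovingDomain T (D.moving c η) (D.envelope c) (D.Ω ∪ S) ε₀ := by
  have hKB : D.envelope c ⊆ D.Ω ∪ S := union_subset_union_right _ hS.tube_subset
  have hB : IsOpen (D.Ω ∪ S) := D.isOpen.union hS.isOpen
  have hΨ := D.contDiff_tubeMap.continuous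
  obtain ⟨δ, hδ, hδB⟩ := (isCompact_envelope c).exists_cthickening_subset_open hB hKB
  have hslice : ∀ t ∈ Icc 0 T, Continuous (η t) := fun t ht =>
    hcont.comp_continuous (Continuous.prodMk_right t) fun y => ⟨ht, mem_univ _⟩
  have hΩt : MeasurableSet (D.Ω \ D.tube (Ioo D.a D.b)) :=
    D.isOpen.measurableSet.diff (D.measurableSet_tube_Ioo _ _)
  refine ⟨δ / 2, hT, fun t ht => ?_, ?_, fun t ht => moving_subset_envelope (hper t ht) (hb t ht),
    isCompact_envelope c, hB, isBounded_union hS, by positivity, fun x hx => ?_, fun t ht => ?_⟩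
  · rw [moving_eq c (hper t ht) (hb t ht)]
    refine hΩt.union (measurableSet_image_of_isOpen hΨ ?_)
    exact (isOpen_lt continuous_const continuous_snd).inter
      (isOpen_lt continuous_snd ((hslice t ht).comp continuous_fst))
  · have heq : spaceTime T (D.moving c η) = Ioo 0 T ×ˢ (D.Ω \ D.tube (Ioo D.a D.b)) ∪
        (fun w : ℝ × R2 × ℝ => (w.1, D.tubeMap w.2)) ''
          {w | w.1 ∈ Ioo 0 T ∧ D.a < w.2.2 ∧ w.2.2 < η w.1 w.2.1} := by
      ext ⟨s, x⟩
      constructor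
      · rintro ⟨hs, hx⟩
        have hs' := Ioo_subset_Icc_self hs
        simp only at hs hx hs'
        rw [moving_eq c (hper s hs') (hb s hs')] at hx
        rcases hx with hx | ⟨w, hw, rfl⟩
        · exact Or.inl ⟨hs, hx⟩
        · exact Or.inr ⟨(s, w), ⟨hs, hw⟩, rfl⟩
      · rintro (⟨hs, hx⟩ | ⟨⟨s', w⟩, ⟨hs, hw⟩, he⟩)
        · have hs' := Ioo_subset_Icc_self hs
          refine ⟨hs, ?_⟩
          simp only at hs hx hs' ⊢
          rw [moving_eq c (hper s hs') (hb s hs')]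
          exact Or.inl hx
        · obtain ⟨rfl, rfl⟩ := Prod.mk.inj he
          have hs' := Ioo_subset_Icc_self hs
          refine ⟨hs, ?_⟩
          simp only at hs hs' hw ⊢
          rw [moving_eq c (hper s' hs') (hb s' hs')]
          exact Or.inr ⟨w, hw, rfl⟩
    rw [heq]
    refine (measurableSet_Ioo.prod hΩt).union (measurableSet_image_of_isOpen
      (continuous_fst.prodMk (hΨ.comp continuous_snd)) ?_)
    have h1 : ContinuousOn (fun w : ℝ × R2 × ℝ => η w.1 w.2.1 - w.2.2) (Ioo 0 T ×ˢ univ) := by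
      refine ContinuousOn.sub (hcont.comp (continuous_fst.prodMk
        (continuous_fst.comp continuous_snd)).continuousOn fun w hw =>
          ⟨Ioo_subset_Icc_self hw.1, mem_univ _⟩) (continuous_snd.comp continuous_snd).continuousOn
    have h2 := h1.isOpen_inter_preimage (isOpen_Ioo.prod isOpen_univ) (isOpen_Ioi (a := (0 : ℝ)))
    have h3 : IsOpen {w : ℝ × R2 × ℝ | D.a < w.2.2} :=
      isOpen_lt continuous_const (continuous_snd.comp continuous_snd)
    -- the displacement is continuous on the closed time interval only, hence the intersection
    have heqset : {w : ℝ × R2 × ℝ | w.1 ∈ Ioo 0 T ∧ D.a < w.2.2 ∧ w.2.2 < η w.1 w.2.1} =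
        (Ioo 0 T ×ˢ univ ∩ (fun w : ℝ × R2 × ℝ => η w.1 w.2.1 - w.2.2) ⁻¹' Ioi 0) ∩
          {w | D.a < w.2.2} := by
      ext w
      constructor
      · rintro ⟨h4, h5, h6⟩
        exact ⟨⟨⟨h4, mem_univ _⟩, sub_pos.2 h6⟩, h5⟩
      · rintro ⟨⟨⟨h4, -⟩, h6⟩, h5⟩
        exact ⟨h4, h5, sub_pos.1 h6⟩
    rw [heqset]
    exact h2.inter h3
  · rw [mul_div_cancel₀ _ two_ne_zero]
    exact (Metric.closedBall_subset_cthickening hx δ).trans hδB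
  · -- outside of a null set, the points in the closure of the domain belong to the domain
    have n1 := volume_image_graph (D.contDiff_tubeMap.differentiable one_ne_zero) (hslice t ht)
    have n2 := volume_image_graph (D.contDiff_tubeMap.differentiable one_ne_zero)
      (continuous_const (y := D.a))
    filter_upwards [measure_eq_zero_iff_ae_notMem.1 n1, measure_eq_zero_iff_ae_notMem.1 n2]
      with x hx1 hx2 hxA
    have hxA' := hxA
    rw [moving_eq c (hper t ht) (hb t ht)] at hxA'
    -- the part of the reference domain outside of the tubular neighbourhood does not
    -- accumulate at `x`
    have e1 : ∀ᶠ x' in 𝓝 x, x' ∉ D.Ω \ D.tube (Ioo D.a D.b) := by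
      by_cases hcl : x ∈ closure D.Ω
      · have hxS : x ∈ S := by
          refine hS.tube_subset ?_
          rcases closure_subset_envelope c hcl with h | h
          · by_cases hxt : x ∈ D.tube (Ioo D.a D.b)
            · obtain ⟨y, z, hz, rfl⟩ := hxt
              have hz0 : z < 0 := by
                by_contra h0
                exact D.tubeMap_notMem (not_lt.1 h0) hz.2 h
              refine ⟨y, z, ⟨?_, hz0.le.trans c.M_pos.le⟩, rfl⟩
              by_contra hlt
              refine hxA' (Or.inr ⟨(y, z), ⟨hz.1, ?_⟩, rfl⟩)
              exact (not_le.1 hlt).trans_le (hb t ht y).1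
            · exact absurd (Or.inl ⟨h, hxt⟩) hxA'
          · exact h
        filter_upwards [hS.isOpen.mem_nhds hxS] with x' hx' hmem
        exact hmem.2 (hS.subset_tube hx')
      · filter_upwards [isClosed_closure.isOpen_compl.mem_nhds hcl] with x' hx' hmem
        exact hx' (subset_closure hmem.1)
    -- the remaining part of the domains lies in a compact subset of space-time
    set Q : Set (ℝ × R2 × ℝ) := (Icc 0 T ×ˢ closedCell ×ˢ Icc D.a c.M) ∩
      {w | w.2.2 ≤ η w.1 w.2.1} with hQ
    have hbox : IsCompact (Icc (0 : ℝ) T ×ˢ closedCell ×ˢ Icc D.a c.M) :=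
      isCompact_Icc.prod (isCompact_closedCell.prod isCompact_Icc)
    have hQc : IsCompact Q := by
      have h1 : ContinuousOn (fun w : ℝ × R2 × ℝ => η w.1 w.2.1 - w.2.2)
          (Icc (0 : ℝ) T ×ˢ closedCell ×ˢ Icc D.a c.M) := by
        refine ContinuousOn.sub (hcont.comp (continuous_fst.prodMk
          (continuous_fst.comp continuous_snd)).continuousOn fun w hw => ⟨hw.1, mem_univ _⟩)
          (continuous_snd.comp continuous_snd).continuousOn
      have h2 := h1.preimage_isClosed_of_isClosed hbox.isClosed (isClosed_Ici (a := (0 : ℝ)))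
      refine hbox.of_isClosed_subset ?_ inter_subset_left
      convert h2 using 1
      ext w
      simp [hQ]
    -- the image of `Q` is closed in space-time, so it does not meet a neighbourhood of `(t, x)`
    have hF := (hQc.image (continuous_fst.prodMk (hΨ.comp continuous_snd) :
      Continuous fun w : ℝ × R2 × ℝ => (w.1, D.tubeMap w.2))).isClosed
    have hnot : (t, x) ∉ (fun w : ℝ × R2 × ℝ => (w.1, D.tubeMap w.2)) '' Q := by
      rintro ⟨⟨s, y, z⟩, ⟨⟨-, -, hz⟩, hle⟩, he⟩
      obtain ⟨rfl, rfl⟩ := Prod.mk.inj he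
      simp only [mem_ofPred_eq] at hz hle
      have k1 : z ≠ D.a := fun h => hx2 ⟨(y, z), h, rfl⟩
      have k2 : z ≠ η s y := fun h => hx1 ⟨(y, z), h, rfl⟩
      exact hxA' (Or.inr ⟨(y, z), ⟨lt_of_le_of_ne hz.1 k1.symm, lt_of_le_of_ne hle k2⟩, rfl⟩)
    have e2 : ∀ᶠ z in 𝓝 (t, x), z ∉ (fun w : ℝ × R2 × ℝ => (w.1, D.tubeMap w.2)) '' Q :=
      hF.isOpen_compl.mem_nhds hnot
    have e3 : ∀ᶠ z in 𝓝 (t, x), z.2 ∉ D.Ω \ D.tube (Ioo D.a D.b) :=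
      (continuous_snd.tendsto (t, x)).eventually e1
    filter_upwards [nhdsWithin_le_nhds e2, nhdsWithin_le_nhds e3, self_mem_nhdsWithin]
      with z k2 k3 hz hmem
    rw [moving_eq c (hper z.1 hz.1) (hb z.1 hz.1)] at hmem
    rcases hmem with h | ⟨⟨y, w⟩, hw, he⟩
    · exact k3 h
    · obtain ⟨y', hy', hyy'⟩ := exists_mem_closedCell y
      have hw' : D.a < w ∧ w < η z.1 y := hw
      refine k2 ⟨(z.1, y', w), ⟨⟨hz.1, hy', hw'.1.le, hw'.2.le.trans (hb z.1 hz.1 y).2⟩, ?_⟩, ?_⟩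
      · simp only [mem_ofPred_eq]
        rw [← hper z.1 hz.1 y y' hyy']
        exact hw'.2.le
      · exact Prod.ext rfl ((D.tubeMap_congr hyy' w).symm.trans he)

end ReferenceDomain

end

theorem lemma2p5
    (D : ReferenceDomain) (c : CutoffData D.a D.b)
    (S : Set R3) (hS : D.IsTubularNhd c.m c.M S)
    (T : ℝ) (hT : 0 < T)
    (η : ℝ → R2 → ℝ) (hη : MemX T η)
    (hηb : ∀ t ∈ Icc (0 : ℝ) T, ∀ y, η t y ∈ Icc c.m c.M)
    (M : ℕ) (hM : 1 ≤ M)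
    (γ : Fin M → ℝ≥0∞) (γmin : ℝ≥0∞) (hγmin : γmin = ⨅ i, γ i) (hγ : 2 ≤ γmin)
    (q : ℝ≥0∞) (hq : 2 < γmin → 1 ≤ q ∧ q < 2 ∧ 1 / γmin + 1 / q ≤ 1) (hq2 : γmin = 2 → q = 2)
    (r : ℝ → R3 → Fin M → ℝ)
    (hr : ∀ i, MemLpLq T (D.moving c η) ⊤ (γ i) (fun t x => r t x i))
    (hr0 : ∀ᵐ z ∂((volume : Measure (ℝ × R3)).restrict (spaceTime T (D.moving c η))),
      ∀ i, 0 ≤ r z.1 z.2 i)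
    (u : ℝ → R3 → R3) (Du : ℝ → R3 → R3 →L[ℝ] R3)
    (hu : MemLpW1 T (D.Ω ∪ S) 2 q u Du)
    (hcont : ∀ i, IsWeakContinuitySol T (D.moving c η) u (fun t x => r t x i)) :
    ∃ r' : ℝ → R3 → Fin M → ℝ,
      (∀ᵐ z ∂((volume : Measure (ℝ × R3)).restrict (spaceTime T (D.moving c η))),
        r' z.1 z.2 = r z.1 z.2) ∧
      (∀ t ∈ Icc (0 : ℝ) T,
        (∀ i, MemLp (fun x => r' t x i) (γ i) (volume.restrict (D.moving c η t))) ∧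
        ∀ᵐ x ∂((volume : Measure R3).restrict (D.moving c η t)), ∀ i, 0 ≤ r' t x i) ∧
      ∀ 𝓑 : (Fin M → ℝ) → ℝ, IsRenormalizer 𝓑 →
        IsRenormalizedSol T (D.moving c η) u Du 𝓑 r' := by
  obtain ⟨ε₀, m⟩ := ReferenceDomain.movingDomain hS hT hη.periodic hη.continuousOn hηb
  have hKB : D.envelope c ⊆ D.Ω ∪ S := union_subset_union_right _ hS.tube_subset
  have hγi : ∀ i, γmin ≤ γ i := fun i => hγmin ▸ iInf_le γ i
  obtain ⟨hc, hpq, hqt⟩ := conjExponent_le_of_hypotheses hγ hq hq2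
  exact exists_renormalized_representative (p := γmin.conjExponent) m hKB hγ hγi hpq hqt hr hr0 hu
    hcont
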